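/- **Theorem (Safety of D-DEMOS).** *System.* Fix numbers of voters $n$, options $m$, vote collectors (VC) $N_v$, bulletin boards (BB) $N_b$ and trustees $N_t$, and thresholds $f_v<2^{64}$, $f_b$, $h_t$ with $N_v>3f_v$, $N_b>2f_b$, $1\le h_t\le N_t$; fix a group of prime order $q$ with $q>2^{128}$ and $n,N_v,N_t<q$. An honest, afterwards destroyed election authority gives each voter a ballot with a serial number and two parts; each part lists for every option a 160-bit vote code (random, distinct within the ballot) and a uniformly random 64-bit receipt. Each VC node gets a signature key, shuffled salted hashes of all vote codes, and shares of all receipts and of a master key under Pedersen $(N_v-f_v,N_v)$-verifiable secret sharing. Each BB node gets the vote codes encrypted under the master key, a salted hash of the master key, and lifted ElGamal commitments to the unit vectors encoding the options; the openings of these commitments are $(h_t,N_t)$-secret-shared among the trustees. *Protocol.* An honest voter picks a part of her ballot at random and posts the vote code of her option to VC nodes, one after the other and none of them twice, listening to one answer (or giving up) each time, until the answer is the receipt printed next to that vote code (a *valid receipt*). A VC node that is asked collects signatures of $N_v-f_v$ VC nodes on (serial number, vote code) — a uniqueness certificate; an honest VC node signs at most one vote code per ballot — and then all honest VC nodes that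 see the certificate during voting hours disclose their shares of the receipt; $N_v-f_v$ valid shares determine the receipt, which is sent to the voter. After its election end time a VC node announces, for each ballot, the certified vote code it knows (or none), waits for $N_v-f_v$ announcements, adopts a certified vote code found there, and enters binary consensus on "is there a valid vote code?", where all honest nodes obtain the same decision, which is the opinion of some honest node. On decision 0 the ballot is not voted; on decision 1 it is voted with the certified vote code, which is requested from the other nodes if it is not known locally. Each VC node then sends its list of (serial number, vote code) pairs and its master key share to all BB nodes. A BB node publishes a list received from $f_v+1$ VC nodes, reconstructs the master key from $N_v-f_v$ valid shares that match its hash, and decrypts the vote codes. Trustees read data on which $f_b+1$ BB nodes agree, and post their shares of the opening of the sum of the commitments belonging to the listed vote codes; a BB node publishes the result when $h_t$ valid shares open this sum. *Adversary.* The adversary $\mathcal A$ is a (non-uniform, probabilistic) polynomial-size, polynomially-many-round machine in the security parameter $\lambda$. It controls a fixed set of at most $f_v$ VC nodes, at most $f_b$ BB nodes and at most $N_t-h_t$ trustees, corrupts voters adaptively, controls all clocks, reads all messages, and delays, drops, repeats and reorders them; it cannot forge messages of honest VC nodes on authenticated channels or answers of honest VC nodes to honest voters. The signature scheme is efficient and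 existentially unforgeable under chosen-message attacks, and the (keyed) hash function is collision resistant, against such machines. *Claim.* For every such $\mathcal A$ there is a negligible function $\mathsf{negl}$ such that, for every $\lambda$ and every voter $V$, the probability that $V$ is never corrupted, receives a valid receipt from a VC node, and yet her vote is not published on the honest BB nodes and included in the election tally, is at most $$\mathsf{negl}(\lambda)+\frac{f_v}{2^{64}-f_v}.$$ Here "published and included" means: every list published by an honest BB node contains $V$'s serial number with her vote code; every result published by an honest BB node gives, for each option, the number of ballots that such a list containing $V$'s vote records with a vote code of that option; and, if at the end all clocks have passed the election end time, all messages between honest parties in the phase after voting have been delivered and no honest party has anything left to do, then every honest BB node has published a list and a result. -/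

import Mathlib

open scoped Classical in
/-- Probability of an event when an element of the finite space `Ω` is drawn uniformly. -/
noncomputable def prob {Ω : Type} [Finite Ω] (E : Ω → Prop) : ℝ :=
  (Nat.card {ω : Ω // E ω} : ℝ) / (Nat.card Ω : ℝ)

/-- `f` is negligible: it vanishes faster than every inverse polynomial. -/
def Negligible (f : ℕ → ℝ) : Prop :=
  Asymptotics.SuperpolynomialDecay Filter.atTop (fun k : ℕ => (k : ℝ)) f

def PolyBounded (f : ℕ → ℕ) : Prop := ∃ p : Polynomial ℕ, ∀ k, f k ≤ p.eval k

/-! ### Boolean circuits and efficient (non-uniform, probabilistic, interactive) machines -/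

/-- The values carried by wires that are named by the elements of `α`. -/
abbrev Wires (α : Type) := α → Bool

/-- Strings of `w` bits. -/
abbrev Str (w : ℕ) := Wires (Fin w)

/-- `CircuitSize f s`: the map `f` is computed by a Boolean circuit with `s` NAND gates.
Rewiring (with fan-out) and constant wires are free. -/
inductive CircuitSize : {α β : Type} → (Wires α → Wires β) → ℕ → Prop
  | wire {α β : Type} (f : β → α) : CircuitSize (fun x b => x (f b)) 0
  | const {α β : Type} (v : Wires β) : CircuitSize (fun _ : Wires α => v) 0
  | nand {α : Type} (i j : α) : CircuitSize (fun (x : Wires α) (_ : Unit) => !(x i && x j)) 1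
  | comp {α β γ : Type} {f : Wires α → Wires β} {g : Wires β → Wires γ} {s t : ℕ}
      (hf : CircuitSize f s) (hg : CircuitSize g t) : CircuitSize (fun x => g (f x)) (s + t)
  | pair {α β γ : Type} {f : Wires α → Wires β} {g : Wires α → Wires γ} {s t : ℕ}
      (hf : CircuitSize f s) (hg : CircuitSize g t) :
      CircuitSize (fun x => (Sum.elim (f x) (g x) : Wires (β ⊕ γ))) (s + t)

/-- A family of maps is efficient if it has circuits of polynomial size. -/
def PolySize {α β : ℕ → Type} (f : ∀ k, Wires (α k) → Wires (β k)) : Prop :=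
  ∃ s : ℕ → ℕ, PolyBounded s ∧ ∀ k, ∃ j ≤ s k, CircuitSize (f k) j

/-- A family, indexed by the security parameter, of interactive randomised machines.
In every round the machine reads its memory (initially all `false`), its random tape, a fixed
read-only input `View`, and the message `In` of its environment; it rewrites its memory and
sends a message `Out`. -/
structure Machine (View In Out : ℕ → Type) where
  rounds : ℕ → ℕ
  Mem : ℕ → Type
  coins : ℕ → ℕ
  step : ∀ k : ℕ, ℕ →
    Wires (Mem k ⊕ (Fin (coins k) ⊕ (View k ⊕ In k))) → Wires (Mem k ⊕ Out k)

/-- Polynomially many rounds, each of them computed by a circuit of polynomial size. -/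
def Machine.Efficient {View In Out : ℕ → Type} (M : Machine View In Out) : Prop :=
  PolyBounded M.rounds ∧
    ∃ s : ℕ → ℕ, PolyBounded s ∧ ∀ k, ∀ t < M.rounds k, ∃ j ≤ s k, CircuitSize (M.step k t) j

/-- The elements of a finite type are numbered and written in binary. -/
abbrev CodeWire (α : Type) := Fin (Nat.clog 2 (Nat.card α))

noncomputable def encode {α : Type} [Finite α] (a : α) : Wires (CodeWire α) :=
  fun i => ((Finite.equivFin α a : Fin (Nat.card α)) : ℕ).testBit i

open scoped Classical in
/-- Partial inverse of `encode`. -/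
noncomputable def decode {α : Type} [Finite α] (x : Wires (CodeWire α)) : Option α :=
  if h : ∃ a : α, encode a = x then some h.choose else none

/-! ### Digital signatures and existential unforgeability under chosen-message attacks -/

/-- A (possibly randomised) signature scheme for messages of `L` bits. -/
structure SigScheme (L : ℕ) where
  vkLen : ℕ → ℕ
  skLen : ℕ → ℕ
  sigLen : ℕ → ℕ
  genCoins : ℕ → ℕ
  signCoins : ℕ → ℕ
  gen : ∀ k, Str (genCoins k) → Str (vkLen k) × Str (skLen k)
  sign : ∀ k, Str (skLen k) → Str L → Str (signCoins k) → Str (sigLen k)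
  verify : ∀ k, Str (vkLen k) → Str L → Str (sigLen k) → Bool
  correct : ∀ k r m c, verify k (gen k r).1 m (sign k (gen k r).2 m c) = true

/-- Keys, signatures and random tapes have polynomial length, and the three algorithms of the
scheme are efficient. -/
def SigScheme.Efficient {L : ℕ} (Sg : SigScheme L) : Prop :=
  (PolyBounded Sg.vkLen ∧ PolyBounded Sg.skLen ∧ PolyBounded Sg.sigLen ∧
    PolyBounded Sg.genCoins ∧ PolyBounded Sg.signCoins) ∧
  PolySize (α := fun k => Fin (Sg.genCoins k)) (β := fun k => Fin (Sg.vkLen k) ⊕ Fin (Sg.skLen k))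
    (fun k r => Sum.elim (Sg.gen k r).1 (Sg.gen k r).2) ∧
  PolySize (α := fun k => Fin (Sg.skLen k) ⊕ (Fin L ⊕ Fin (Sg.signCoins k)))
    (β := fun k => Fin (Sg.sigLen k))
    (fun k x => Sg.sign k (fun i => x (.inl i)) (fun i => x (.inr (.inl i)))
      (fun i => x (.inr (.inr i)))) ∧
  PolySize (α := fun k => Fin (Sg.vkLen k) ⊕ (Fin L ⊕ Fin (Sg.sigLen k))) (β := fun _ => Unit)
    (fun k x _ => Sg.verify k (fun i => x (.inl i)) (fun i => x (.inr (.inl i)))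
      (fun i => x (.inr (.inr i))))

/-- The messages of a forger: a bit telling whether it makes a signing query, the query, and a
candidate forgery (message and signature). -/
abbrev ForgerOut {L : ℕ} (Sg : SigScheme L) (k : ℕ) : Type :=
  Unit ⊕ (Fin L ⊕ (Fin L ⊕ Fin (Sg.sigLen k)))

/-- A forger knows the verification key and receives the answers to its signing queries. -/
abbrev Forger {L : ℕ} (Sg : SigScheme L) :=
  Machine (fun k => Fin (Sg.vkLen k)) (fun k => Fin (Sg.sigLen k)) (ForgerOut Sg)

/-- Memory of the forger, last answer, messages queried so far, "a forgery was output". -/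
structure ForgeState {L : ℕ} (Sg : SigScheme L) (M : Forger Sg) (k : ℕ) where
  mem : Wires (M.Mem k)
  answer : Str (Sg.sigLen k)
  queried : Set (Str L)
  won : Prop

/-- The first `t` rounds of the chosen-message attack. The forger wins as soon as it outputs a
valid signature on a message that it has not queried so far. -/
noncomputable def forgeRun {L : ℕ} (Sg : SigScheme L) (M : Forger Sg) (k : ℕ)
    (keyCoins : Str (Sg.genCoins k)) (signCoins : Fin (M.rounds k) → Str (Sg.signCoins k))
    (coins : Str (M.coins k)) : ℕ → ForgeState Sg M k
  | 0 => ⟨fun _ => false, fun _ => false, ∅, False⟩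
  | t + 1 =>
    let s := forgeRun Sg M k keyCoins signCoins coins t
    let y := M.step k t (Sum.elim s.mem (Sum.elim coins
      (Sum.elim (Sg.gen k keyCoins).1 s.answer)))
    let query : Str L := fun i => y (.inr (.inr (.inl i)))
    let asks : Bool := y (.inr (.inl ()))
    let candMsg : Str L := fun i => y (.inr (.inr (.inr (.inl i))))
    let candSig : Str (Sg.sigLen k) := fun i => y (.inr (.inr (.inr (.inr i))))
    { mem := fun i => y (.inl i)
      answer := if asks = true then
          Sg.sign k (Sg.gen k keyCoins).2 query
            (if h : t < M.rounds k then signCoins ⟨t, h⟩ else fun _ => false)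
        else fun _ => false
      queried := if asks = true then insert query s.queried else s.queried
      won := s.won ∨
        (Sg.verify k (Sg.gen k keyCoins).1 candMsg candSig = true ∧ candMsg ∉ s.queried) }

/-- Existential unforgeability under adaptive chosen-message attacks. -/
def SigScheme.Unforgeable {L : ℕ} (Sg : SigScheme L) : Prop :=
  ∀ M : Forger Sg, M.Efficient →
    Negligible fun k =>
      prob fun ω : Str (Sg.genCoins k) × (Fin (M.rounds k) → Str (Sg.signCoins k)) ×
          Str (M.coins k) =>
        (forgeRun Sg M k ω.1 ω.2.1 ω.2.2 (M.rounds k)).won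

/-! ### Collision-resistant hashing -/

/-- A keyed family of hash functions on bit strings. -/
structure HashFamily where
  keyLen : ℕ → ℕ
  digestLen : ℕ → ℕ
  hash : ∀ k, Str (keyLen k) → ∀ w : ℕ, Str w → Str (digestLen k)

/-- No efficient algorithm that is given a random key finds two strings of a prescribed length
that collide, except with negligible probability. -/
def HashFamily.CollisionResistant (H : HashFamily) : Prop :=
  ∀ (w : ℕ) (coins : ℕ → ℕ)
    (f : ∀ k, Wires (Fin (coins k) ⊕ Fin (H.keyLen k)) → Wires (Fin w ⊕ Fin w)),
    PolySize f →
      Negligible fun k => prob fun ω : Str (coins k) × Str (H.keyLen k) =>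
        let y := f k (Sum.elim ω.1 ω.2)
        let x₁ : Str w := fun i => y (.inl i)
        let x₂ : Str w := fun i => y (.inr i)
        x₁ ≠ x₂ ∧ H.hash k ω.2 w x₁ = H.hash k ω.2 w x₂

/-! ### Election parameters -/

abbrev Code := Str 160
abbrev Receipt := Str 64
abbrev Salt := Str 64
abbrev MasterKey := Str 128

/-- Public parameters of an election: `n` voters, `m` options, `Nv` vote collectors (VC) with
fault threshold `fv`, `Nb` bulletin boards (BB) with fault threshold `fb`, `Nt` trustees with
reconstruction threshold `ht`; the serial numbers of the ballots; a group `G` of prime order `q`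
with two nontrivial elements, used by Pedersen's secret sharing and by the lifted ElGamal
commitments; a symmetric encryption scheme with 128-bit keys for vote codes. -/
structure Params where
  (n m Nv fv Nb fb Nt ht q : ℕ)
  serial : Fin n ↪ Str 64
  prime_q : q.Prime
  n_lt : n < q
  Nv_lt : Nv < q
  Nt_lt : Nt < q
  key_lt : 2 ^ 128 < q
  G : Type
  [group : CommGroup G]
  [finite : Finite G]
  card_G : Nat.card G = q
  (g h : G)
  g_ne : g ≠ 1
  h_ne : h ≠ 1
  (IV Cipher : Type)
  [finite_IV : Finite IV]
  [finite_Cipher : Finite Cipher]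
  enc : MasterKey → IV → Code → Cipher
  dec : MasterKey → Cipher → Code
  dec_enc : ∀ key iv c, dec key (enc key iv c) = c

attribute [instance] Params.group Params.finite Params.finite_IV Params.finite_Cipher

instance (P : Params) : NeZero P.q := ⟨P.prime_q.ne_zero⟩
instance (P : Params) : Fact P.q.Prime := ⟨P.prime_q⟩

/-- Number of endorsements in a uniqueness certificate, and of shares that open a receipt. -/
abbrev Params.thr (P : Params) : ℕ := P.Nv - P.fv

/-- The lines of a ballot as printed: part (`A` or `B`) and option. -/
abbrev Line (P : Params) := Bool × Fin P.m

/-- The lines of a ballot as stored by the servers: part and (shuffled) position. -/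
abbrev Pos (P : Params) := Bool × Fin P.m

/-- At most one vote code per serial number. -/
abbrev VoteSet (P : Params) := Fin P.n → Option Code

/-! ### Pedersen's verifiable secret sharing and lifted ElGamal commitments -/

/-- A share: values of the secret polynomial and of the blinding polynomial. -/
abbrev Share (P : Params) := ZMod P.q × ZMod P.q

/-- Random coefficients of a sharing with threshold `t`. The constant coefficient of the secret
polynomial is replaced by the secret (see `secretCoeff`). -/
abbrev VssCoins (P : Params) (t : ℕ) := (Fin t → ZMod P.q) × (Fin t → ZMod P.q)

def secretCoeff {P : Params} {t : ℕ} (secret : ZMod P.q) (r : VssCoins P t) (j : Fin t) :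
    ZMod P.q :=
  if j.val = 0 then secret else r.1 j

/-- The evaluation point of the participant with index `i`. -/
def point (P : Params) (i : ℕ) : ZMod P.q := (i : ZMod P.q) + 1

def vssShare {P : Params} {t : ℕ} (secret : ZMod P.q) (r : VssCoins P t) (i : ℕ) : Share P :=
  (∑ j, secretCoeff secret r j * point P i ^ j.val, ∑ j, r.2 j * point P i ^ j.val)

/-- `g ^ x * h ^ y`. -/
def pedersen {P : Params} (x y : ZMod P.q) : P.G := P.g ^ x.val * P.h ^ y.val

/-- Public verification data: commitments to the coefficients. -/
def vssCommit {P : Params} {t : ℕ} (secret : ZMod P.q) (r : VssCoins P t) : Fin t → P.G :=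
  fun j => pedersen (secretCoeff secret r j) (r.2 j)

def vssVerify {P : Params} {t : ℕ} (C : Fin t → P.G) (i : ℕ) (x : Share P) : Prop :=
  pedersen x.1 x.2 = ∏ j, C j ^ (point P i ^ j.val).val

/-- Reconstruction from the values held by the participants in `Q`. -/
noncomputable def vssRec {P : Params} {N : ℕ} (Q : Finset (Fin N)) (x : Fin N → ZMod P.q) :
    ZMod P.q :=
  (Lagrange.interpolate Q (fun i => point P i) x).eval 0

/-- Lifted ElGamal commitment to `e` with randomness `r`. -/
def elgamal {P : Params} (e r : ZMod P.q) : P.G × P.G :=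
  (P.g ^ r.val, P.g ^ e.val * P.h ^ r.val)

/-- Bit strings as elements of `ZMod q`, and back. -/
def bitsToZ (P : Params) {w : ℕ} (x : Str w) : ZMod P.q := (Nat.ofBits x : ℕ)

def bitsOfZ {P : Params} (w : ℕ) (z : ZMod P.q) : Str w := fun i => z.val.testBit i

/-! ### Setup by the election authority -/

/-- All random choices of the election authority, except for signature keys and the hash key,
together with the honest voters' random choices of a ballot part. -/
structure Setup (P : Params) where
  code : Fin P.n → {c : Line P → Code // Function.Injective c}
  receipt : Fin P.n → Line P → Receipt
  salt : Fin P.n → Pos P → Salt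
  perm : Fin P.n → Bool → Equiv.Perm (Fin P.m)
  receiptVss : Fin P.n → Line P → VssCoins P P.thr
  msk : MasterKey
  mskSalt : Salt
  mskVss : VssCoins P P.thr
  iv : Fin P.n → Pos P → P.IV
  comRand : Fin P.n → Line P → Fin P.m → ZMod P.q
  /-- sharing of the entries of the encoded options, and of the commitment randomness -/
  openVss : Fin P.n → Line P → Fin P.m → VssCoins P P.ht × VssCoins P P.ht
  part : Fin P.n → Bool

set_option synthInstance.maxHeartbeats 400000 in
set_option synthInstance.maxSize 4096 in
instance (P : Params) : Finite (Setup P) :=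
  Finite.of_injective (fun s : Setup P => (s.code, s.receipt, s.salt, s.perm, s.receiptVss, s.msk,
    s.mskSalt, s.mskVss, s.iv, s.comRand, s.openVss, s.part)) (by
      rintro ⟨⟩ ⟨⟩ h
      simpa using h)

namespace Setup

variable {P : Params} (e : Setup P)

/-- The printed line behind a shuffled position. -/
def line (ℓ : Fin P.n) (p : Pos P) : Line P := (p.1, e.perm ℓ p.1 p.2)

def codeAt (ℓ : Fin P.n) (p : Pos P) : Code := (e.code ℓ).1 (e.line ℓ p)

/-- Share of VC node `i` of the receipt at position `p`, and its verification data. -/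
def receiptShare (ℓ : Fin P.n) (p : Pos P) (i : Fin P.Nv) : Share P :=
  vssShare (bitsToZ P (e.receipt ℓ (e.line ℓ p))) (e.receiptVss ℓ (e.line ℓ p)) i

def receiptCommit (ℓ : Fin P.n) (p : Pos P) : Fin P.thr → P.G :=
  vssCommit (bitsToZ P (e.receipt ℓ (e.line ℓ p))) (e.receiptVss ℓ (e.line ℓ p))

/-- Share of VC node `i` of the master key, and its verification data. -/
def mskShare (i : Fin P.Nv) : Share P := vssShare (bitsToZ P e.msk) e.mskVss i

def mskCommit : Fin P.thr → P.G := vssCommit (bitsToZ P e.msk) e.mskVss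

/-- Encrypted vote code on the bulletin boards. -/
def cipher (ℓ : Fin P.n) (p : Pos P) : P.Cipher := P.enc e.msk (e.iv ℓ p) (e.codeAt ℓ p)

/-- Entry `o` of the unit vector that encodes the option at position `p`. -/
def entry (ℓ : Fin P.n) (p : Pos P) (o : Fin P.m) : ZMod P.q :=
  if o = (e.line ℓ p).2 then 1 else 0

/-- Commitment to the encoded option at position `p`, entry by entry. -/
def com (ℓ : Fin P.n) (p : Pos P) (o : Fin P.m) : P.G × P.G :=
  elgamal (e.entry ℓ p o) (e.comRand ℓ (e.line ℓ p) o)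

/-- Share of trustee `t` of the opening (entry, randomness) of that commitment. -/
def openShare (ℓ : Fin P.n) (p : Pos P) (o : Fin P.m) (t : Fin P.Nt) : Share P × Share P :=
  (vssShare (e.entry ℓ p o) (e.openVss ℓ (e.line ℓ p) o).1 t,
    vssShare (e.comRand ℓ (e.line ℓ p) o) (e.openVss ℓ (e.line ℓ p) o).2 t)

def openCommit (ℓ : Fin P.n) (p : Pos P) (o : Fin P.m) :
    (Fin P.ht → P.G) × (Fin P.ht → P.G) :=
  (vssCommit (e.entry ℓ p o) (e.openVss ℓ (e.line ℓ p) o).1,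
    vssCommit (e.comRand ℓ (e.line ℓ p) o) (e.openVss ℓ (e.line ℓ p) o).2)

end Setup

/-! ### States of the components -/

/-- A uniqueness certificate: a signature (or nothing) for every VC node. -/
abbrev UCert (P : Params) (S : Type) := Fin P.Nv → Option S

/-- What an honest VC node records about one ballot. -/
structure VcBallot (P : Params) (S : Type) where
  /-- the vote code that the node has endorsed -/
  endorsed : Option Code
  /-- as a responder: the vote code for which endorsements are collected, and these -/
  asking : Option Code
  collected : UCert P S
  /-- the used vote code with its certificate (status pending or voted) -/
  cert : Option (Code × UCert P S)
  /-- receipt shares, the node's own one included once it is disclosed -/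
  shares : Fin P.Nv → Option (Share P)
  /-- the reconstructed receipt (status voted) -/
  receipt : Option Receipt
  /-- content of the node's ANNOUNCE message -/
  announced : Option (Code × UCert P S)
  /-- nodes whose ANNOUNCE message has arrived -/
  heard : Finset (Fin P.Nv)
  /-- opinion with which the node enters binary consensus -/
  proposal : Option Bool
  /-- final result for this ballot: not voted, or a vote code -/
  outcome : Option (Option Code)

set_option synthInstance.maxHeartbeats 400000 in
set_option synthInstance.maxSize 4096 in
instance (P : Params) (S : Type) [Finite S] : Finite (VcBallot P S) :=
  Finite.of_injective (fun s : VcBallot P S => (s.endorsed, s.asking, s.collected, s.cert,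
    s.shares, s.receipt, s.announced, s.heard, s.proposal, s.outcome)) (by
      rintro ⟨⟩ ⟨⟩ h
      simpa using h)

set_option synthInstance.maxHeartbeats 400000 in
set_option synthInstance.maxSize 4096 in
structure Voter (P : Params) where
  /-- the content of the ballot, once the voter is corrupted -/
  revealed : Option ((Line P → Code) × (Line P → Receipt))
  choice : Option (Fin P.m)
  /-- the vote code that is posted to VC nodes -/
  cast : Option Code
  /-- VC nodes contacted so far (none of them is contacted twice), and the one that the voter
  is waiting for -/
  tried : Finset (Fin P.Nv)
  current : Option (Fin P.Nv)
  /-- a receipt equal to the one on the ballot has been received -/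
  accepted : Bool
  deriving Fintype

/-- Opening shares of the homomorphic sum, one pair per option. -/
abbrev TallyShare (P : Params) := Fin P.m → Share P × Share P

set_option synthInstance.maxHeartbeats 400000 in
set_option synthInstance.maxSize 4096 in
structure BbState (P : Params) where
  /-- vote sets and master key shares received from the VC nodes -/
  sets : Fin P.Nv → Option (VoteSet P)
  keyShares : Fin P.Nv → Option (Share P)
  /-- the published vote set and master key (which publishes all decrypted vote codes) -/
  published : Option (VoteSet P)
  msk : Option MasterKey
  /-- data posted by the trustees, and the published election result -/
  posts : Fin P.Nt → Option (TallyShare P)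
  result : Option (Fin P.m → ZMod P.q)
  deriving Fintype

/-- Global state. Entries that belong to corrupted servers are not used. -/
structure State (P : Params) (S : Type) where
  voter : Fin P.n → Voter P
  vc : Fin P.Nv → Fin P.n → VcBallot P S
  /-- the clock of this VC node has reached the election end time -/
  closed : Fin P.Nv → Bool
  /-- result of the binary consensus for a ballot -/
  decision : Fin P.n → Option Bool
  /-- master key share that the VC node has sent at the end of its work -/
  sentKey : Fin P.Nv → Option (Share P)
  bb : Fin P.Nb → BbState P
  trustee : Fin P.Nt → Option (TallyShare P)

set_option synthInstance.maxHeartbeats 400000 in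
set_option synthInstance.maxSize 4096 in
instance (P : Params) (S : Type) [Finite S] : Finite (State P S) :=
  Finite.of_injective (fun s : State P S => (s.voter, s.vc, s.closed, s.decision, s.sentKey, s.bb,
    s.trustee)) (by
      rintro ⟨⟩ ⟨⟩ h
      simpa using h)

def VcBallot.map {P : Params} {S S' : Type} (f : S → S') (r : VcBallot P S) : VcBallot P S' :=
  { endorsed := r.endorsed
    asking := r.asking
    collected := fun i => (r.collected i).map f
    cert := r.cert.map fun c => (c.1, fun i => (c.2 i).map f)
    shares := r.shares
    receipt := r.receipt
    announced := r.announced.map fun c => (c.1, fun i => (c.2 i).map f)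
    heard := r.heard
    proposal := r.proposal
    outcome := r.outcome }

def State.map {P : Params} {S S' : Type} (f : S → S') (s : State P S) : State P S' :=
  { voter := s.voter
    vc := fun i ℓ => (s.vc i ℓ).map f
    closed := s.closed
    decision := s.decision
    sentKey := s.sentKey
    bb := s.bb
    trustee := s.trustee }

def State.initial (P : Params) (S : Type) : State P S :=
  { voter := fun _ => ⟨none, none, none, ∅, none, false⟩
    vc := fun _ _ => ⟨none, none, fun _ => none, none, fun _ => none, none, none, ∅, none, none⟩
    closed := fun _ => false
    decision := fun _ => none
    sentKey := fun _ => none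
    bb := fun _ => ⟨fun _ => none, fun _ => none, none, none, fun _ => none, none⟩
    trustee := fun _ => none }

/-! ### The protocol -/

set_option synthInstance.maxHeartbeats 400000 in
set_option synthInstance.maxSize 4096 in
/-- The adversary schedules everything: it delivers, delays, repeats, reorders or drops messages,
advances the clocks, decides when honest voters act, and acts for the corrupted parties.
`ℓ` is a ballot (or its voter), `i` the receiving VC node, `k` the sending VC node. Signatures
that are part of a message are supplied separately. -/
inductive Cmd (P : Params)
  /-- corrupt a voter -/
  | corrupt (ℓ : Fin P.n)
  /-- initialise an honest voter, with the option she votes for and the first VC node she asks -/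
  | start (ℓ : Fin P.n) (o : Fin P.m) (i : Fin P.Nv)
  /-- the voter stops waiting, or has got an invalid receipt, and asks another VC node -/
  | retry (ℓ : Fin P.n) (i : Fin P.Nv)
  /-- a corrupted VC node answers the voter -/
  | reply (ℓ : Fin P.n) (r : Receipt)
  /-- the receipt sent by an honest VC node is delivered to the voter -/
  | relayReceipt (ℓ : Fin P.n)
  /-- VOTE (from anyone: this channel is public) -/
  | vote (i : Fin P.Nv) (ℓ : Fin P.n) (c : Code)
  /-- ENDORSE -/
  | endorse (i : Fin P.Nv) (ℓ : Fin P.n) (c : Code)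
  /-- ENDORSEMENT with signature of `k` -/
  | endorsement (i : Fin P.Nv) (ℓ : Fin P.n) (k : Fin P.Nv)
  /-- VOTE_P, from a corrupted or from an honest VC node -/
  | voteP (i : Fin P.Nv) (ℓ : Fin P.n) (k : Fin P.Nv) (c : Code) (x : Share P)
  | relayVoteP (i : Fin P.Nv) (ℓ : Fin P.n) (k : Fin P.Nv)
  /-- the clock of a VC node reaches the election end time -/
  | close (i : Fin P.Nv)
  /-- ANNOUNCE, from a corrupted or from an honest VC node -/
  | announce (i : Fin P.Nv) (ℓ : Fin P.n) (k : Fin P.Nv) (c : Option Code)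
  | relayAnnounce (i : Fin P.Nv) (ℓ : Fin P.n) (k : Fin P.Nv)
  /-- binary consensus for a ballot reaches a decision, about which all honest nodes agree; when
  this happens and, if the honest nodes enter with different opinions, which decision it is, is up
  to the adversary; a node learns the decision -/
  | decide (ℓ : Fin P.n) (b : Bool)
  | learn (i : Fin P.Nv) (ℓ : Fin P.n)
  /-- RECOVER-RESPONSE, from a corrupted or from an honest VC node -/
  | recover (i : Fin P.Nv) (ℓ : Fin P.n) (k : Fin P.Nv) (c : Code)
  | relayRecover (i : Fin P.Nv) (ℓ : Fin P.n) (k : Fin P.Nv)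
  /-- a VC node that has a result for every ballot sends its vote set and master key share -/
  | finish (i : Fin P.Nv)
  /-- delivery to a BB node, from an honest or from a corrupted VC node -/
  | relaySubmit (k : Fin P.Nv) (b : Fin P.Nb)
  | submit (k : Fin P.Nv) (b : Fin P.Nb) (V : VoteSet P) (x : Share P)
  /-- a BB node reconstructs the master key from the shares of the VC nodes in `Q` -/
  | openKey (b : Fin P.Nb) (Q : Finset (Fin P.Nv))
  /-- a trustee reads the same data from the BB nodes in `R` and computes its tally share -/
  | read (t : Fin P.Nt) (R : Finset (Fin P.Nb)) (V : VoteSet P) (key : MasterKey)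
  /-- delivery to a BB node, from an honest or from a corrupted trustee -/
  | relayPost (t : Fin P.Nt) (b : Fin P.Nb)
  | post (t : Fin P.Nt) (b : Fin P.Nb) (T : TallyShare P)
  /-- a BB node combines the tally shares of the trustees in `Q` -/
  | combine (b : Fin P.Nb) (Q : Finset (Fin P.Nt))
  deriving Fintype

/-- Everything that is fixed before the voting phase; `S` is the type of signatures and `D` the
type of digests. -/
structure Env (P : Params) (S D : Type) where
  setup : Setup P
  hash : ∀ w : ℕ, Str w → D
  verify : Fin P.Nv → Str 224 → S → Bool
  badV : Finset (Fin P.Nv)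
  badB : Finset (Fin P.Nb)
  badT : Finset (Fin P.Nt)

section Protocol

variable {P : Params} {S D : Type}

/-- The statement signed by an endorser: serial number and vote code. -/
def endorseMsg (P : Params) (ℓ : Fin P.n) (c : Code) : Str 224 := Fin.append (P.serial ℓ) c

/-- The stored digest of the vote code at a position. -/
def Env.digest (E : Env P S D) (ℓ : Fin P.n) (p : Pos P) : D :=
  E.hash 224 (Fin.append (E.setup.codeAt ℓ p) (E.setup.salt ℓ p))

/-- The stored digest of the master key. -/
def Env.mskDigest (E : Env P S D) : D :=
  E.hash 192 (Fin.append E.setup.msk E.setup.mskSalt)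

/-- The receipt that is printed on the ballot next to the vote code that the voter casts. -/
def Env.validReceipt (E : Env P S D) (ℓ : Fin P.n) (r : Receipt) (s : State P S) : Prop :=
  ∃ o, (s.voter ℓ).choice = some o ∧ r = E.setup.receipt ℓ (E.setup.part ℓ, o)

/-- Replace the record of node `i` about ballot `ℓ`. -/
def State.setVc (s : State P S) (i : Fin P.Nv) (ℓ : Fin P.n) (r : VcBallot P S) : State P S :=
  { s with vc := Function.update s.vc i (Function.update (s.vc i) ℓ r) }

def State.setVoter (s : State P S) (ℓ : Fin P.n) (v : Voter P) : State P S :=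
  { s with voter := Function.update s.voter ℓ v }

def State.setBb (s : State P S) (b : Fin P.Nb) (r : BbState P) : State P S :=
  { s with bb := Function.update s.bb b r }

open scoped Classical in
/-- A position of the ballot whose stored digest matches the vote code. -/
noncomputable def Env.findPos (E : Env P S D) (ℓ : Fin P.n) (c : Code) : Option (Pos P) :=
  if h : ∃ p, E.hash 224 (Fin.append c (E.setup.salt ℓ p)) = E.digest ℓ p then some h.choose
  else none

open scoped Classical in
/-- At least `Nv - fv` VC nodes have signed the serial number with this vote code. -/
def Env.ValidCert (E : Env P S D) (ℓ : Fin P.n) (c : Code) (u : UCert P S) : Prop :=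
  P.thr ≤ (Finset.univ.filter fun k =>
    ∃ σ, u k = some σ ∧ E.verify k (endorseMsg P ℓ c) σ = true).card

/-- Reconstruct the receipt as soon as there are enough shares. -/
noncomputable def tryReceipt (r : VcBallot P S) : VcBallot P S :=
  let Q := Finset.univ.filter fun k => (r.shares k).isSome = true
  if r.receipt.isNone = true ∧ P.thr ≤ Q.card then
    { r with receipt := some (bitsOfZ 64 (vssRec Q fun k => ((r.shares k).getD 0).1)) }
  else r

/-- Mark the ballot as pending for a certified vote code and disclose the own receipt share. -/
def Env.adopt (E : Env P S D) (i : Fin P.Nv) (ℓ : Fin P.n) (p : Pos P) (c : Code) (u : UCert P S)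
    (r : VcBallot P S) : VcBallot P S :=
  { r with
    cert := some (c, u)
    shares := Function.update r.shares i (some (E.setup.receiptShare ℓ p i)) }

def addShare (k : Fin P.Nv) (x : Share P) (r : VcBallot P S) : VcBallot P S :=
  if (r.shares k).isNone = true then { r with shares := Function.update r.shares k (some x) } else r

open scoped Classical in
/-- An honest node `i` receives ENDORSEMENT with signature `σ` of node `k`. -/
noncomputable def Env.onEndorsement (E : Env P S D) (i : Fin P.Nv) (ℓ : Fin P.n) (k : Fin P.Nv)
    (σ : S) (s : State P S) : State P S :=
  let r := s.vc i ℓ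
  match r.asking, r.cert with
  | some c, none =>
    if s.closed i = false ∧ E.verify k (endorseMsg P ℓ c) σ = true then
      let r' := { r with collected := Function.update r.collected k (some σ) }
      if P.thr ≤ (Finset.univ.filter fun j => (r'.collected j).isSome = true).card then
        match E.findPos ℓ c with
        | some p => s.setVc i ℓ (tryReceipt (E.adopt i ℓ p c r'.collected r'))
        | none => s
      else s.setVc i ℓ r'
    else s
  | _, _ => s

open scoped Classical in
/-- An honest node `i` receives VOTE_P from node `k`. -/
noncomputable def Env.onVoteP (E : Env P S D) (i : Fin P.Nv) (ℓ : Fin P.n) (k : Fin P.Nv)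
    (c : Code) (x : Share P) (u : UCert P S) (s : State P S) : State P S :=
  let r := s.vc i ℓ
  match E.findPos ℓ c with
  | none => s
  | some p =>
    if s.closed i = false ∧ E.ValidCert ℓ c u ∧ vssVerify (E.setup.receiptCommit ℓ p) k x then
      match r.cert with
      | none => s.setVc i ℓ (tryReceipt (addShare k x (E.adopt i ℓ p c u r)))
      | some (c', _) => if c' = c then s.setVc i ℓ (tryReceipt (addShare k x r)) else s
    else s

open scoped Classical in
/-- An honest node `i` that has not yet entered binary consensus receives ANNOUNCE from `k`; it
enters binary consensus when `Nv - fv` such messages have arrived. -/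
noncomputable def Env.onAnnounce (E : Env P S D) (i : Fin P.Nv) (ℓ : Fin P.n) (k : Fin P.Nv)
    (a : Option (Code × UCert P S)) (s : State P S) : State P S :=
  let r := s.vc i ℓ
  if s.closed i = true ∧ r.proposal = none then
    let known : Option (Code × UCert P S) :=
      match r.cert, a with
      | none, some (c, u) =>
        if E.ValidCert ℓ c u ∧ (E.findPos ℓ c).isSome = true then some (c, u) else none
      | old, _ => old
    let heard := insert k r.heard
    s.setVc i ℓ { r with
      heard := heard
      cert := known
      proposal := if P.thr ≤ heard.card then some known.isSome else none }
  else s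

open scoped Classical in
/-- An honest node `i` that waits for a vote code receives RECOVER-RESPONSE. -/
noncomputable def Env.onRecover (E : Env P S D) (i : Fin P.Nv) (ℓ : Fin P.n)
    (c : Code) (u : UCert P S) (s : State P S) : State P S :=
  let r := s.vc i ℓ
  if r.proposal.isSome = true ∧ s.decision ℓ = some true ∧ r.cert = none ∧ r.outcome = none ∧
      E.ValidCert ℓ c u ∧ (E.findPos ℓ c).isSome = true then
    s.setVc i ℓ { r with cert := some (c, u), outcome := some (some c) }
  else s

open scoped Classical in
/-- BB node `b` receives a vote set and a master key share from VC node `k` (only once); it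
publishes a vote set when `fv + 1` VC nodes have submitted it. -/
noncomputable def onSubmit (b : Fin P.Nb) (k : Fin P.Nv) (V : VoteSet P) (x : Share P)
    (s : State P S) : State P S :=
  let r := s.bb b
  if r.sets k = none then
    let sets := Function.update r.sets k (some V)
    s.setBb b { r with
      sets := sets
      keyShares := Function.update r.keyShares k (some x)
      published := if r.published = none ∧
          P.fv + 1 ≤ (Finset.univ.filter fun j => sets j = some V).card then some V
        else r.published }
  else s

open scoped Classical in
/-- The ballots and positions whose commitments are counted when the vote set `V` is published
and the encrypted vote codes are decrypted with `key`. A ballot with several marked positions is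
discarded. -/
noncomputable def Setup.tallySet (e : Setup P) (V : VoteSet P) (key : MasterKey) :
    Finset (Fin P.n × Pos P) :=
  Finset.univ.filter fun x =>
    V x.1 = some (P.dec key (e.cipher x.1 x.2)) ∧
      ∀ p, V x.1 = some (P.dec key (e.cipher x.1 p)) → p = x.2

/-- The share of trustee `t` of the opening of the sum of all counted commitments. -/
noncomputable def Setup.tallyShare (e : Setup P) (V : VoteSet P) (key : MasterKey)
    (t : Fin P.Nt) : TallyShare P :=
  fun o => ∑ x ∈ e.tallySet V key, e.openShare x.1 x.2 o t

/-- Verification of a tally share against the secret sharing's public data. -/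
def Setup.ValidTallyShare (e : Setup P) (V : VoteSet P) (key : MasterKey) (t : Fin P.Nt)
    (T : TallyShare P) : Prop :=
  ∀ o, vssVerify (fun j => ∏ x ∈ e.tallySet V key, (e.openCommit x.1 x.2 o).1 j) t (T o).1 ∧
    vssVerify (fun j => ∏ x ∈ e.tallySet V key, (e.openCommit x.1 x.2 o).2 j) t (T o).2

open scoped Classical in
/-- Combination of tally shares; the result is published if it opens the sum of the counted
commitments. -/
noncomputable def Env.onCombine (E : Env P S D) (b : Fin P.Nb) (Q : Finset (Fin P.Nt))
    (s : State P S) : State P S :=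
  let r := s.bb b
  match r.published, r.msk with
  | some V, some key =>
    let T : Fin P.Nt → TallyShare P := fun t => (r.posts t).getD 0
    let res : Fin P.m → ZMod P.q := fun o => vssRec Q fun t => (T t o).1.1
    let rand : Fin P.m → ZMod P.q := fun o => vssRec Q fun t => (T t o).2.1
    if r.result = none ∧ Q.card = P.ht ∧
        (∀ t ∈ Q, (r.posts t).isSome = true ∧ E.setup.ValidTallyShare V key t (T t)) ∧
        (∀ o, elgamal (res o) (rand o) = ∏ x ∈ E.setup.tallySet V key, E.setup.com x.1 x.2 o) then
      s.setBb b { r with result := some res }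
    else s
  | _, _ => s

open scoped Classical in
/-- BB node `b` reconstructs the master key and checks it against the stored digest. -/
noncomputable def Env.onOpenKey (E : Env P S D) (b : Fin P.Nb) (Q : Finset (Fin P.Nv))
    (s : State P S) : State P S :=
  let r := s.bb b
  let x : Fin P.Nv → Share P := fun k => (r.keyShares k).getD 0
  let key : MasterKey := bitsOfZ 128 (vssRec Q fun k => (x k).1)
  if r.msk = none ∧ Q.card = P.thr ∧
      (∀ k ∈ Q, (r.keyShares k).isSome = true ∧ vssVerify E.setup.mskCommit k (x k)) ∧
      E.hash 192 (Fin.append key E.setup.mskSalt) = E.mskDigest then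
    s.setBb b { r with msk := some key }
  else s

open scoped Classical in
/-- The voter, who waits for an answer, gets `r`: if it is the receipt on her ballot, she is done;
otherwise she does not listen to this VC node any more. -/
noncomputable def Env.onReceipt (E : Env P S D) (ℓ : Fin P.n) (r : Receipt) (s : State P S) :
    State P S :=
  s.setVoter ℓ { s.voter ℓ with
    current := none
    accepted := decide (E.validReceipt ℓ r s) }

/-- The voter is uncorrupted, has been initialised and has not got a valid receipt yet. -/
def Voter.waiting (v : Voter P) : Prop :=
  v.revealed = none ∧ v.choice.isSome = true ∧ v.accepted = false

/-- Signature requested from an honest node: an honest VC node that receives ENDORSE signs unless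
it has endorsed another vote code for this ballot. -/
def Env.Signs (E : Env P S D) (i : Fin P.Nv) (ℓ : Fin P.n) (c : Code) (s : State P S) : Prop :=
  i ∉ E.badV ∧ s.closed i = false ∧
    ((s.vc i ℓ).endorsed = none ∨ (s.vc i ℓ).endorsed = some c)

open scoped Classical in
/-- One step of the system. The signatures `σ` are supplied by the adversary together with the
command. -/
noncomputable def Env.step (E : Env P S D) (cmd : Cmd P) (σ : Fin P.Nv → S) (s : State P S) :
    State P S :=
  let u : UCert P S := fun k => some (σ k)
  match cmd with
  | .corrupt ℓ =>
    s.setVoter ℓ { s.voter ℓ with revealed := some ((E.setup.code ℓ).1, E.setup.receipt ℓ) }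
  | .start ℓ o i =>
    if (s.voter ℓ).revealed = none ∧ (s.voter ℓ).choice = none then
      s.setVoter ℓ { s.voter ℓ with
        choice := some o
        cast := some ((E.setup.code ℓ).1 (E.setup.part ℓ, o))
        tried := {i}
        current := some i }
    else s
  | .retry ℓ i =>
    if (s.voter ℓ).waiting ∧ i ∉ (s.voter ℓ).tried then
      s.setVoter ℓ { s.voter ℓ with
        tried := insert i (s.voter ℓ).tried
        current := some i }
    else s
  | .reply ℓ r =>
    if (s.voter ℓ).waiting ∧ ∃ i ∈ E.badV, (s.voter ℓ).current = some i then E.onReceipt ℓ r s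
    else s
  | .relayReceipt ℓ =>
    match (s.voter ℓ).current with
    | none => s
    | some i =>
      match (s.vc i ℓ).receipt with
      | none => s
      | some r =>
        if (s.voter ℓ).waiting ∧ i ∉ E.badV ∧
            (s.vc i ℓ).cert.map Prod.fst = (s.voter ℓ).cast then E.onReceipt ℓ r s
        else s
  | .vote i ℓ c =>
    if i ∉ E.badV ∧ s.closed i = false ∧ (s.vc i ℓ).cert = none ∧
        (E.findPos ℓ c).isSome = true then
      s.setVc i ℓ { s.vc i ℓ with asking := some c, collected := fun _ => none }
    else s
  | .endorse i ℓ c =>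
    if E.Signs i ℓ c s then s.setVc i ℓ { s.vc i ℓ with endorsed := some c } else s
  | .endorsement i ℓ k => if i ∉ E.badV then E.onEndorsement i ℓ k (σ k) s else s
  | .voteP i ℓ k c x => if i ∉ E.badV ∧ k ∈ E.badV then E.onVoteP i ℓ k c x u s else s
  | .relayVoteP i ℓ k =>
    match (s.vc k ℓ).cert, (s.vc k ℓ).shares k with
    | some (c, w), some x =>
      if i ∉ E.badV ∧ k ∉ E.badV then E.onVoteP i ℓ k c x w s else s
    | _, _ => s
  | .close i =>
    if i ∉ E.badV ∧ s.closed i = false then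
      { s with
        closed := Function.update s.closed i true
        vc := Function.update s.vc i fun ℓ =>
          { s.vc i ℓ with announced := (s.vc i ℓ).cert } }
    else s
  | .announce i ℓ k c =>
    if i ∉ E.badV ∧ k ∈ E.badV then E.onAnnounce i ℓ k (c.map fun c => (c, u)) s else s
  | .relayAnnounce i ℓ k =>
    if i ∉ E.badV ∧ k ∉ E.badV ∧ s.closed k = true then
      E.onAnnounce i ℓ k (s.vc k ℓ).announced s
    else s
  | .decide ℓ b =>
    if s.decision ℓ = none ∧ ∃ i, i ∉ E.badV ∧ (s.vc i ℓ).proposal = some b then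
      { s with decision := Function.update s.decision ℓ (some b) }
    else s
  | .learn i ℓ =>
    if i ∉ E.badV ∧ (s.vc i ℓ).proposal.isSome = true ∧ (s.vc i ℓ).outcome = none then
      match s.decision ℓ, (s.vc i ℓ).cert with
      | some false, _ => s.setVc i ℓ { s.vc i ℓ with outcome := some none }
      | some true, some (c, _) => s.setVc i ℓ { s.vc i ℓ with outcome := some (some c) }
      | _, _ => s
    else s
  | .recover i ℓ k c => if i ∉ E.badV ∧ k ∈ E.badV then E.onRecover i ℓ c u s else s
  | .relayRecover i ℓ k =>
    match (s.vc k ℓ).cert with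
    | some (c, w) => if i ∉ E.badV ∧ k ∉ E.badV then E.onRecover i ℓ c w s else s
    | none => s
  | .finish i =>
    if i ∉ E.badV ∧ (∀ ℓ, (s.vc i ℓ).outcome.isSome = true) then
      { s with sentKey := Function.update s.sentKey i (some (E.setup.mskShare i)) }
    else s
  | .relaySubmit k b =>
    match s.sentKey k with
    | some x =>
      if k ∉ E.badV then onSubmit b k (fun ℓ => ((s.vc k ℓ).outcome).join) x s else s
    | none => s
  | .submit k b V x => if k ∈ E.badV then onSubmit b k V x s else s
  | .openKey b Q => if b ∉ E.badB then E.onOpenKey b Q s else s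
  | .read t R V key =>
    if t ∉ E.badT ∧ s.trustee t = none ∧ P.fb + 1 ≤ R.card ∧
        (∀ b ∈ R, b ∈ E.badB ∨ ((s.bb b).published = some V ∧ (s.bb b).msk = some key)) then
      { s with trustee := Function.update s.trustee t (some (E.setup.tallyShare V key t)) }
    else s
  | .relayPost t b =>
    match s.trustee t, (s.bb b).posts t with
    | some T, none =>
      if t ∉ E.badT then
        s.setBb b { s.bb b with posts := Function.update (s.bb b).posts t (some T) }
      else s
    | _, _ => s
  | .post t b T =>
    if t ∈ E.badT ∧ (s.bb b).posts t = none then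
      s.setBb b { s.bb b with posts := Function.update (s.bb b).posts t (some T) }
    else s
  | .combine b Q => if b ∉ E.badB then E.onCombine b Q s else s

/-- The events that happen without any action of a corrupted party in the part of the protocol
that follows the voting hours. -/
def Cmd.Fair : Cmd P → Prop
  | .close _ | .relayAnnounce _ _ _ | .decide _ _ | .learn _ _ | .relayRecover _ _ _ | .finish _
  | .relaySubmit _ _ | .openKey _ _ | .read _ _ _ _ | .relayPost _ _ | .combine _ _ => True
  | _ => False

/-- The election is over: all clocks have reached the election end time, every message between
honest parties in the subsequent protocol has been delivered, and no honest party has anything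
left to do. -/
def Env.Complete (E : Env P S D) (s : State P S) : Prop :=
  ∀ cmd : Cmd P, cmd.Fair → ∀ σ : Fin P.Nv → S, E.step cmd σ s = s

open scoped Classical in
/-- The number of ballots that are recorded in `V` with a vote code for option `o`. -/
noncomputable def Setup.votesFor (e : Setup P) (V : VoteSet P) (o : Fin P.m) : ℕ :=
  (Finset.univ.filter fun ℓ => ∃ part, V ℓ = some ((e.code ℓ).1 (part, o))).card

/-- The vote of voter `ℓ` for option `o` is published on the honest BB nodes and included in the
election tally: what an honest BB node publishes contains it, and when the election is over,
every honest BB node has published a vote set and a result. -/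
def Env.Included (E : Env P S D) (ℓ : Fin P.n) (o : Fin P.m) (s : State P S) : Prop :=
  ∀ b, b ∉ E.badB →
    (∀ V, (s.bb b).published = some V → V ℓ = some ((E.setup.code ℓ).1 (E.setup.part ℓ, o))) ∧
    (∀ R, (s.bb b).result = some R →
      ∃ V, (s.bb b).published = some V ∧
        V ℓ = some ((E.setup.code ℓ).1 (E.setup.part ℓ, o)) ∧
        ∀ o', (R o').val = E.setup.votesFor V o') ∧
    (E.Complete s → (s.bb b).published.isSome = true ∧ (s.bb b).result.isSome = true)

/-- Voter `ℓ` was never corrupted and got a valid receipt from a VC node, but her vote is not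
published and counted. -/
def Env.Violation (E : Env P S D) (ℓ : Fin P.n) (s : State P S) : Prop :=
  (s.voter ℓ).revealed = none ∧ (s.voter ℓ).accepted = true ∧
    ∃ o, (s.voter ℓ).choice = some o ∧ ¬ E.Included ℓ o s

end Protocol

/-! ### The adversary and the execution -/

/-- Names of the bits that the adversary knows initially: public data of fixed size and the
fixed-size secrets of corrupted servers (see `leakData`), hash key, digests, keys. -/
inductive LeakWire (P : Params) (Sg : SigScheme 224) (H : HashFamily) (α : Type) (k : ℕ) : Type
  | data (j : CodeWire α)
  | hashKey (j : Fin (H.keyLen k))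
  | mskDigest (j : Fin (H.digestLen k))
  | digest (ℓ : Fin P.n) (p : Pos P) (j : Fin (H.digestLen k))
  | vk (i : Fin P.Nv) (j : Fin (Sg.vkLen k))
  | sk (i : Fin P.Nv) (j : Fin (Sg.skLen k))

/-- Bulletin board data (encrypted vote codes, option commitments, salt of the master key),
verification data of all sharings, data of corrupted VC nodes (share of the master key; salts and
receipt shares), data of corrupted trustees. -/
abbrev LeakData (P : Params) :=
  (Fin P.n → Pos P → P.Cipher × (Fin P.m → P.G × P.G)) × Salt ×
  (Fin P.n → Pos P → Fin P.thr → P.G) × (Fin P.thr → P.G) ×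
  (Fin P.n → Pos P → Fin P.m → (Fin P.ht → P.G) × (Fin P.ht → P.G)) ×
  (Fin P.Nv → Option (Share P × (Fin P.n → Pos P → Salt × Share P))) ×
  (Fin P.Nt → Option (Fin P.n → Pos P → Fin P.m → Share P × Share P))

open scoped Classical in
noncomputable def leakData {P : Params} {S D : Type} (E : Env P S D) : LeakData P :=
  let e := E.setup
  (fun ℓ p => (e.cipher ℓ p, e.com ℓ p), e.mskSalt,
    e.receiptCommit, e.mskCommit, e.openCommit,
    fun i => if i ∈ E.badV then
      some (e.mskShare i, fun ℓ p => (e.salt ℓ p, e.receiptShare ℓ p i)) else none,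
    fun t => if t ∈ E.badT then some (fun ℓ p o => e.openShare ℓ p o t) else none)

/-- An adversary: fixed sets of corrupted servers, and a machine that in every round sees the
whole state of the protocol (no secret of an honest party is part of it) with the certificates'
signature strings replaced by their presence, and the signature that was produced in the last
round, if any; it answers with a command and signature strings. -/
structure Adversary (P : Params) (Sg : SigScheme 224) (H : HashFamily) where
  badV : ℕ → Finset (Fin P.Nv)
  badB : ℕ → Finset (Fin P.Nb)
  badT : ℕ → Finset (Fin P.Nt)
  machine : Machine (LeakWire P Sg H (LeakData P))
    (fun k => CodeWire (State P Unit) ⊕ Fin (Sg.sigLen k))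
    (fun k => CodeWire (Cmd P) ⊕ (Fin P.Nv × Fin (Sg.sigLen k)))

section Execution

variable {P : Params} {Sg : SigScheme 224} {H : HashFamily}

/-- All random choices in an execution. -/
structure Randomness (A : Adversary P Sg H) (k : ℕ) where
  setup : Setup P
  hashKey : Str (H.keyLen k)
  keyCoins : Fin P.Nv → Str (Sg.genCoins k)
  signCoins : Fin P.Nv → Fin (A.machine.rounds k) → Str (Sg.signCoins k)
  coins : Str (A.machine.coins k)

instance (A : Adversary P Sg H) (k : ℕ) : Finite (Randomness A k) :=
  Finite.of_injective (fun s : Randomness A k =>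
    (s.setup, s.hashKey, s.keyCoins, s.signCoins, s.coins)) (by
      rintro ⟨⟩ ⟨⟩ h
      simpa using h)

def env (A : Adversary P Sg H) (k : ℕ) (ω : Randomness A k) :
    Env P (Str (Sg.sigLen k)) (Str (H.digestLen k)) :=
  { setup := ω.setup
    hash := H.hash k ω.hashKey
    verify := fun i => Sg.verify k (Sg.gen k (ω.keyCoins i)).1
    badV := A.badV k
    badB := A.badB k
    badT := A.badT k }

set_option synthInstance.maxHeartbeats 400000 in
set_option synthInstance.maxSize 4096 in
/-- The initial knowledge of the adversary. The digests are known to the corrupted VC nodes. -/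
noncomputable def leak (A : Adversary P Sg H) (k : ℕ) (ω : Randomness A k) :
    Wires (LeakWire P Sg H (LeakData P) k)
  | .data j => encode (leakData (env A k ω)) j
  | .hashKey j => ω.hashKey j
  | .mskDigest j => (env A k ω).mskDigest j
  | .digest ℓ p j => decide (A.badV k).Nonempty && (env A k ω).digest ℓ p j
  | .vk i j => (Sg.gen k (ω.keyCoins i)).1 j
  | .sk i j => decide (i ∈ A.badV k) && (Sg.gen k (ω.keyCoins i)).2 j

/-- Memory of the adversary, state of the system, last signature of an honest node. -/
structure Config (A : Adversary P Sg H) (k : ℕ) where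
  mem : Wires (A.machine.Mem k)
  state : State P (Str (Sg.sigLen k))
  out : Str (Sg.sigLen k)

open scoped Classical in
/-- The signature that an honest node produces in round `t`. -/
noncomputable def signature (A : Adversary P Sg H) (k : ℕ) (ω : Randomness A k) (t : ℕ)
    (s : State P (Str (Sg.sigLen k))) : Option (Cmd P) → Str (Sg.sigLen k)
  | some (.endorse i ℓ c) =>
    if (env A k ω).Signs i ℓ c s then
      Sg.sign k (Sg.gen k (ω.keyCoins i)).2 (endorseMsg P ℓ c)
        (if h : t < A.machine.rounds k then ω.signCoins i ⟨t, h⟩ else fun _ => false)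
    else fun _ => false
  | _ => fun _ => false

/-- The execution after `t` rounds. -/
noncomputable def run (A : Adversary P Sg H) (k : ℕ) (ω : Randomness A k) : ℕ → Config A k
  | 0 => ⟨fun _ => false, State.initial P _, fun _ => false⟩
  | t + 1 =>
    let x := run A k ω t
    let y := A.machine.step k t (Sum.elim x.mem (Sum.elim ω.coins (Sum.elim (leak A k ω)
      (Sum.elim (encode (x.state.map fun _ => ())) x.out))))
    let cmd : Option (Cmd P) := decode fun j => y (.inr (.inl j))
    let σ : Fin P.Nv → Str (Sg.sigLen k) := fun i j => y (.inr (.inr (i, j)))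
    { mem := fun j => y (.inl j)
      state := match cmd with
        | some c => (env A k ω).step c σ x.state
        | none => x.state
      out := signature A k ω t x.state cmd }

/-- The state at the end of the execution. -/
noncomputable def finalState (A : Adversary P Sg H) (k : ℕ) (ω : Randomness A k) :
    State P (Str (Sg.sigLen k)) :=
  (run A k ω (A.machine.rounds k)).state

end Execution

/-! ### Probabilities on finite spaces and negligible functions -/

section Probability

variable {Ω K : Type} [Finite Ω] [Finite K]

/-! A violation needs one of three events: a hash collision, a valid signature of an honest vote
collector on a vote code that it has not endorsed, or an answer of a corrupted vote collector that
hits the voter's receipt while fewer than `Nv - fv` shares of it are held by corrupted nodes or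
disclosed (`violation_cases`). The theorem is a union bound over these events.

Outside them the argument is deterministic. Every command decomposes into atomic moves
(`Env.step_moves`); their guards make the recorded data write-once (`Env.Move.le`), and the moves
preserve an invariant (`Env.Inv.move`). Acceptance of a receipt means that a quorum of `Nv - fv`
nodes is corrupted or has disclosed its share for the voter's line. An honest node discloses a share
only for a certified vote code and before its clock closes, so it later announces a certificate. A
node whose opinion is "no" has heard a quorum of announcements. As `Nv > 3 fv`, the two quorums
share an honest node, which contradicts that opinion; so the decision cannot be "no". Two certified
vote codes of one ballot coincide, because an honest node in both quorums endorsed both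
(`Env.Backed.unique`). Among `fv + 1` equal lists one is honest, ElGamal commitments are perfectly
binding, and `n < q` excludes wraparound, so whatever is published is right. In a completed election
nothing is missing: otherwise some fair command would still change the state.

Collisions: the hashed strings have the fixed lengths 224 and 192. There is a constant number of
pairs of such strings, and each pair is output by a circuit without gates, so the hash is injective
on them except with negligible probability.

Forgeries: a forger runs the adversary together with the whole system and uses its signing oracle
for one honest node. All other randomness is fixed by averaging (`exists_prob_le_patch`). Since the
election parameters do not depend on the security parameter, the state becomes an element of a fixed
finite type once signatures are replaced by their validity bits (`Env.bits`). Transitions are then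
tables of constant size, and only the adversary, signing and verification need growing circuits
(`forger_efficient`).

Guesses: Pedersen sharing hides perfectly. A receipt can be replaced, together with its sharing,
without touching the commitments and fewer than `Nv - fv` given shares (`reshare`). In an ideal
execution, which ignores acceptance by the voter and stops before the receipt is exposed, such a
replacement has no effect (`ideal_reshare`). The voter asks no node twice, so at most `fv` guesses
are made, all independent of a uniform 64-bit receipt. Counting gives `fv / 2 ^ 64`
(`prob_guessEvent_le`), which is below the claimed term. -/

theorem prob_nonneg (E : Ω → Prop) : 0 ≤ prob E := by unfold prob; positivity

theorem prob_mono {E F : Ω → Prop} (h : ∀ ω, E ω → F ω) : prob E ≤ prob F := by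
  unfold prob
  gcongr
  exact Nat.card_le_card_of_injective (fun ω : {ω // E ω} => (⟨ω.1, h _ ω.2⟩ : {ω // F ω}))
    (fun a b hab => Subtype.ext (by simpa using hab))

theorem prob_of_isEmpty [IsEmpty Ω] (E : Ω → Prop) : prob E = 0 := by simp [prob]

theorem prob_or_le (E F : Ω → Prop) : prob (fun ω => E ω ∨ F ω) ≤ prob E + prob F := by
  unfold prob
  rw [← add_div]
  gcongr
  have h := Set.ncard_union_le {ω | E ω} {ω | F ω}
  exact_mod_cast h

theorem prob_exists_mem_le {ι : Type*} (s : Finset ι) (E : ι → Ω → Prop) :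
    prob (fun ω => ∃ i ∈ s, E i ω) ≤ ∑ i ∈ s, prob (E i) := by
  classical
  induction s using Finset.induction_on with
  | empty => simp [prob]
  | insert a s ha ih =>
    rw [Finset.sum_insert ha]
    refine le_trans ?_ ((prob_or_le (E a) fun ω => ∃ i ∈ s, E i ω).trans (by gcongr))
    exact prob_mono fun ω ⟨i, hi, h⟩ => by
      rcases Finset.mem_insert.1 hi with rfl | hi
      · exact .inl h
      · exact .inr ⟨i, hi, h⟩

/-- If `patch ω κ` replaces the component `get ω` of `ω` by `κ`, then some way to fix the other
components does not decrease the probability of an event. -/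
theorem exists_prob_le_patch [Nonempty Ω] (get : Ω → K) (patch : Ω → K → Ω)
    (h₁ : ∀ ω κ, get (patch ω κ) = κ) (h₂ : ∀ ω κ, patch (patch ω κ) (get ω) = ω)
    (E : Ω → Prop) : ∃ ω₀, prob E ≤ prob fun κ => E (patch ω₀ κ) := by
  classical
  have := Fintype.ofFinite Ω
  have := Fintype.ofFinite K
  have hK : Nonempty K := ⟨get (Classical.arbitrary Ω)⟩
  -- Double counting by the swap `(ω, κ) ↦ (patch ω κ, get ω)`, which is its own inverse by `h₁` and
  -- `h₂`: the average over `ω` of the conditional probabilities is `prob E`, so they cannot all be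
  -- smaller.
  have key : ∑ ω : Ω, Nat.card {κ // E (patch ω κ)} = Nat.card K * Nat.card {ω // E ω} := by
    rw [← Nat.card_sigma, ← Nat.card_prod]
    refine Nat.card_congr
      { toFun := fun x => (get x.1, ⟨patch x.1 x.2.1, x.2.2⟩)
        invFun := fun y => ⟨patch y.2.1 y.1, ⟨get y.2.1, by rw [h₂]; exact y.2.2⟩⟩
        left_inv := ?_
        right_inv := ?_ }
    · rintro ⟨ω, κ, h⟩
      have e : patch (patch ω κ) (get ω) = ω := h₂ ω κ
      have e' : get (patch ω κ) = κ := h₁ ω κ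
      refine Sigma.ext e ?_
      simp only [e']
      congr 1
      · simp only [e]
      · exact proof_irrel_heq _ _
    · rintro ⟨κ, ω, h⟩
      simp [h₁, h₂]
  by_contra! hlt
  have hΩ : (0 : ℝ) < Nat.card Ω := by exact_mod_cast Nat.card_pos
  have hKp : (0 : ℝ) < Nat.card K := by exact_mod_cast Nat.card_pos
  have hs : ∑ ω : Ω, (Nat.card {κ // E (patch ω κ)} : ℝ) < ∑ _ω : Ω, Nat.card K * prob E := by
    refine Finset.sum_lt_sum_of_nonempty Finset.univ_nonempty fun ω _ => ?_
    have := hlt ω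
    rw [prob, div_lt_iff₀ hKp] at this
    linarith
  rw [Finset.sum_const, Finset.card_univ, ← Nat.card_eq_fintype_card, nsmul_eq_mul] at hs
  have key' : ∑ ω : Ω, (Nat.card {κ // E (patch ω κ)} : ℝ)
      = Nat.card K * Nat.card {ω // E ω} := by exact_mod_cast key
  rw [key', prob] at hs
  field_simp at hs
  exact lt_irrefl _ hs

/-- An event of which `N` disjoint shifts exist, up to a labelling by `Fin c`, has probability at
most `c / N`. -/
theorem prob_le_of_injective {N c : ℕ} {R : Type} (hR : Nat.card R = N) [Finite R] (hN : 0 < N)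
    (E : Ω → Prop) (f : {ω // E ω} × R → Ω × Fin c) (hf : Function.Injective f) :
    prob E ≤ (c : ℝ) / N := by
  have h := Nat.card_le_card_of_injective f hf
  rw [Nat.card_prod, Nat.card_prod, hR, Nat.card_eq_fintype_card (α := Fin c),
    Fintype.card_fin] at h
  rcases Nat.eq_zero_or_pos (Nat.card Ω) with h0 | h0
  · rw [prob, h0]; simp; positivity
  · have h0' : (0 : ℝ) < Nat.card Ω := by exact_mod_cast h0
    have hN' : (0 : ℝ) < N := by exact_mod_cast hN
    rw [prob, div_le_div_iff₀ h0' hN']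
    have : (Nat.card {ω // E ω} * N : ℝ) ≤ Nat.card Ω * c := by exact_mod_cast h
    linarith

end Probability

theorem Negligible.zero : Negligible 0 := Asymptotics.superpolynomialDecay_zero _ _

theorem Negligible.add {f g : ℕ → ℝ} (hf : Negligible f) (hg : Negligible g) :
    Negligible (f + g) := Asymptotics.SuperpolynomialDecay.add hf hg

theorem Negligible.sum {ι : Type*} (s : Finset ι) {f : ι → ℕ → ℝ}
    (h : ∀ i ∈ s, Negligible (f i)) : Negligible (fun k => ∑ i ∈ s, f i k) := by
  classical
  induction s using Finset.induction_on with
  | empty => simp only [Finset.sum_empty]; exact Negligible.zero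
  | insert a s ha ih =>
    have h1 := (h a (by simp)).add (ih fun i hi => h i (by simp [hi]))
    have : (fun k => ∑ i ∈ insert a s, f i k) = f a + fun k => ∑ i ∈ s, f i k := by
      funext k; simp [Finset.sum_insert ha]
    rw [this]; exact h1

/-! ### Circuits -/

section Circuits

variable {α β γ δ : Type}

/-- The map `f` has a circuit with at most `s` gates. -/
def CircuitLE (f : Wires α → Wires β) (s : ℕ) : Prop := ∃ j ≤ s, CircuitSize f j

namespace CircuitLE

theorem mono {f : Wires α → Wires β} {s t : ℕ} (h : CircuitLE f s) (hst : s ≤ t) :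
    CircuitLE f t := let ⟨j, hj, h⟩ := h; ⟨j, hj.trans hst, h⟩

theorem wire (f : β → α) : CircuitLE (fun x : Wires α => fun b => x (f b)) 0 :=
  ⟨0, le_rfl, .wire f⟩

theorem const (v : Wires β) : CircuitLE (fun _ : Wires α => v) 0 := ⟨0, le_rfl, .const v⟩

theorem comp {f : Wires α → Wires β} {g : Wires β → Wires γ} {s t : ℕ}
    (hg : CircuitLE g t) (hf : CircuitLE f s) : CircuitLE (fun x => g (f x)) (s + t) :=
  let ⟨j, hj, h⟩ := hf
  let ⟨i, hi, h'⟩ := hg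
  ⟨j + i, add_le_add hj hi, .comp h h'⟩

theorem pair {f : Wires α → Wires β} {g : Wires α → Wires γ} {s t : ℕ}
    (hf : CircuitLE f s) (hg : CircuitLE g t) :
    CircuitLE (fun x => (Sum.elim (f x) (g x) : Wires (β ⊕ γ))) (s + t) :=
  let ⟨j, hj, h⟩ := hf
  let ⟨i, hi, h'⟩ := hg
  ⟨j + i, add_le_add hj hi, .pair h h'⟩

/-- Rewire the output. -/
theorem select {f : Wires α → Wires β} {s : ℕ} (hf : CircuitLE f s) (e : γ → β) :
    CircuitLE (fun x => fun c => f x (e c)) s := by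
  simpa using (wire e).comp hf

theorem nand {f g : Wires α → Bool} {s t : ℕ} (hf : CircuitLE (fun x (_ : Unit) => f x) s)
    (hg : CircuitLE (fun x (_ : Unit) => g x) t) :
    CircuitLE (fun x (_ : Unit) => !(f x && g x)) (s + t + 1) :=
  comp (g := fun (y : Wires (Unit ⊕ Unit)) (_ : Unit) => !(y (.inl ()) && y (.inr ())))
    ⟨1, le_rfl, .nand _ _⟩ (hf.pair hg)

/-- Circuits for the single output bits can be put side by side on the same input, so their sizes
add up. -/
theorem fin_bits {L c : ℕ} {f : Wires α → Wires (Fin L)}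
    (h : ∀ b, CircuitLE (fun x (_ : Unit) => f x b) c) : CircuitLE f (L * c) := by
  induction L with
  | zero =>
    have : f = fun _ => fun _ => false := by funext x b; exact b.elim0
    rw [this]; simpa using const _
  | succ L ih =>
    have h1 := ih (f := fun x b => f x b.succ) fun b => h b.succ
    have h2 := ((h 0).pair h1).select (fun b : Fin (L + 1) =>
      (Fin.cases (Sum.inl ()) (fun b => Sum.inr b) b : Unit ⊕ Fin L))
    have : f = fun x => fun b => Sum.elim (fun _ : Unit => f x 0) (fun b : Fin L => f x b.succ)
        (Fin.cases (Sum.inl ()) (fun b => Sum.inr b) b : Unit ⊕ Fin L) := by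
      funext x b
      cases b using Fin.cases <;> simp
    rw [this]
    exact h2.mono (by ring_nf; omega)

theorem bits [Finite β] {c : ℕ} {f : Wires α → Wires β}
    (h : ∀ b, CircuitLE (fun x (_ : Unit) => f x b) c) : CircuitLE f (Nat.card β * c) := by
  have := (fin_bits (f := fun x i => f x ((Finite.equivFin β).symm i)) fun i => h _).select
    (Finite.equivFin β)
  simpa using this

/-- Shannon expansion: the first input bit selects between two functions of the remaining bits. -/
theorem exists_fin (n : ℕ) (f : Wires (Fin n) → Bool) :
    ∃ s, CircuitLE (fun x (_ : Unit) => f x) s := by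
  induction n with
  | zero =>
    refine ⟨0, ?_⟩
    have : (fun (x : Wires (Fin 0)) (_ : Unit) => f x) = fun _ => fun _ => f Fin.elim0 := by
      funext x _; congr 1; exact Subsingleton.elim _ _
    rw [this]; exact const _
  | succ n ih =>
    obtain ⟨s₀, h₀⟩ := ih fun x => f (Fin.cons false x)
    obtain ⟨s₁, h₁⟩ := ih fun x => f (Fin.cons true x)
    have tail : CircuitLE (fun (x : Wires (Fin (n + 1))) => fun i : Fin n => x i.succ) 0 :=
      wire Fin.succ
    have head : CircuitLE (fun (x : Wires (Fin (n + 1))) (_ : Unit) => x 0) 0 :=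
      wire fun _ => 0
    have g₀ := h₀.comp tail
    have g₁ := h₁.comp tail
    -- The multiplexer written with NAND gates; the NAND of `x 0` with itself is its negation.
    have key : (fun (x : Wires (Fin (n + 1))) (_ : Unit) => f x) = fun x (_ : Unit) =>
        !(!(x 0 && f (Fin.cons true fun i => x i.succ)) &&
          !(!(x 0 && x 0) && f (Fin.cons false fun i => x i.succ))) := by
      funext x _
      have hx : x = Fin.cons (x 0) fun i => x i.succ := (Fin.cons_self_tail x).symm
      rcases h : x 0 with _ | _
      · rw [h] at hx; simp [← hx]
      · rw [h] at hx; simp [← hx]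
    have := nand (nand head g₁) (nand (nand head head) g₀)
    rw [← key] at this
    exact ⟨_, this⟩

/-- All maps between given finite sets of wires have circuits of bounded size. -/
theorem exists_bound (α β : Type) [Finite α] [Finite β] :
    ∃ s, ∀ f : Wires α → Wires β, CircuitLE f s := by
  have h : ∀ f : Wires α → Wires β, ∃ s, CircuitLE f s := fun f => by
    have hb : ∀ b, ∃ s, CircuitLE (fun x (_ : Unit) => f x b) s := fun b => by
      obtain ⟨s, hs⟩ := exists_fin (Nat.card α) fun x => f (fun a => x (Finite.equivFin α a)) b
      have := hs.comp (wire (Finite.equivFin α).symm)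
      exact ⟨_, by simpa using this⟩
    choose s hs using hb
    obtain ⟨c, hc⟩ := Finite.exists_le s
    exact ⟨_, bits fun b => (hs b).mono (hc b)⟩
  choose s hs using h
  -- Only finitely many maps exist between fixed finite sets of wires, so one bound serves all of
  -- them, efficient or not.
  obtain ⟨c, hc⟩ := Finite.exists_le s
  exact ⟨c, fun f => (hs f).mono (hc f)⟩

end CircuitLE

end Circuits

theorem PolyBounded.const (c : ℕ) : PolyBounded fun _ => c := ⟨Polynomial.C c, fun k => by simp⟩

theorem PolyBounded.add {f g : ℕ → ℕ} (hf : PolyBounded f) (hg : PolyBounded g) :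
    PolyBounded fun k => f k + g k :=
  let ⟨p, hp⟩ := hf
  let ⟨q, hq⟩ := hg
  ⟨p + q, fun k => by simpa using add_le_add (hp k) (hq k)⟩

theorem PolyBounded.mul {f g : ℕ → ℕ} (hf : PolyBounded f) (hg : PolyBounded g) :
    PolyBounded fun k => f k * g k :=
  let ⟨p, hp⟩ := hf
  let ⟨q, hq⟩ := hg
  ⟨p * q, fun k => by simpa using Nat.mul_le_mul (hp k) (hq k)⟩

/-! ### Fixed-length inputs of a collision resistant hash function -/

/-- A collision resistant hash function is injective on strings of a fixed length, except with
negligible probability: the pairs of such strings are finitely many, and each of them is output by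
a circuit without gates. -/
theorem HashFamily.CollisionResistant.negligible_not_injective {H : HashFamily}
    (hH : H.CollisionResistant) (w : ℕ) :
    Negligible fun k => prob fun κ : Str (H.keyLen k) =>
      ∃ p ∈ (Finset.univ : Finset (Str w × Str w)),
        p.1 ≠ p.2 ∧ H.hash k κ w p.1 = H.hash k κ w p.2 := by
  have hp : ∀ p : Str w × Str w, Negligible fun k => prob fun κ : Str (H.keyLen k) =>
      p.1 ≠ p.2 ∧ H.hash k κ w p.1 = H.hash k κ w p.2 := fun p => by
    -- The attacker without coins and gates that always outputs the pair `p`.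
    have := hH w (fun _ => 0) (fun k _ => Sum.elim p.1 p.2)
      ⟨fun _ => 0, PolyBounded.const 0, fun k => ⟨0, le_rfl, .const _⟩⟩
    have e : ∀ k, (prob fun κ : Str (H.keyLen k) =>
        p.1 ≠ p.2 ∧ H.hash k κ w p.1 = H.hash k κ w p.2) =
        prob fun ω : Str 0 × Str (H.keyLen k) =>
          p.1 ≠ p.2 ∧ H.hash k ω.2 w p.1 = H.hash k ω.2 w p.2 := fun k => by
      unfold prob
      congr 2
      · exact Nat.card_congr
          { toFun := fun x => ⟨(fun _ => false, x.1), x.2⟩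
            invFun := fun x => ⟨x.1.2, x.2⟩
            left_inv := fun x => rfl
            right_inv := fun x => Subtype.ext (Prod.ext (Subsingleton.elim _ _) rfl) }
      · rw [Nat.card_prod]; simp
    simp only [e]
    exact this
  have hs := Negligible.sum (Finset.univ : Finset (Str w × Str w)) fun p _ => hp p
  refine Asymptotics.SuperpolynomialDecay.trans_abs_le hs fun k => ?_
  rw [abs_of_nonneg (prob_nonneg _)]
  exact (prob_exists_mem_le _ _).trans (le_abs_self _)

/-! ### Algebra of the commitments and of the secret sharing -/

section Algebra

variable {P : Params}

/-- The group has order `q`, so exponents may be read in `ZMod q`; this is what makes the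
commitments homomorphic. -/
theorem pow_mod_q (a : P.G) (n : ℕ) : a ^ (n % P.q) = a ^ n := by
  rw [← P.card_G, pow_mod_natCard]

theorem pow_val_add (a : P.G) (x y : ZMod P.q) : a ^ (x + y).val = a ^ x.val * a ^ y.val := by
  rw [ZMod.val_add, ← pow_add, pow_mod_q]

theorem pow_val_mul (a : P.G) (x y : ZMod P.q) : a ^ (x * y).val = (a ^ x.val) ^ y.val := by
  rw [ZMod.val_mul, ← pow_mul, pow_mod_q]

theorem pow_val_sum {ι : Type*} (s : Finset ι) (a : P.G) (f : ι → ZMod P.q) :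
    a ^ (∑ i ∈ s, f i).val = ∏ i ∈ s, a ^ (f i).val := by
  classical
  induction s using Finset.induction_on with
  | empty => simp
  | insert i s hi ih => rw [Finset.sum_insert hi, Finset.prod_insert hi, pow_val_add, ih]

/-- In a group of prime order every nontrivial element has order `q`. -/
theorem pow_val_injective {a : P.G} (ha : a ≠ 1) {x y : ZMod P.q}
    (h : a ^ x.val = a ^ y.val) : x = y := by
  have ho : orderOf a = P.q := by
    have := orderOf_dvd_natCard a
    rw [P.card_G] at this
    exact ((Nat.dvd_prime P.prime_q).1 this).resolve_left (by simpa using ha)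
  have h' := pow_inj_mod.1 h
  rw [ho, Nat.mod_eq_of_lt (ZMod.val_lt x), Nat.mod_eq_of_lt (ZMod.val_lt y)] at h'
  exact ZMod.val_injective _ h'

/-- Every nontrivial element generates a group of prime order. The exponent is a trapdoor for
changing the content of Pedersen commitments; it occurs only in a counting argument, so it need not
be computable. -/
theorem exists_dlog (P : Params) : ∃ κ : ZMod P.q, P.g = P.h ^ κ.val := by
  obtain ⟨n, hn⟩ := mem_powers_of_prime_card P.card_G P.h_ne (g' := P.g)
  refine ⟨n, ?_⟩
  rw [ZMod.val_natCast, ← P.card_G, pow_mod_natCard]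
  exact hn.symm

theorem pedersen_sum {ι : Type*} (s : Finset ι) (x y : ι → ZMod P.q) :
    pedersen (∑ i ∈ s, x i) (∑ i ∈ s, y i) = ∏ i ∈ s, pedersen (x i) (y i) := by
  simp only [pedersen, pow_val_sum, Finset.prod_mul_distrib]

theorem pedersen_mul (x y c : ZMod P.q) :
    pedersen (x * c) (y * c) = pedersen x y ^ c.val := by
  simp only [pedersen, pow_val_mul, mul_pow]

/-- Pedersen commitments are homomorphic: the product of the coefficient commitments of several
sharings commits to the coefficients of the summed polynomials. Tally shares are verified in this
way. -/
theorem vssVerify_sum {ι : Type*} {t : ℕ} (s : Finset ι) (secret : ι → ZMod P.q)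
    (r : ι → VssCoins P t) (i : ℕ) :
    vssVerify (fun j => ∏ x ∈ s, vssCommit (secret x) (r x) j) i
      (∑ x ∈ s, vssShare (secret x) (r x) i) := by
  unfold vssVerify
  rw [Prod.fst_sum, Prod.snd_sum, pedersen_sum]
  simp only [← Finset.prod_pow]
  rw [Finset.prod_comm]
  refine Finset.prod_congr rfl fun x _ => ?_
  simp only [vssShare, vssCommit, pedersen_sum, pedersen_mul]

theorem vssVerify_share {t : ℕ} (secret : ZMod P.q) (r : VssCoins P t) (i : ℕ) :
    vssVerify (vssCommit secret r) i (vssShare secret r i) := by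
  simpa using vssVerify_sum (Finset.univ : Finset Unit) (fun _ => secret) (fun _ => r) i

theorem point_injOn {i j : ℕ} (hi : i < P.q) (hj : j < P.q) (h : point P i = point P j) :
    i = j := by
  have h' : (i : ZMod P.q) = j := by simpa [point] using h
  have := (ZMod.natCast_eq_natCast_iff' i j P.q).1 h'
  rwa [Nat.mod_eq_of_lt hi, Nat.mod_eq_of_lt hj] at this

theorem point_ne_zero {i : ℕ} (hi : i + 1 < P.q) : point P i ≠ 0 := by
  intro h
  have h' : ((i + 1 : ℕ) : ZMod P.q) = 0 := by simpa [point] using h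
  rw [ZMod.natCast_eq_zero_iff] at h'
  exact absurd (Nat.le_of_dvd (by omega) h') (by omega)

/-- A polynomial of degree below `t` is determined by its values at `t` distinct points, and its
value at `0` is its constant coefficient. The points are distinct because `N < q`. -/
theorem vssRec_eq {N t : ℕ} (hN : N < P.q) (ht : 0 < t) {Q : Finset (Fin N)} (hQ : Q.card = t)
    (c : Fin t → ZMod P.q) {v : Fin N → ZMod P.q}
    (hv : ∀ i ∈ Q, v i = ∑ j, c j * point P i ^ j.val) : vssRec Q v = c ⟨0, ht⟩ := by
  classical
  let f : Polynomial (ZMod P.q) := ∑ j, Polynomial.C (c j) * Polynomial.X ^ j.val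
  have hdeg : f.degree < Q.card := by
    rw [hQ, Polynomial.degree_lt_iff_coeff_zero]
    intro m hm
    simp only [f, Polynomial.finsetSum_coeff, Polynomial.coeff_C_mul, Polynomial.coeff_X_pow]
    exact Finset.sum_eq_zero fun j _ => by rw [if_neg (by omega), mul_zero]
  have heval : ∀ x, f.eval x = ∑ j, c j * x ^ j.val := fun x => by
    simp [f, Polynomial.eval_finsetSum]
  have hinj : Set.InjOn (fun i : Fin N => point P i) Q := fun i _ j _ h =>
    Fin.ext (point_injOn (i.2.trans hN) (j.2.trans hN) h)
  have := Lagrange.eq_interpolate_of_eval_eq (f := f) v hinj hdeg fun i hi => by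
    rw [hv i hi, heval]
  rw [vssRec, ← this, heval, Finset.sum_eq_single ⟨0, ht⟩]
  · simp
  · intro j _ hj
    have : j.val ≠ 0 := fun h => hj (Fin.ext h)
    simp [this]
  · simp

theorem elgamal_sum {ι : Type*} (s : Finset ι) (e r : ι → ZMod P.q) :
    elgamal (∑ i ∈ s, e i) (∑ i ∈ s, r i) = ∏ i ∈ s, elgamal (e i) (r i) := by
  ext
  · simp [elgamal, Prod.fst_prod, pow_val_sum]
  · simp [elgamal, Prod.snd_prod, pow_val_sum, Finset.prod_mul_distrib]

/-- Perfect binding: the first component fixes the randomness, and then the second one fixes the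
exponent of `g`. -/
theorem elgamal_injective {e e' r r' : ZMod P.q} (h : elgamal e r = elgamal e' r') : e = e' := by
  have h1 := pow_val_injective P.g_ne (congrArg Prod.fst h)
  subst h1
  exact pow_val_injective P.g_ne (mul_right_cancel (congrArg Prod.snd h))

/-! Replacing the secret of a sharing without changing few of the shares -/

/-- The coefficients of a polynomial with value `1` at `0` and zeros at the points of `Q`. -/
noncomputable def maskCoeff {N : ℕ} (Q : Finset (Fin N)) (j : ℕ) : ZMod P.q :=
  (∏ i ∈ Q, (1 - Polynomial.C (point P i)⁻¹ * Polynomial.X)).coeff j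

theorem maskCoeff_zero {N : ℕ} (Q : Finset (Fin N)) : maskCoeff (P := P) Q 0 = 1 := by
  simp [maskCoeff, Polynomial.coeff_zero_eq_eval_zero, Polynomial.eval_prod]

/-- The masking polynomial vanishes at the points of `Q` and has degree at most `Q.card < t`, so `t`
coefficients describe it completely. -/
theorem maskCoeff_sum {N t : ℕ} (hN : N < P.q) {Q : Finset (Fin N)} (hQ : Q.card < t)
    {i : Fin N} (hi : i ∈ Q) : ∑ j : Fin t, maskCoeff Q j.val * point P i ^ j.val = 0 := by
  have hdeg : (∏ i ∈ Q, (1 - Polynomial.C (point P i)⁻¹ * Polynomial.X)).natDegree < t := by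
    refine lt_of_le_of_lt (Polynomial.natDegree_prod_le _ _) (lt_of_le_of_lt ?_ hQ)
    rw [Finset.card_eq_sum_ones]
    refine Finset.sum_le_sum fun i _ => ?_
    refine (Polynomial.natDegree_sub_le _ _).trans (max_le (by simp) ?_)
    exact (Polynomial.natDegree_C_mul_le _ _).trans Polynomial.natDegree_X_le
  have h := Polynomial.eval_eq_sum_range' hdeg (point P i)
  have e := Fin.sum_univ_eq_sum_range (fun j => maskCoeff Q j * point P i ^ j) t
  rw [e, show (∑ j ∈ Finset.range t, maskCoeff Q j * point P i ^ j) = _ from h.symm,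
    Polynomial.eval_prod]
  refine Finset.prod_eq_zero hi ?_
  have : point P i ≠ 0 := point_ne_zero (by omega)
  simp [this]

/-- Coins that share `new` instead of `old`, with the same commitments and the same shares of
the participants in `Q`; `κ` is the discrete logarithm of `g` to the base `h`. -/
noncomputable def reshare {N t : ℕ} (κ : ZMod P.q) (Q : Finset (Fin N)) (old new : ZMod P.q)
    (r : VssCoins P t) : VssCoins P t :=
  (fun j => if j.val = 0 then r.1 j else r.1 j + (new - old) * maskCoeff Q j.val,
    fun j => r.2 j - κ * ((new - old) * maskCoeff Q j.val))

/-- Exchanging `old` and `new` flips the sign of the multiple of the mask that is added. -/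
theorem reshare_reshare {N t : ℕ} (κ : ZMod P.q) (Q : Finset (Fin N)) (old new : ZMod P.q)
    (r : VssCoins P t) : reshare κ Q new old (reshare κ Q old new r) = r := by
  ext j
  · by_cases h : j.val = 0
    · simp [reshare, h]
    · simp only [reshare, h, if_false]; ring
  · simp only [reshare]; ring

theorem secretCoeff_reshare {N t : ℕ} (κ : ZMod P.q) (Q : Finset (Fin N)) (old new : ZMod P.q)
    (r : VssCoins P t) (j : Fin t) :
    secretCoeff new (reshare κ Q old new r) j
      = secretCoeff old r j + (new - old) * maskCoeff Q j.val := by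
  by_cases h : j.val = 0
  · simp [secretCoeff, h, maskCoeff_zero]
  · simp [secretCoeff, reshare, h]

/-- Both polynomials change by a multiple of the mask, which vanishes at the points of `Q`. -/
theorem vssShare_reshare {N t : ℕ} (hN : N < P.q) (κ : ZMod P.q) {Q : Finset (Fin N)}
    (hQ : Q.card < t) (old new : ZMod P.q) (r : VssCoins P t) {i : Fin N} (hi : i ∈ Q) :
    vssShare new (reshare κ Q old new r) i = vssShare old r i := by
  have h := maskCoeff_sum hN hQ hi
  have h2 : ∀ d : ZMod P.q, ∑ j : Fin t, d * maskCoeff Q j.val * point P i ^ j.val = 0 := by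
    intro d
    simp only [mul_assoc, ← Finset.mul_sum, h, mul_zero]
  refine Prod.ext ?_ ?_
  · simp only [vssShare, secretCoeff_reshare, add_mul, Finset.sum_add_distrib, h2, add_zero]
  · simp only [vssShare]
    rw [← sub_zero (∑ j, r.2 j * point P i ^ j.val), ← h2 (κ * (new - old)),
      ← Finset.sum_sub_distrib]
    refine Finset.sum_congr rfl fun j _ => ?_
    simp only [reshare]
    ring

/-- With `g = h ^ κ`, adding `d` to the exponent of `g` is compensated by subtracting `κ * d` from
the exponent of `h`. -/
theorem vssCommit_reshare {N t : ℕ} {κ : ZMod P.q} (hκ : P.g = P.h ^ κ.val) (Q : Finset (Fin N))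
    (old new : ZMod P.q) (r : VssCoins P t) :
    vssCommit new (reshare κ Q old new r) = vssCommit old r := by
  funext j
  simp only [vssCommit, secretCoeff_reshare, pedersen]
  rw [hκ, ← pow_val_mul, ← pow_val_mul, ← pow_val_add, ← pow_val_add]
  congr 2
  simp only [reshare]
  ring

/-- Strings of `w` bits denote numbers below `q`, so reduction modulo `q` loses nothing. -/
theorem bitsOfZ_bitsToZ {w : ℕ} (hw : 2 ^ w ≤ P.q) (x : Str w) :
    bitsOfZ w (bitsToZ P x) = x := by
  funext i
  have hlt : Nat.ofBits x < P.q := (Nat.ofBits_lt_two_pow x).trans_le hw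
  simp only [bitsOfZ, bitsToZ, ZMod.val_natCast, Nat.mod_eq_of_lt hlt]
  rw [Nat.testBit_ofBits_lt _ _ i.2]

end Algebra

/-! ### Invariants of the protocol -/

section Invariants

variable {P : Params} {S D : Type}

@[simp] theorem State.setVc_vc_self (s : State P S) (i : Fin P.Nv) (ℓ : Fin P.n)
    (r : VcBallot P S) : (s.setVc i ℓ r).vc i ℓ = r := by simp [State.setVc]

theorem State.setVc_vc (s : State P S) (i j : Fin P.Nv) (ℓ ℓ' : Fin P.n) (r : VcBallot P S) :
    (s.setVc i ℓ r).vc j ℓ' = if j = i ∧ ℓ' = ℓ then r else s.vc j ℓ' := by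
  by_cases h : j = i
  · subst h
    by_cases h' : ℓ' = ℓ
    · subst h'; simp [State.setVc]
    · simp [State.setVc, h']
  · simp [State.setVc, h]

@[simp] theorem State.setVc_setVc (s : State P S) (i : Fin P.Nv) (ℓ : Fin P.n)
    (r r' : VcBallot P S) : (s.setVc i ℓ r).setVc i ℓ r' = s.setVc i ℓ r' := by
  simp [State.setVc]

@[simp] theorem State.setVc_self (s : State P S) (i : Fin P.Nv) (ℓ : Fin P.n) :
    s.setVc i ℓ (s.vc i ℓ) = s := by
  simp [State.setVc]

section Fields

variable (s : State P S) (i : Fin P.Nv) (ℓ : Fin P.n) (r : VcBallot P S) (v : Voter P)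
  (b : Fin P.Nb) (x : BbState P)

@[simp] theorem State.setVc_voter : (s.setVc i ℓ r).voter = s.voter := rfl
@[simp] theorem State.setVc_closed : (s.setVc i ℓ r).closed = s.closed := rfl
@[simp] theorem State.setVc_decision : (s.setVc i ℓ r).decision = s.decision := rfl
@[simp] theorem State.setVc_sentKey : (s.setVc i ℓ r).sentKey = s.sentKey := rfl
@[simp] theorem State.setVc_bb : (s.setVc i ℓ r).bb = s.bb := rfl
@[simp] theorem State.setVc_trustee : (s.setVc i ℓ r).trustee = s.trustee := rfl
@[simp] theorem State.setVoter_vc : (s.setVoter ℓ v).vc = s.vc := rfl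
@[simp] theorem State.setVoter_closed : (s.setVoter ℓ v).closed = s.closed := rfl
@[simp] theorem State.setVoter_decision : (s.setVoter ℓ v).decision = s.decision := rfl
@[simp] theorem State.setVoter_sentKey : (s.setVoter ℓ v).sentKey = s.sentKey := rfl
@[simp] theorem State.setVoter_bb : (s.setVoter ℓ v).bb = s.bb := rfl
@[simp] theorem State.setVoter_trustee : (s.setVoter ℓ v).trustee = s.trustee := rfl
@[simp] theorem State.setBb_vc : (s.setBb b x).vc = s.vc := rfl
@[simp] theorem State.setBb_voter : (s.setBb b x).voter = s.voter := rfl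
@[simp] theorem State.setBb_closed : (s.setBb b x).closed = s.closed := rfl
@[simp] theorem State.setBb_decision : (s.setBb b x).decision = s.decision := rfl
@[simp] theorem State.setBb_sentKey : (s.setBb b x).sentKey = s.sentKey := rfl
@[simp] theorem State.setBb_trustee : (s.setBb b x).trustee = s.trustee := rfl

theorem State.setBb_bb (b' : Fin P.Nb) :
    (s.setBb b x).bb b' = if b' = b then x else s.bb b' := by
  simp [State.setBb, Function.update_apply]

theorem State.setVoter_voter (ℓ' : Fin P.n) :
    (s.setVoter ℓ v).voter ℓ' = if ℓ' = ℓ then v else s.voter ℓ' := by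
  simp [State.setVoter, Function.update_apply]

end Fields

open scoped Classical in
/-- Enough nodes for a certificate are corrupted or have endorsed the vote code. -/
def Env.Backed (E : Env P S D) (s : State P S) (ℓ : Fin P.n) (c : Code) : Prop :=
  P.thr ≤ (Finset.univ.filter fun k => k ∈ E.badV ∨ (s.vc k ℓ).endorsed = some c).card

/-- The printed line of a vote code that is known to the servers. -/
noncomputable def Env.lineOf (E : Env P S D) (ℓ : Fin P.n) (c : Code) : Option (Line P) :=
  (E.findPos ℓ c).map (E.setup.line ℓ)

/-- The node `k` has disclosed its share of the receipt on line `x` of the ballot. -/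
def Env.Opened (E : Env P S D) (s : State P S) (ℓ : Fin P.n) (x : Line P) (k : Fin P.Nv) : Prop :=
  ((s.vc k ℓ).shares k).isSome = true ∧
    ∃ c, (s.vc k ℓ).cert.map Prod.fst = some c ∧ E.lineOf ℓ c = some x

open scoped Classical in
/-- The nodes whose share of a receipt is known to the adversary. -/
noncomputable def Env.holders (E : Env P S D) (s : State P S) (ℓ : Fin P.n) (x : Line P) :
    Finset (Fin P.Nv) :=
  Finset.univ.filter fun k => k ∈ E.badV ∨ E.Opened s ℓ x k

theorem Env.mem_holders {E : Env P S D} {s : State P S} {ℓ : Fin P.n} {x : Line P}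
    {k : Fin P.Nv} : k ∈ E.holders s ℓ x ↔ k ∈ E.badV ∨ E.Opened s ℓ x k := by
  simp [Env.holders]

/-- No two of the strings hashed in the election collide. -/
structure Env.HashInjective (E : Env P S D) : Prop where
  code : Function.Injective (E.hash 224)
  key : Function.Injective (E.hash 192)

/-- The serial number and vote code to which the signatures refer that come with a command. -/
def Cmd.subject (cmd : Cmd P) (s : State P S) : Option (Fin P.n × Code) :=
  match cmd with
  | .endorsement i ℓ _ => (s.vc i ℓ).asking.map fun c => (ℓ, c)
  | .voteP _ ℓ _ c _ => some (ℓ, c)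
  | .announce _ ℓ _ c => c.map fun c => (ℓ, c)
  | .recover _ ℓ _ c => some (ℓ, c)
  | _ => none

/-- The command comes with a valid signature of `j` on a vote code that `j` has not endorsed. -/
def Env.Forges (E : Env P S D) (cmd : Cmd P) (σ : Fin P.Nv → S) (s : State P S) (j : Fin P.Nv) :
    Prop :=
  j ∉ E.badV ∧ ∃ x, cmd.subject s = some x ∧ E.verify j (endorseMsg P x.1 x.2) (σ j) = true ∧
    (s.vc j x.1).endorsed ≠ some x.2

/-- A corrupted node answers the voter with her receipt, of which it does not know enough
shares. -/
def Env.Guesses (E : Env P S D) (v : Fin P.n) (cmd : Cmd P) (s : State P S) : Prop :=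
  ∃ r o, cmd = .reply v r ∧ (s.voter v).waiting ∧ (∃ i ∈ E.badV, (s.voter v).current = some i) ∧
    (s.voter v).choice = some o ∧ r = E.setup.receipt v (E.setup.part v, o) ∧
    (E.holders s v (E.setup.part v, o)).card < P.thr

/-- What holds for the record `r` of the honest node `i` about ballot `ℓ`. -/
structure Env.RecordInv (E : Env P S D) (s : State P S) (i : Fin P.Nv) (ℓ : Fin P.n)
    (closed : Bool) (r : VcBallot P S) : Prop where
  collected : ∀ j σ, r.collected j = some σ → ∃ c, r.asking = some c ∧
    E.verify j (endorseMsg P ℓ c) σ = true ∧ (j ∈ E.badV ∨ (s.vc j ℓ).endorsed = some c)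
  cert : ∀ c u, r.cert = some (c, u) →
    E.ValidCert ℓ c u ∧ (E.findPos ℓ c).isSome = true ∧ E.Backed s ℓ c
  announced : ∀ x, r.announced = some x → r.cert = some x
  announced_own : closed = true → (r.shares i).isSome = true → r.announced.isSome = true
  own : (r.shares i).isSome = true → r.cert.isSome = true
  shares : ∀ k ∉ E.badV, k ≠ i → (r.shares k).isSome = true → ∃ c, r.cert.map Prod.fst = some c ∧
    (s.vc k ℓ).cert.map Prod.fst = some c ∧ ((s.vc k ℓ).shares k).isSome = true
  receipt : r.receipt.isSome = true →
    P.thr ≤ (Finset.univ.filter fun k => (r.shares k).isSome = true).card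
  heard : ∀ k ∈ r.heard, k ∉ E.badV → s.closed k = true ∧
    ((s.vc k ℓ).announced.isSome = true → r.cert.isSome = true)
  proposal : ∀ b, r.proposal = some b → P.thr ≤ r.heard.card ∧
    (b = true → r.cert.isSome = true) ∧
    (b = false → ∀ k ∈ r.heard, k ∉ E.badV → (s.vc k ℓ).announced = none)
  outcome : ∀ o, r.outcome = some o → (o = none ∧ s.decision ℓ = some false) ∨
    ∃ c, o = some c ∧ s.decision ℓ = some true ∧ r.cert.map Prod.fst = some c

/-- The vote set of a VC node. -/
def State.voteSet (s : State P S) (k : Fin P.Nv) : VoteSet P := fun ℓ => ((s.vc k ℓ).outcome).join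

open scoped Classical in
/-- What holds in all states that are reached without collisions, forgeries and guesses; `v` is
the voter under consideration. -/
structure Env.Inv (E : Env P S D) (v : Fin P.n) (s : State P S) : Prop where
  record : ∀ i ∉ E.badV, ∀ ℓ, E.RecordInv s i ℓ (s.closed i) (s.vc i ℓ)
  decision : ∀ ℓ b, s.decision ℓ = some b → ∃ i ∉ E.badV, (s.vc i ℓ).proposal = some b
  sentKey : ∀ k ∉ E.badV, ∀ x, s.sentKey k = some x → x = E.setup.mskShare k ∧
    ∀ ℓ, (s.vc k ℓ).outcome.isSome = true
  sets : ∀ b, ∀ k ∉ E.badV, ∀ V, (s.bb b).sets k = some V →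
    (s.bb b).keyShares k = some (E.setup.mskShare k) ∧
    (∀ ℓ, (s.vc k ℓ).outcome.isSome = true) ∧ V = s.voteSet k
  published : ∀ b V, (s.bb b).published = some V → ∃ k ∉ E.badV, (s.bb b).sets k = some V
  unpublished : ∀ b, (s.bb b).published = none → ∀ V,
    (Finset.univ.filter fun k => (s.bb b).sets k = some V).card ≤ P.fv
  msk : ∀ b key, (s.bb b).msk = some key → key = E.setup.msk
  trustee : ∀ t ∉ E.badT, ∀ T, s.trustee t = some T → ∃ b ∉ E.badB, ∃ V,
    (s.bb b).published = some V ∧ T = E.setup.tallyShare V E.setup.msk t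
  posts : ∀ b, ∀ t ∉ E.badT, ∀ T, (s.bb b).posts t = some T → s.trustee t = some T
  result : ∀ b R, (s.bb b).result = some R → ∃ V, (s.bb b).published = some V ∧
    ∀ o, R o = ∑ x ∈ E.setup.tallySet V E.setup.msk, E.setup.entry x.1 x.2 o
  cast : ∀ o, (s.voter v).choice = some o →
    (s.voter v).cast = some ((E.setup.code v).1 (E.setup.part v, o))
  accepted : (s.voter v).accepted = true → ∃ o, (s.voter v).choice = some o ∧
    P.thr ≤ (E.holders s v (E.setup.part v, o)).card

/-! ### Atomic changes of the state -/

open scoped Classical in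
/-- Atomic changes of the state. What depends on the invariants is only asserted under the
hypothesis `G`. -/
inductive Env.Move (E : Env P S D) (v : Fin P.n) (G : Prop) : State P S → State P S → Prop
  | corrupt (s : State P S) (ℓ : Fin P.n) (x : (Line P → Code) × (Line P → Receipt)) :
    E.Move v G s (s.setVoter ℓ { s.voter ℓ with revealed := some x })
  | start (s : State P S) (ℓ : Fin P.n) (o : Fin P.m) (i : Fin P.Nv)
    (h : (s.voter ℓ).choice = none) :
    E.Move v G s (s.setVoter ℓ { s.voter ℓ with
      choice := some o
      cast := some ((E.setup.code ℓ).1 (E.setup.part ℓ, o))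
      tried := {i}
      current := some i })
  | retry (s : State P S) (ℓ : Fin P.n) (i : Fin P.Nv) (hi : i ∉ (s.voter ℓ).tried)
    (h : (s.voter ℓ).waiting) :
    E.Move v G s (s.setVoter ℓ { s.voter ℓ with
      tried := insert i (s.voter ℓ).tried
      current := some i })
  | answer (s : State P S) (ℓ : Fin P.n) (acc : Bool) (h : (s.voter ℓ).waiting)
    (h' : G → ℓ = v → acc = true → ∃ o, (s.voter ℓ).choice = some o ∧
      P.thr ≤ (E.holders s ℓ (E.setup.part ℓ, o)).card) :
    E.Move v G s (s.setVoter ℓ { s.voter ℓ with current := none, accepted := acc })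
  | vote (s : State P S) (i : Fin P.Nv) (ℓ : Fin P.n) (c : Code) (hi : i ∉ E.badV) :
    E.Move v G s (s.setVc i ℓ { s.vc i ℓ with asking := some c, collected := fun _ => none })
  | endorse (s : State P S) (i : Fin P.Nv) (ℓ : Fin P.n) (c : Code) (hi : i ∉ E.badV)
    (h : (s.vc i ℓ).endorsed = none ∨ (s.vc i ℓ).endorsed = some c) :
    E.Move v G s (s.setVc i ℓ { s.vc i ℓ with endorsed := some c })
  | collect (s : State P S) (i : Fin P.Nv) (ℓ : Fin P.n) (k : Fin P.Nv) (σ : S) (c : Code)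
    (hi : i ∉ E.badV) (ha : (s.vc i ℓ).asking = some c)
    (hσ : E.verify k (endorseMsg P ℓ c) σ = true)
    (h : G → k ∈ E.badV ∨ (s.vc k ℓ).endorsed = some c) :
    E.Move v G s (s.setVc i ℓ { s.vc i ℓ with
      collected := Function.update (s.vc i ℓ).collected k (some σ) })
  | adopt (s : State P S) (i : Fin P.Nv) (ℓ : Fin P.n) (p : Pos P) (c : Code) (u : UCert P S)
    (hi : i ∉ E.badV) (hc : (s.vc i ℓ).cert = none) (hcl : s.closed i = false)
    (hp : E.findPos ℓ c = some p)
    (h : G → E.ValidCert ℓ c u ∧ E.Backed s ℓ c) :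
    E.Move v G s (s.setVc i ℓ (E.adopt i ℓ p c u (s.vc i ℓ)))
  | share (s : State P S) (i : Fin P.Nv) (ℓ : Fin P.n) (k : Fin P.Nv) (x : Share P) (c : Code)
    (hi : i ∉ E.badV) (hc : (s.vc i ℓ).cert.map Prod.fst = some c) (hcl : s.closed i = false)
    (hki : k ≠ i)
    (h : G → k ∉ E.badV → (s.vc k ℓ).cert.map Prod.fst = some c ∧
      ((s.vc k ℓ).shares k).isSome = true) :
    E.Move v G s (s.setVc i ℓ { s.vc i ℓ with
      shares := Function.update (s.vc i ℓ).shares k (some x) })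
  | receipt (s : State P S) (i : Fin P.Nv) (ℓ : Fin P.n) (x : Receipt) (hi : i ∉ E.badV)
    (h : P.thr ≤ (Finset.univ.filter fun k => ((s.vc i ℓ).shares k).isSome = true).card) :
    E.Move v G s (s.setVc i ℓ { s.vc i ℓ with receipt := some x })
  | close (s : State P S) (i : Fin P.Nv) (hi : i ∉ E.badV) (hcl : s.closed i = false) :
    E.Move v G s { s with
      closed := Function.update s.closed i true
      vc := Function.update s.vc i fun ℓ => { s.vc i ℓ with announced := (s.vc i ℓ).cert } }
  | announce (s : State P S) (i : Fin P.Nv) (ℓ : Fin P.n) (k : Fin P.Nv)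
    (known : Option (Code × UCert P S)) (hi : i ∉ E.badV)
    (hcl : s.closed i = true) (hpr : (s.vc i ℓ).proposal = none)
    (hold : ∀ x, (s.vc i ℓ).cert = some x → known = some x)
    (hnew : (s.vc i ℓ).cert = none → ∀ c u, known = some (c, u) →
      (E.findPos ℓ c).isSome = true ∧ (G → E.ValidCert ℓ c u ∧ E.Backed s ℓ c))
    (h : G → k ∉ E.badV → s.closed k = true ∧
      ((s.vc k ℓ).announced.isSome = true → known.isSome = true)) :
    E.Move v G s (s.setVc i ℓ { s.vc i ℓ with
      heard := insert k (s.vc i ℓ).heard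
      cert := known
      proposal := if P.thr ≤ (insert k (s.vc i ℓ).heard).card then some known.isSome else none })
  | decide (s : State P S) (ℓ : Fin P.n) (b : Bool) (hd : s.decision ℓ = none)
    (h : ∃ i, i ∉ E.badV ∧ (s.vc i ℓ).proposal = some b) :
    E.Move v G s { s with decision := Function.update s.decision ℓ (some b) }
  | learn (s : State P S) (i : Fin P.Nv) (ℓ : Fin P.n) (o : Option Code) (hi : i ∉ E.badV)
    (ho : (s.vc i ℓ).outcome = none)
    (h : (o = none ∧ s.decision ℓ = some false) ∨
      ∃ c, o = some c ∧ s.decision ℓ = some true ∧ (s.vc i ℓ).cert.map Prod.fst = some c) :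
    E.Move v G s (s.setVc i ℓ { s.vc i ℓ with outcome := some o })
  | recover (s : State P S) (i : Fin P.Nv) (ℓ : Fin P.n) (c : Code) (u : UCert P S)
    (hi : i ∉ E.badV) (hd : s.decision ℓ = some true) (hc : (s.vc i ℓ).cert = none)
    (ho : (s.vc i ℓ).outcome = none) (hp : (E.findPos ℓ c).isSome = true)
    (h : G → E.ValidCert ℓ c u ∧ E.Backed s ℓ c) :
    E.Move v G s (s.setVc i ℓ { s.vc i ℓ with cert := some (c, u), outcome := some (some c) })
  | finish (s : State P S) (i : Fin P.Nv) (h : ∀ ℓ, (s.vc i ℓ).outcome.isSome = true) :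
    E.Move v G s { s with
      sentKey := Function.update s.sentKey i (some (E.setup.mskShare i)) }
  | submit (s : State P S) (b : Fin P.Nb) (k : Fin P.Nv) (V : VoteSet P) (x : Share P)
    (hs : (s.bb b).sets k = none)
    (h : k ∉ E.badV → s.sentKey k = some x ∧ V = s.voteSet k) :
    E.Move v G s (s.setBb b { s.bb b with
      sets := Function.update (s.bb b).sets k (some V)
      keyShares := Function.update (s.bb b).keyShares k (some x)
      published := if (s.bb b).published = none ∧ P.fv + 1 ≤ (Finset.univ.filter fun j =>
          Function.update (s.bb b).sets k (some V) j = some V).card then some V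
        else (s.bb b).published })
  | openKey (s : State P S) (b : Fin P.Nb) (key : MasterKey) (hm : (s.bb b).msk = none)
    (h : E.hash 192 (Fin.append key E.setup.mskSalt) = E.mskDigest) :
    E.Move v G s (s.setBb b { s.bb b with msk := some key })
  | read (s : State P S) (t : Fin P.Nt) (R : Finset (Fin P.Nb)) (V : VoteSet P)
    (key : MasterKey) (ht : s.trustee t = none) (hR : P.fb + 1 ≤ R.card)
    (h : ∀ b ∈ R, b ∈ E.badB ∨ ((s.bb b).published = some V ∧ (s.bb b).msk = some key)) :
    E.Move v G s { s with
      trustee := Function.update s.trustee t (some (E.setup.tallyShare V key t)) }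
  | post (s : State P S) (t : Fin P.Nt) (b : Fin P.Nb) (T : TallyShare P)
    (h : t ∉ E.badT → s.trustee t = some T) :
    E.Move v G s
      (s.setBb b { s.bb b with posts := Function.update (s.bb b).posts t (some T) })
  | combine (s : State P S) (b : Fin P.Nb) (V : VoteSet P) (key : MasterKey)
    (res rand : Fin P.m → ZMod P.q)
    (hV : (s.bb b).published = some V) (hk : (s.bb b).msk = some key)
    (h : ∀ o, elgamal (res o) (rand o) =
      ∏ x ∈ E.setup.tallySet V key, E.setup.com x.1 x.2 o) :
    E.Move v G s (s.setBb b { s.bb b with result := some res })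

end Invariants

/-! ### Decomposition of commands into atomic moves -/

section StepMoves

variable {P : Params} {S D : Type}

theorem append_left_cancel {a b : ℕ} {x x' : Str a} {y y' : Str b}
    (h : (Fin.append x y : Str (a + b)) = Fin.append x' y') : x = x' := by
  funext i
  simpa using congrFun h (Fin.castAdd b i)

theorem append_right_cancel {a b : ℕ} {x x' : Str a} {y y' : Str b}
    (h : (Fin.append x y : Str (a + b)) = Fin.append x' y') : y = y' := by
  funext i
  simpa using congrFun h (Fin.natAdd a i)

/-- An injective hash lets the salted digest of a position match only the vote code stored there. -/
theorem Env.findPos_spec {E : Env P S D} (hH : E.HashInjective) {ℓ : Fin P.n} {c : Code}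
    {p : Pos P} (h : E.findPos ℓ c = some p) : c = E.setup.codeAt ℓ p := by
  unfold Env.findPos at h
  split at h
  case isTrue hex =>
    have := hex.choose_spec
    rw [Option.some.inj h] at this
    exact append_left_cancel (hH.code this)
  case isFalse => cases h

theorem Env.findPos_isSome {E : Env P S D} (ℓ : Fin P.n) (p : Pos P) :
    (E.findPos ℓ (E.setup.codeAt ℓ p)).isSome = true := by
  unfold Env.findPos
  rw [dif_pos ⟨p, rfl⟩]
  rfl

theorem Setup.codeAt_symm (e : Setup P) (ℓ : Fin P.n) (x : Line P) :
    e.codeAt ℓ (x.1, (e.perm ℓ x.1).symm x.2) = (e.code ℓ).1 x := by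
  simp [Setup.codeAt, Setup.line]

theorem Env.eq_code_of_lineOf {E : Env P S D} (hH : E.HashInjective) {ℓ : Fin P.n} {c : Code}
    {x : Line P} (h : E.lineOf ℓ c = some x) : c = (E.setup.code ℓ).1 x := by
  obtain ⟨p, hp, rfl⟩ := Option.map_eq_some_iff.1 h
  exact E.findPos_spec hH hp

/-- Some position with a matching digest exists. It carries the same vote code, and the vote codes
of a ballot are distinct, so it lies behind the given line. -/
theorem Env.lineOf_code {E : Env P S D} (hH : E.HashInjective) (ℓ : Fin P.n) (x : Line P) :
    E.lineOf ℓ ((E.setup.code ℓ).1 x) = some x := by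
  obtain ⟨p, hp⟩ := Option.isSome_iff_exists.1 (E.findPos_isSome ℓ (x.1, (E.setup.perm ℓ x.1).symm x.2))
  rw [Setup.codeAt_symm] at hp
  have h := E.findPos_spec hH hp
  rw [Env.lineOf, hp, Option.map_some]
  exact congrArg some ((E.setup.code ℓ).2 h).symm

/-- A certificate made of unforged signatures backs the vote code. -/
theorem Env.ValidCert.backed {E : Env P S D} {s : State P S} {ℓ : Fin P.n} {c : Code}
    {u : UCert P S} (h : E.ValidCert ℓ c u)
    (hu : ∀ j σ, u j = some σ → E.verify j (endorseMsg P ℓ c) σ = true →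
      j ∈ E.badV ∨ (s.vc j ℓ).endorsed = some c) : E.Backed s ℓ c := by
  refine le_trans h (Finset.card_le_card fun j hj => ?_)
  obtain ⟨σ, h1, h2⟩ := (Finset.mem_filter.1 hj).2
  exact Finset.mem_filter.2 ⟨Finset.mem_univ _, hu j σ h1 h2⟩

/-- A valid signature of an honest node that has not endorsed the vote code is what `Env.Forges`
describes, so without forgeries a certificate supplied by the adversary is as good as a collected
one. -/
theorem Env.ValidCert.backed_of_not_forges {E : Env P S D} {s : State P S} {ℓ : Fin P.n}
    {c : Code} {cmd : Cmd P} {σ : Fin P.Nv → S} (hs : cmd.subject s = some (ℓ, c))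
    (hF : ∀ j, ¬ E.Forges cmd σ s j) (h : E.ValidCert ℓ c fun k => some (σ k)) :
    E.Backed s ℓ c := by
  refine h.backed fun j τ hj hv => ?_
  by_contra hn
  rw [not_or] at hn
  obtain rfl := Option.some.inj hj
  exact hF j ⟨hn.1, (ℓ, c), hs, hv, hn.2⟩

open Relation in
-- Reconstruction amounts to at most one more move, whose only requirement is the number of shares
-- that it checks itself.
theorem Env.tryReceipt_moves (E : Env P S D) (v : Fin P.n) (G : Prop) (s₀ s : State P S)
    (i : Fin P.Nv) (ℓ : Fin P.n) (r : VcBallot P S) (hi : i ∉ E.badV)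
    (h : ReflTransGen (E.Move v G) s₀ (s.setVc i ℓ r)) :
    ReflTransGen (E.Move v G) s₀ (s.setVc i ℓ (tryReceipt r)) := by
  unfold tryReceipt
  dsimp only
  split
  case isTrue hr =>
    refine h.tail ?_
    have := Env.Move.receipt (E := E) (v := v) (G := G) (s.setVc i ℓ r) i ℓ
      (bitsOfZ 64 (vssRec (Finset.univ.filter fun k => (r.shares k).isSome = true)
        fun k => ((r.shares k).getD 0).1)) hi (by simpa using hr.2)
    simpa using this
  case isFalse => exact h

open Relation in
/-- The steps of the system are made of atomic changes. -/
theorem Env.step_moves (E : Env P S D) (v : Fin P.n) (G : Prop) (cmd : Cmd P)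
    (σ : Fin P.Nv → S) (s : State P S)
    (hG : G → E.HashInjective ∧ E.Inv v s ∧ (∀ j, ¬ E.Forges cmd σ s j) ∧ ¬ E.Guesses v cmd s) :
    ReflTransGen (E.Move v G) s (E.step cmd σ s) := by
  cases cmd with
  | corrupt ℓ => exact .single (.corrupt _ _ _)
  | start ℓ o i =>
    simp only [Env.step]
    split
    case isTrue h => exact .single (.start _ _ _ _ h.2)
    case isFalse => rfl
  | retry ℓ i =>
    simp only [Env.step]
    split
    case isTrue h => exact .single (.retry _ _ _ h.2 h.1)
    case isFalse => rfl
  | reply ℓ r =>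
    simp only [Env.step]
    split
    case isTrue h =>
      refine .single (.answer _ _ _ h.1 fun g hv hacc => ?_)
      subst hv
      have hacc' : E.validReceipt ℓ r s := by simpa using hacc
      obtain ⟨o, ho, hr⟩ := hacc'
      refine ⟨o, ho, ?_⟩
      -- The right answer with too few known shares would be a guess, which `hG` excludes.
      by_contra hlt
      exact (hG g).2.2.2 ⟨r, o, rfl, h.1, h.2, ho, hr, not_le.1 hlt⟩
    case isFalse => rfl
  | relayReceipt ℓ =>
    simp only [Env.step]
    split
    · rfl
    split
    · rfl
    split
    case h_2.isTrue i _ _ r hr h =>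
      refine .single (.answer _ _ _ h.1 fun g hv hacc => ?_)
      subst hv
      obtain ⟨hH, hI, -, -⟩ := hG g
      have hacc' : E.validReceipt ℓ r s := by simpa using hacc
      obtain ⟨o, ho, -⟩ := hacc'
      refine ⟨o, ho, ?_⟩
      have hrec := hI.record i h.2.1 ℓ
      -- An honest node sends a receipt only if it has a quorum of shares, each of which belongs to
      -- a corrupted node or was disclosed for the certified vote code. This is the voter's vote
      -- code, so these nodes are holders of the line that she expects.
      refine (hrec.receipt (by rw [hr]; rfl)).trans (Finset.card_le_card fun k hk => ?_)
      rw [Finset.mem_filter] at hk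
      refine Env.mem_holders.2 ?_
      have hc := h.2.2.trans (hI.cast o ho)
      by_cases hkb : k ∈ E.badV
      · exact .inl hkb
      refine .inr ?_
      by_cases hki : k = i
      · subst hki
        exact ⟨hk.2, _, hc, E.lineOf_code hH _ _⟩
      · obtain ⟨c, h1, h2, h3⟩ := hrec.shares k hkb hki hk.2
        rw [hc] at h1
        obtain rfl := Option.some.inj h1
        exact ⟨h3, _, h2, E.lineOf_code hH _ _⟩
    case h_2.isFalse => rfl
  | vote i ℓ c =>
    simp only [Env.step]
    split
    case isTrue h => exact .single (.vote _ _ _ _ h.1)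
    case isFalse => rfl
  | endorse i ℓ c =>
    simp only [Env.step]
    split
    case isTrue h => exact .single (.endorse _ _ _ _ h.1 h.2.2)
    case isFalse => rfl
  | endorsement i ℓ k =>
    simp only [Env.step]
    split
    case isFalse => rfl
    case isTrue hi =>
    unfold Env.onEndorsement
    dsimp only
    split
    case h_2 => rfl
    case h_1 c ha hc =>
    split
    case isFalse => rfl
    case isTrue hv =>
    have hk : G → k ∈ E.badV ∨ (s.vc k ℓ).endorsed = some c := fun g => by
      by_contra hn
      rw [not_or] at hn
      exact (hG g).2.2.1 k ⟨hn.1, (ℓ, c), by simp [Cmd.subject, ha], hv.2, hn.2⟩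
    have hcol := Env.Move.collect (v := v) s i ℓ k (σ k) c hi ha hv.2 hk
    split
    case isFalse => exact .single hcol
    case isTrue hthr =>
    split
    case h_2 => rfl
    case h_1 p hp =>
    refine E.tryReceipt_moves v G _ _ _ _ _ hi ?_
    refine (ReflTransGen.single hcol).tail ?_
    -- All collected signatures concern the vote code that is being asked for, by the invariant for
    -- the old ones and by `hv` and `hk` for the new one; together they form a valid and backed
    -- certificate.
    have hu : G → ∀ j τ, Function.update (s.vc i ℓ).collected k (some (σ k)) j = some τ →
        E.verify j (endorseMsg P ℓ c) τ = true ∧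
          (j ∈ E.badV ∨ (s.vc j ℓ).endorsed = some c) := fun g j τ hj => by
      by_cases hjk : j = k
      · subst hjk
        simp only [Function.update_self, Option.some.injEq] at hj
        subst hj
        exact ⟨hv.2, hk g⟩
      · rw [Function.update_of_ne hjk] at hj
        obtain ⟨c', h1, h2, h3⟩ := ((hG g).2.1.record i hi ℓ).collected j τ hj
        rw [ha] at h1
        obtain rfl := Option.some.inj h1
        exact ⟨h2, h3⟩
    have had := Env.Move.adopt (E := E) (v := v) (G := G) (s.setVc i ℓ { s.vc i ℓ with
      collected := Function.update (s.vc i ℓ).collected k (some (σ k)) }) i ℓ p c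
      (Function.update (s.vc i ℓ).collected k (some (σ k))) hi (by simpa using hc)
      (by simpa using hv.1) hp (fun g => by
        have hval : E.ValidCert ℓ c (Function.update (s.vc i ℓ).collected k (some (σ k))) := by
          refine le_trans hthr (Finset.card_le_card fun j hj => ?_)
          obtain ⟨τ, hτ⟩ := Option.isSome_iff_exists.1 (Finset.mem_filter.1 hj).2
          exact Finset.mem_filter.2 ⟨Finset.mem_univ _, τ, hτ, (hu g j τ hτ).1⟩
        refine ⟨hval, hval.backed fun j τ hj _ => ?_⟩
        have := (hu g j τ hj).2
        rw [State.setVc_vc]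
        split
        case isTrue h => obtain ⟨rfl, -⟩ := h; exact this
        case isFalse => exact this)
    simpa using had
  | voteP i ℓ k c x =>
    simp only [Env.step]
    split
    case isFalse => rfl
    case isTrue hb =>
    have hki : k ≠ i := fun h => hb.1 (h ▸ hb.2)
    unfold Env.onVoteP
    dsimp only
    split
    · rfl
    case h_2 p hp =>
    split
    case isFalse => rfl
    case isTrue hv =>
    split
    case h_1 hc =>
      refine E.tryReceipt_moves v G _ _ _ _ _ hb.1 ?_
      have had := Env.Move.adopt (v := v) (G := G) s i ℓ p c (fun k => some (σ k)) hb.1 hc hv.1 hp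
        (fun g => ⟨hv.2.1, hv.2.1.backed_of_not_forges rfl (hG g).2.2.1⟩)
      unfold addShare
      split
      case isFalse => exact .single had
      case isTrue hn =>
      refine (ReflTransGen.single had).tail ?_
      have := Env.Move.share (E := E) (v := v) (G := G)
        (s.setVc i ℓ (E.adopt i ℓ p c (fun k => some (σ k)) (s.vc i ℓ)))
        i ℓ k x c hb.1 (by simp [Env.adopt]) (by simpa using hv.1) hki (fun _ h => absurd hb.2 h)
      simpa using this
    case h_2 c' u' hc =>
      split
      case isFalse => rfl
      case isTrue h =>
      refine E.tryReceipt_moves v G _ _ _ _ _ hb.1 ?_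
      unfold addShare
      split
      case isFalse => rw [State.setVc_self]
      case isTrue hn =>
      exact .single (.share s i ℓ k x c hb.1 (by rw [hc]; simp [h]) hv.1 hki
        fun _ h => absurd hb.2 h)
  | relayVoteP i ℓ k =>
    simp only [Env.step]
    split
    case h_2 => rfl
    case h_1 c w x hck hsk =>
    split
    case isFalse => rfl
    case isTrue hb =>
    unfold Env.onVoteP
    dsimp only
    split
    · rfl
    case h_2 p hp =>
    split
    case isFalse => rfl
    case isTrue hv =>
    split
    case h_1 hc =>
      have hki : k ≠ i := fun h => by rw [h, hc] at hck; cases hck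
      refine E.tryReceipt_moves v G _ _ _ _ _ hb.1 ?_
      have had := Env.Move.adopt (v := v) (G := G) s i ℓ p c w hb.1 hc hv.1 hp
        (fun g => ⟨hv.2.1, (((hG g).2.1.record k hb.2 ℓ).cert c w hck).2.2⟩)
      unfold addShare
      split
      case isFalse => exact .single had
      case isTrue hn =>
      refine (ReflTransGen.single had).tail ?_
      have := Env.Move.share (E := E) (v := v) (G := G)
        (s.setVc i ℓ (E.adopt i ℓ p c w (s.vc i ℓ)))
        i ℓ k x c hb.1 (by simp [Env.adopt]) (by simpa using hv.1) hki
        (fun _ _ => by rw [State.setVc_vc, if_neg (fun h => hki h.1)]; simp [hck, hsk])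
      simpa using this
    case h_2 c' u' hc =>
      split
      case isFalse => rfl
      case isTrue h =>
      refine E.tryReceipt_moves v G _ _ _ _ _ hb.1 ?_
      unfold addShare
      split
      case isFalse => rw [State.setVc_self]
      case isTrue hn =>
      -- The sender has its own share, whereas the receiver still lacks it.
      have hki : k ≠ i := fun h => by rw [← h, hsk] at hn; cases hn
      exact .single (.share s i ℓ k x c hb.1 (by rw [hc]; simp [h]) hv.1 hki
        fun _ _ => by simp [hck, hsk])
  | close i =>
    simp only [Env.step]
    split
    case isTrue h => exact .single (.close _ _ h.1 h.2)
    case isFalse => rfl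
  | announce i ℓ k c =>
    simp only [Env.step]
    split
    case isFalse => rfl
    case isTrue hb =>
    unfold Env.onAnnounce
    dsimp only
    split
    case isFalse => rfl
    case isTrue hcl =>
    refine .single (.announce s i ℓ k _ hb.1 hcl.1 hcl.2 ?_ ?_ fun _ h => absurd hb.2 h)
    · intro y hy
      rw [hy]
    · intro hn c' u' h
      rw [hn] at h
      rcases c with _ | c
      · cases h
      simp only [Option.map_some] at h
      split at h
      case isTrue hv =>
        have h' := Option.some.inj h
        rw [Prod.ext_iff] at h'
        obtain ⟨rfl, rfl⟩ := h'
        exact ⟨hv.2, fun g => ⟨hv.1, hv.1.backed_of_not_forges rfl (hG g).2.2.1⟩⟩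
      case isFalse => cases h
  | relayAnnounce i ℓ k =>
    simp only [Env.step]
    split
    case isFalse => rfl
    case isTrue hb =>
    unfold Env.onAnnounce
    dsimp only
    split
    case isFalse => rfl
    case isTrue hcl =>
    refine .single (.announce s i ℓ k _ hb.1 hcl.1 hcl.2 ?_ ?_ fun g _ => ⟨hb.2.2, fun ha => ?_⟩)
    · intro y hy
      rw [hy]
    · intro hn c' u' h
      rw [hn] at h
      rcases ha : (s.vc k ℓ).announced with _ | ⟨c, u⟩
      · rw [ha] at h; cases h
      simp only [ha] at h
      split at h
      case isTrue hv =>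
        have h' := Option.some.inj h
        rw [Prod.ext_iff] at h'
        obtain ⟨rfl, rfl⟩ := h'
        have hrec := (hG · |>.2.1.record k hb.2.1 ℓ)
        exact ⟨hv.2, fun g => ⟨hv.1, ((hrec g).cert c u ((hrec g).announced _ ha)).2.2⟩⟩
      case isFalse => cases h
    -- What an honest node announces is its valid certificate, so the receiver adopts it unless it
    -- has one already.
    · have hrec := (hG g).2.1.record k hb.2.1 ℓ
      rcases ha' : (s.vc k ℓ).announced with _ | ⟨c, u⟩
      · rw [ha'] at ha; cases ha
      obtain ⟨h1, h2, -⟩ := hrec.cert c u (hrec.announced _ ha')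
      rcases hc : (s.vc i ℓ).cert with _ | y
      · simp [h1, h2]
      · simp
  | decide ℓ b =>
    simp only [Env.step]
    split
    case isTrue h => exact .single (.decide _ _ _ h.1 h.2)
    case isFalse => rfl
  | learn i ℓ =>
    simp only [Env.step]
    split
    case isFalse => rfl
    case isTrue hb =>
    split
    case h_1 hd => exact .single (.learn _ _ _ _ hb.1 hb.2.2 (.inl ⟨rfl, hd⟩))
    case h_2 c u hd hc =>
      exact .single (.learn _ _ _ _ hb.1 hb.2.2 (.inr ⟨c, rfl, hd, by rw [hc]; rfl⟩))
    case h_3 => rfl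
  | recover i ℓ k c =>
    simp only [Env.step]
    split
    case isFalse => rfl
    case isTrue hb =>
    unfold Env.onRecover
    dsimp only
    split
    case isFalse => rfl
    case isTrue h =>
    exact .single (.recover s i ℓ c _ hb.1 h.2.1 h.2.2.1 h.2.2.2.1 h.2.2.2.2.2 fun g =>
      ⟨h.2.2.2.2.1, h.2.2.2.2.1.backed_of_not_forges rfl (hG g).2.2.1⟩)
  | relayRecover i ℓ k =>
    simp only [Env.step]
    split
    case h_2 => rfl
    case h_1 c w hck =>
    split
    case isFalse => rfl
    case isTrue hb =>
    unfold Env.onRecover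
    dsimp only
    split
    case isFalse => rfl
    case isTrue h =>
    exact .single (.recover s i ℓ c _ hb.1 h.2.1 h.2.2.1 h.2.2.2.1 h.2.2.2.2.2 fun g =>
      ⟨h.2.2.2.2.1, (((hG g).2.1.record k hb.2 ℓ).cert c w hck).2.2⟩)
  | finish i =>
    simp only [Env.step]
    split
    case isTrue h => exact .single (.finish _ _ h.2)
    case isFalse => rfl
  | relaySubmit k b =>
    simp only [Env.step]
    split
    case h_2 => rfl
    case h_1 x hx =>
    split
    case isFalse => rfl
    case isTrue hk =>
    unfold onSubmit
    dsimp only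
    split
    case isFalse => rfl
    case isTrue h => exact .single (.submit s b k _ x h fun _ => ⟨hx, rfl⟩)
  | submit k b V x =>
    simp only [Env.step]
    split
    case isFalse => rfl
    case isTrue hk =>
    unfold onSubmit
    dsimp only
    split
    case isFalse => rfl
    case isTrue h => exact .single (.submit s b k _ x h fun h => absurd hk h)
  | openKey b Q =>
    simp only [Env.step]
    split
    case isFalse => rfl
    case isTrue hb =>
    unfold Env.onOpenKey
    dsimp only
    split
    case isFalse => rfl
    case isTrue h => exact .single (.openKey s b _ h.1 h.2.2.2)
  | read t R V key =>
    simp only [Env.step]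
    split
    case isFalse => rfl
    case isTrue h => exact .single (.read s t R V key h.2.1 h.2.2.1 h.2.2.2)
  | relayPost t b =>
    simp only [Env.step]
    split
    case h_2 => rfl
    case h_1 T hT _ =>
    split
    case isFalse => rfl
    case isTrue h => exact .single (.post s t b T fun _ => hT)
  | post t b T =>
    simp only [Env.step]
    split
    case isFalse => rfl
    case isTrue h => exact .single (.post s t b T fun h' => absurd h.1 h')
  | combine b Q =>
    simp only [Env.step]
    split
    case isFalse => rfl
    case isTrue hb =>
    unfold Env.onCombine
    dsimp only
    split
    case h_2 => rfl
    case h_1 V key hV hk =>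
    split
    case isFalse => rfl
    case isTrue h => exact .single (.combine s b V key _ _ hV hk h.2.2.2)

end StepMoves

/-! ### Monotonicity of the state -/

section Preservation

variable {P : Params} {S D : Type}

/-- Monotone changes of the record of a node; `closed` is the state of its clock before. -/
structure VcBallot.Le (closed : Bool) (r r' : VcBallot P S) : Prop where
  endorsed : ∀ c, r.endorsed = some c → r'.endorsed = some c
  cert : ∀ x, r.cert = some x → r'.cert = some x
  announced : closed = true → r'.announced = r.announced
  shares : ∀ k, (r.shares k).isSome = true → (r'.shares k).isSome = true
  proposal : ∀ b, r.proposal = some b → r'.proposal = some b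
  outcome : ∀ o, r.outcome = some o → r'.outcome = some o

theorem VcBallot.Le.refl (closed : Bool) (r : VcBallot P S) : r.Le closed r :=
  ⟨fun _ => id, fun _ => id, fun _ => rfl, fun _ => id, fun _ => id, fun _ => id⟩

/-- Monotone changes of the state. -/
structure State.Le (s s' : State P S) : Prop where
  vc : ∀ i ℓ, (s.vc i ℓ).Le (s.closed i) (s'.vc i ℓ)
  closed : ∀ i, s.closed i = true → s'.closed i = true
  decision : ∀ ℓ b, s.decision ℓ = some b → s'.decision ℓ = some b
  choice : ∀ ℓ o, (s.voter ℓ).choice = some o → (s'.voter ℓ).choice = some o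
  revealed : ∀ ℓ, (s.voter ℓ).revealed.isSome = true → (s'.voter ℓ).revealed.isSome = true
  accepted : ∀ ℓ, (s.voter ℓ).accepted = true → (s'.voter ℓ).accepted = true
  published : ∀ b V, (s.bb b).published = some V → (s'.bb b).published = some V

theorem State.Le.of_eq {s s' : State P S} (h₁ : s'.vc = s.vc) (h₂ : s'.closed = s.closed)
    (h₃ : s'.decision = s.decision) (h₄ : s'.voter = s.voter)
    (h₅ : ∀ b V, (s.bb b).published = some V → (s'.bb b).published = some V) : s.Le s' :=
  ⟨fun i ℓ => by rw [h₁]; exact .refl _ _, fun i h => by rw [h₂]; exact h,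
    fun ℓ b h => by rw [h₃]; exact h, fun ℓ o h => by rw [h₄]; exact h,
    fun ℓ h => by rw [h₄]; exact h, fun ℓ h => by rw [h₄]; exact h, h₅⟩

theorem State.Le.refl (s : State P S) : s.Le s := .of_eq rfl rfl rfl rfl fun _ _ => id

theorem State.Le.trans {s₁ s₂ s₃ : State P S} (h : s₁.Le s₂) (h' : s₂.Le s₃) : s₁.Le s₃ where
  vc i ℓ :=
    let a := h.vc i ℓ
    let b := h'.vc i ℓ
    ⟨fun c hc => b.endorsed c (a.endorsed c hc), fun c hc => b.cert c (a.cert c hc),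
      fun hc => (b.announced (h.closed i hc)).trans (a.announced hc),
      fun c hc => b.shares c (a.shares c hc), fun c hc => b.proposal c (a.proposal c hc),
      fun c hc => b.outcome c (a.outcome c hc)⟩
  closed i hi := h'.closed i (h.closed i hi)
  decision ℓ b hb := h'.decision ℓ b (h.decision ℓ b hb)
  choice ℓ b hb := h'.choice ℓ b (h.choice ℓ b hb)
  revealed ℓ hb := h'.revealed ℓ (h.revealed ℓ hb)
  accepted ℓ hb := h'.accepted ℓ (h.accepted ℓ hb)
  published ℓ b hb := h'.published ℓ b (h.published ℓ b hb)

theorem State.Le.setVc {s : State P S} {i : Fin P.Nv} {ℓ : Fin P.n} {r : VcBallot P S}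
    (h : (s.vc i ℓ).Le (s.closed i) r) : s.Le (s.setVc i ℓ r) where
  vc j ℓ' := by
    rw [State.setVc_vc]
    split
    case isTrue h' => obtain ⟨rfl, rfl⟩ := h'; exact h
    case isFalse => exact .refl _ _
  closed _ := id
  decision _ _ := id
  choice _ _ := id
  revealed _ := id
  accepted _ := id
  published _ _ := id

theorem State.Le.setVoter {s : State P S} {ℓ : Fin P.n} {w : Voter P}
    (h₁ : ∀ o, (s.voter ℓ).choice = some o → w.choice = some o)
    (h₂ : (s.voter ℓ).revealed.isSome = true → w.revealed.isSome = true)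
    (h₃ : (s.voter ℓ).accepted = true → w.accepted = true) : s.Le (s.setVoter ℓ w) where
  vc _ _ := .refl _ _
  closed _ := id
  decision _ _ := id
  choice ℓ' o h := by
    rw [State.setVoter_voter]; split
    case isTrue e => subst e; exact h₁ o h
    case isFalse => exact h
  revealed ℓ' h := by
    rw [State.setVoter_voter]; split
    case isTrue e => subst e; exact h₂ h
    case isFalse => exact h
  accepted ℓ' h := by
    rw [State.setVoter_voter]; split
    case isTrue e => subst e; exact h₃ h
    case isFalse => exact h
  published _ _ := id

theorem State.Le.setBb {s : State P S} {b : Fin P.Nb} {x : BbState P}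
    (h : ∀ V, (s.bb b).published = some V → x.published = some V) : s.Le (s.setBb b x) := by
  refine .of_eq rfl rfl rfl rfl fun b' V hV => ?_
  rw [State.setBb_bb]
  split
  case isTrue e => subst e; exact h V hV
  case isFalse => exact hV

/-- The guards of the moves make the data write-once: an endorsement, a certificate, a proposal, an
outcome or a decision is entered where there was none, or confirmed. The field `announced` changes
only at the moment of closing, which is why its stability is asserted for closed clocks only. -/
theorem Env.Move.le {E : Env P S D} {v : Fin P.n} {G : Prop} {s s' : State P S}
    (h : E.Move v G s s') : s.Le s' := by
  cases h with
  | corrupt ℓ x => exact .setVoter (fun _ => id) (fun _ => rfl) id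
  | start ℓ o i h => exact .setVoter (fun _ h' => (by rw [h] at h'; cases h')) id id
  | retry ℓ i => exact .setVoter (fun _ => id) id id
  | answer ℓ acc h =>
    exact .setVoter (fun _ => id) id fun h' => by rw [h.2.2] at h'; cases h'
  | vote i ℓ c =>
    exact .setVc ⟨fun _ => id, fun _ => id, fun _ => rfl, fun _ => id, fun _ => id, fun _ => id⟩
  | endorse i ℓ c hi h =>
    refine .setVc ⟨fun c' h' => ?_, fun _ => id, fun _ => rfl, fun _ => id, fun _ => id,
      fun _ => id⟩
    rcases h with h | h
    · rw [h] at h'; cases h'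
    · rw [h] at h'; exact h'
  | collect i ℓ k σ c =>
    exact .setVc ⟨fun _ => id, fun _ => id, fun _ => rfl, fun _ => id, fun _ => id, fun _ => id⟩
  | adopt i ℓ p c u hi hc =>
    refine .setVc ⟨fun _ => id, fun _ h => (by rw [hc] at h; cases h), fun _ => rfl,
      fun k h => ?_, fun _ => id, fun _ => id⟩
    by_cases hk : k = i
    · subst hk; simp [Env.adopt]
    · simpa [Env.adopt, hk] using h
  | share i ℓ k x c =>
    refine .setVc ⟨fun _ => id, fun _ => id, fun _ => rfl, fun j h => ?_, fun _ => id,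
      fun _ => id⟩
    by_cases hk : j = k
    · subst hk; simp
    · simpa [hk] using h
  | receipt i ℓ x =>
    exact .setVc ⟨fun _ => id, fun _ => id, fun _ => rfl, fun _ => id, fun _ => id, fun _ => id⟩
  | close i hi hcl =>
    refine ⟨fun j ℓ => ?_, fun j h => ?_, fun _ _ => id, fun _ _ => id, fun _ => id, fun _ => id,
      fun _ _ => id⟩
    · by_cases hj : j = i
      · subst hj
        simp only [Function.update_self]
        exact ⟨fun _ => id, fun _ => id, fun h => (by rw [hcl] at h; cases h), fun _ => id,
          fun _ => id, fun _ => id⟩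
      · simp only [Function.update_of_ne hj]; exact .refl _ _
    · by_cases hj : j = i
      · subst hj; simp
      · simpa [hj] using h
  | announce i ℓ k known hi hcl hpr hold =>
    exact .setVc ⟨fun _ => id, hold, fun _ => rfl, fun _ => id,
      fun _ h => (by rw [hpr] at h; cases h), fun _ => id⟩
  | decide ℓ b hd =>
    refine ⟨fun _ _ => .refl _ _, fun _ => id, fun ℓ' b' h => ?_, fun _ _ => id, fun _ => id,
      fun _ => id, fun _ _ => id⟩
    by_cases e : ℓ' = ℓ
    · subst e; rw [hd] at h; cases h
    · simpa [e] using h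
  | learn i ℓ o hi ho =>
    exact .setVc ⟨fun _ => id, fun _ => id, fun _ => rfl, fun _ => id, fun _ => id,
      fun _ h => (by rw [ho] at h; cases h)⟩
  | recover i ℓ c u hi hd hc ho =>
    exact .setVc ⟨fun _ => id, fun _ h => (by rw [hc] at h; cases h), fun _ => rfl, fun _ => id,
      fun _ => id, fun _ h => (by rw [ho] at h; cases h)⟩
  | finish => exact .of_eq rfl rfl rfl rfl fun _ _ => id
  | submit b k V x =>
    refine .setBb fun V' h => ?_
    simp [h]
  | openKey => exact .setBb fun _ => id
  | read => exact .of_eq rfl rfl rfl rfl fun _ _ => id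
  | post => exact .setBb fun _ => id
  | combine => exact .setBb fun _ => id

theorem Env.step_le (E : Env P S D) (cmd : Cmd P) (σ : Fin P.Nv → S) (s : State P S)
    (v : Fin P.n) : s.Le (E.step cmd σ s) := by
  -- With `False` for `G` all assertions that rest on the invariant become void, so monotonicity
  -- holds in every state.
  have h := E.step_moves v False cmd σ s False.elim
  generalize E.step cmd σ s = s' at h
  induction h with
  | refl => exact .refl s
  | tail _ h ih => exact ih.trans h.le

theorem Env.Backed.mono {E : Env P S D} {s s' : State P S} (h : s.Le s') {ℓ : Fin P.n} {c : Code}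
    (hb : E.Backed s ℓ c) : E.Backed s' ℓ c := by
  refine le_trans hb (Finset.card_le_card fun k hk => ?_)
  simp only [Finset.mem_filter, Finset.mem_univ, true_and] at hk ⊢
  exact hk.imp_right ((h.vc k ℓ).endorsed c)

theorem State.Le.certCode {s s' : State P S} (h : s.Le s') {i : Fin P.Nv} {ℓ : Fin P.n}
    {c : Code} (hc : (s.vc i ℓ).cert.map Prod.fst = some c) :
    (s'.vc i ℓ).cert.map Prod.fst = some c := by
  obtain ⟨x, hx, rfl⟩ := Option.map_eq_some_iff.1 hc
  rw [(h.vc i ℓ).cert x hx]; rfl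

theorem Env.holders_mono {E : Env P S D} {s s' : State P S} (h : s.Le s') (ℓ : Fin P.n)
    (x : Line P) : E.holders s ℓ x ⊆ E.holders s' ℓ x := by
  intro k hk
  rw [Env.mem_holders] at hk ⊢
  refine hk.imp_right ?_
  rintro ⟨h1, c, h2, h3⟩
  exact ⟨(h.vc k ℓ).shares k h1, c, h.certCode h2, h3⟩

theorem State.Le.outcome_isSome {s s' : State P S} (h : s.Le s') {k : Fin P.Nv} {ℓ : Fin P.n}
    (ho : (s.vc k ℓ).outcome.isSome = true) : (s'.vc k ℓ).outcome.isSome = true := by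
  obtain ⟨o, ho⟩ := Option.isSome_iff_exists.1 ho
  rw [(h.vc k ℓ).outcome o ho]; rfl

/-- Outcomes are final, so the list of a node with a result for every ballot is frozen and cannot
differ from a copy submitted earlier. -/
theorem State.Le.voteSet_eq {s s' : State P S} (h : s.Le s') {k : Fin P.Nv}
    (ho : ∀ ℓ, (s.vc k ℓ).outcome.isSome = true) : s'.voteSet k = s.voteSet k := by
  funext ℓ
  obtain ⟨o, ho⟩ := Option.isSome_iff_exists.1 (ho ℓ)
  simp only [State.voteSet]
  rw [ho, (h.vc k ℓ).outcome o ho]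

/-- What the record of one node asserts about others refers to data that only grow, or to
announcements of nodes whose clocks have closed. Changes elsewhere therefore do no harm. -/
theorem Env.RecordInv.mono {E : Env P S D} {s s' : State P S} (h : s.Le s') {i : Fin P.Nv}
    {ℓ : Fin P.n} {cl : Bool} {r : VcBallot P S} (hr : E.RecordInv s i ℓ cl r) :
    E.RecordInv s' i ℓ cl r where
  collected j σ hj := by
    obtain ⟨c, h1, h2, h3⟩ := hr.collected j σ hj
    exact ⟨c, h1, h2, h3.imp_right ((h.vc j ℓ).endorsed c)⟩
  cert c u hc := by
    obtain ⟨h1, h2, h3⟩ := hr.cert c u hc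
    exact ⟨h1, h2, h3.mono h⟩
  announced := hr.announced
  announced_own := hr.announced_own
  own := hr.own
  shares k hk hki hs := by
    obtain ⟨c, h1, h2, h3⟩ := hr.shares k hk hki hs
    exact ⟨c, h1, h.certCode h2, (h.vc k ℓ).shares k h3⟩
  receipt := hr.receipt
  heard k hk hb := by
    obtain ⟨h1, h2⟩ := hr.heard k hk hb
    exact ⟨h.closed k h1, by rwa [(h.vc k ℓ).announced h1]⟩
  proposal b hb := by
    obtain ⟨h1, h2, h3⟩ := hr.proposal b hb
    refine ⟨h1, h2, fun hb k hk hkb => ?_⟩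
    -- Honest nodes that have been heard are closed, so their announcements no longer change.
    rw [(h.vc k ℓ).announced (hr.heard k hk hkb).1]
    exact h3 hb k hk hkb
  outcome o ho := by
    rcases hr.outcome o ho with ⟨h1, h2⟩ | ⟨c, h1, h2, h3⟩
    · exact .inl ⟨h1, h.decision _ _ h2⟩
    · exact .inr ⟨c, h1, h.decision _ _ h2, h3⟩

/-- A monotone change that only concerns VC records keeps the invariant if it keeps it for the
records and decisions. -/
theorem Env.Inv.of_vc {E : Env P S D} {v : Fin P.n} {s s' : State P S} (hI : E.Inv v s)
    (h : s.Le s') (hb : s'.bb = s.bb) (ht : s'.trustee = s.trustee) (hv : s'.voter = s.voter)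
    (hk : s'.sentKey = s.sentKey)
    (hr : ∀ i ∉ E.badV, ∀ ℓ, E.RecordInv s' i ℓ (s'.closed i) (s'.vc i ℓ))
    (hd : ∀ ℓ b, s'.decision ℓ = some b → ∃ i ∉ E.badV, (s'.vc i ℓ).proposal = some b) :
    E.Inv v s' where
  record := hr
  decision := hd
  sentKey k hk' x hx := by
    rw [hk] at hx
    obtain ⟨h1, h2⟩ := hI.sentKey k hk' x hx
    exact ⟨h1, fun ℓ => h.outcome_isSome (h2 ℓ)⟩
  sets b k hk' V hV := by
    rw [hb] at hV ⊢
    obtain ⟨h1, h2, h3⟩ := hI.sets b k hk' V hV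
    exact ⟨h1, fun ℓ => h.outcome_isSome (h2 ℓ), by rw [h.voteSet_eq h2]; exact h3⟩
  published := by rw [hb]; exact hI.published
  unpublished := by rw [hb]; exact hI.unpublished
  msk := by rw [hb]; exact hI.msk
  trustee := by rw [hb, ht]; exact hI.trustee
  posts := by rw [hb, ht]; exact hI.posts
  result := by rw [hb]; exact hI.result
  cast := by rw [hv]; exact hI.cast
  accepted ha := by
    rw [hv] at ha ⊢
    obtain ⟨o, h1, h2⟩ := hI.accepted ha
    exact ⟨o, h1, h2.trans (Finset.card_le_card (E.holders_mono h _ _))⟩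

/-- It is enough to check the new record against the old state: monotonicity transfers it, and all
other records, to the new state. -/
theorem Env.Inv.setVc {E : Env P S D} {v : Fin P.n} {s : State P S} (hI : E.Inv v s)
    {i : Fin P.Nv} {ℓ : Fin P.n} {r : VcBallot P S} (hle : s.Le (s.setVc i ℓ r))
    (h : E.RecordInv s i ℓ (s.closed i) r) : E.Inv v (s.setVc i ℓ r) := by
  refine hI.of_vc hle rfl rfl rfl rfl (fun j hj ℓ' => ?_) fun ℓ' b hb => ?_
  · rw [State.setVc_vc]
    split
    case isTrue e => obtain ⟨rfl, rfl⟩ := e; exact h.mono hle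
    case isFalse => exact (hI.record j hj ℓ').mono hle
  · obtain ⟨j, hj, hp⟩ := hI.decision ℓ' b hb
    exact ⟨j, hj, (hle.vc j ℓ').proposal b hp⟩

/-- A change of a voter keeps the invariant if it keeps it for this voter. -/
theorem Env.Inv.setVoter {E : Env P S D} {v : Fin P.n} {s : State P S} (hI : E.Inv v s)
    {ℓ : Fin P.n} {w : Voter P} (hle : s.Le (s.setVoter ℓ w))
    (h₁ : ℓ = v → ∀ o, w.choice = some o →
      w.cast = some ((E.setup.code v).1 (E.setup.part v, o)))
    (h₂ : ℓ = v → w.accepted = true → ∃ o, w.choice = some o ∧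
      P.thr ≤ (E.holders s v (E.setup.part v, o)).card) : E.Inv v (s.setVoter ℓ w) where
  record i hi ℓ' := (hI.record i hi ℓ').mono hle
  decision := hI.decision
  sentKey := hI.sentKey
  sets := hI.sets
  published := hI.published
  unpublished := hI.unpublished
  msk := hI.msk
  trustee := hI.trustee
  posts := hI.posts
  result := hI.result
  cast := by
    rw [State.setVoter_voter]
    split
    case isTrue e => exact h₁ e.symm
    case isFalse => exact hI.cast
  accepted := by
    rw [State.setVoter_voter]
    split
    case isTrue e => exact h₂ e.symm
    case isFalse => exact hI.accepted

end Preservation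

/-! ### Preservation of the invariants -/

section MovePreservation

variable {P : Params} {S D : Type}

theorem exists_notMem_of_card_lt {α : Type*} {A B : Finset α} (h : B.card < A.card) :
    ∃ a ∈ A, a ∉ B := by
  by_contra! hn
  exact absurd (Finset.card_le_card hn) (not_le.2 h)

/-- Monotonicity takes care of what a move does not touch, so each case only concerns the changed
fields. The fault thresholds enter where a board publishes a list (`fv + 1` senders) and where a
trustee reads (`fb + 1` boards); injectivity of the hash enters where a master key is accepted. -/
theorem Env.Inv.move {E : Env P S D} (hH : E.HashInjective) (hbV : E.badV.card ≤ P.fv)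
    (hbB : E.badB.card ≤ P.fb) {v : Fin P.n} {s s' : State P S}
    (hm : E.Move v True s s') (hI : E.Inv v s) : E.Inv v s' := by
  have hle := hm.le
  cases hm with
  | corrupt ℓ x =>
    refine hI.setVoter hle ?_ ?_
    · rintro rfl; exact hI.cast
    · rintro rfl; exact hI.accepted
  | start ℓ o i h =>
    refine hI.setVoter hle ?_ ?_
    · rintro rfl o' ho'
      simp only [Option.some.injEq] at ho' ⊢
      rw [ho']
    · rintro rfl ha
      obtain ⟨o, ho, -⟩ := hI.accepted ha
      rw [h] at ho; cases ho
  | retry ℓ i =>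
    refine hI.setVoter hle ?_ ?_
    · rintro rfl; exact hI.cast
    · rintro rfl; exact hI.accepted
  | answer ℓ acc h h' =>
    refine hI.setVoter hle ?_ ?_
    · rintro rfl; exact hI.cast
    · rintro rfl ha; exact h' trivial rfl ha
  | vote i ℓ c hi =>
    exact hI.setVc hle { hI.record i hi ℓ with collected := fun j σ h => by cases h }
  | endorse i ℓ c hi h => exact hI.setVc hle { hI.record i hi ℓ with }
  | collect i ℓ k σ c hi ha hσ h =>
    have hr := hI.record i hi ℓ
    refine hI.setVc hle { hr with collected := fun j τ hj => ?_ }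
    by_cases hjk : j = k
    · subst hjk
      simp only [Function.update_self, Option.some.injEq] at hj
      subst hj
      exact ⟨c, ha, hσ, h trivial⟩
    · simp only [Function.update_of_ne hjk] at hj
      exact hr.collected j τ hj
  | adopt i ℓ p c u hi hc hcl hp h =>
    have hr := hI.record i hi ℓ
    -- Without a certificate an honest node has neither disclosed its own share nor stored one of
    -- another honest node. Hence no old share can refer to a vote code different from the adopted
    -- one.
    have hnone : ∀ k, k ∉ E.badV → ((s.vc i ℓ).shares k).isSome = true → False :=
      fun k hk hs => by
        by_cases hki : k = i
        · subst hki
          have := hr.own hs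
          rw [hc] at this; cases this
        · obtain ⟨c', h', -⟩ := hr.shares k hk hki hs
          rw [hc] at h'; cases h'
    refine hI.setVc hle
      { hr with
        cert := ?_, announced := ?_, announced_own := ?_, own := ?_, shares := ?_, receipt := ?_,
        heard := ?_, proposal := ?_, outcome := ?_ }
    · intro c' u' hx
      simp only [Env.adopt, Option.some.injEq, Prod.mk.injEq] at hx
      obtain ⟨rfl, rfl⟩ := hx
      exact ⟨(h trivial).1, by rw [hp]; rfl, (h trivial).2⟩
    · intro x hx
      have := hr.announced x hx
      rw [hc] at this; cases this
    · intro h1; rw [hcl] at h1; cases h1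
    · intro _; rfl
    · intro k hk hki hs
      simp only [Env.adopt, Function.update_of_ne hki] at hs
      exact (hnone k hk hs).elim
    · intro hx
      refine (hr.receipt hx).trans (Finset.card_le_card fun k hk => ?_)
      simp only [Finset.mem_filter, Finset.mem_univ, true_and] at hk ⊢
      exact (hle.vc i ℓ |>.shares k hk |> fun h => by simpa using h)
    · intro k hk hkb
      exact ⟨(hr.heard k hk hkb).1, fun _ => rfl⟩
    · intro b hb
      exact ⟨(hr.proposal b hb).1, fun _ => rfl, (hr.proposal b hb).2.2⟩
    · intro o ho
      rcases hr.outcome o ho with h1 | ⟨c', h1, h2, h3⟩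
      · exact .inl h1
      · rw [hc] at h3; cases h3
  | share i ℓ k x c hi hc hcl hki h =>
    have hr := hI.record i hi ℓ
    refine hI.setVc hle { hr with announced_own := ?_, own := ?_, shares := ?_, receipt := ?_ }
    · intro h1; rw [hcl] at h1; cases h1
    · intro _
      obtain ⟨y, hy, -⟩ := Option.map_eq_some_iff.1 hc
      simp [hy]
    · intro j hj hji hs
      by_cases hjk : j = k
      · subst hjk
        exact ⟨c, hc, h trivial hj⟩
      · simp only [Function.update_of_ne hjk] at hs
        exact hr.shares j hj hji hs
    · intro hx
      refine (hr.receipt hx).trans (Finset.card_le_card fun j hj => ?_)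
      simp only [Finset.mem_filter, Finset.mem_univ, true_and] at hj ⊢
      by_cases hjk : j = k
      · subst hjk; simp
      · simpa [hjk] using hj
  | receipt i ℓ x hi h =>
    exact hI.setVc hle { hI.record i hi ℓ with receipt := fun _ => h }
  | close i hi hcl =>
    refine hI.of_vc hle rfl rfl rfl rfl (fun j hj ℓ => ?_) fun ℓ b hb => ?_
    · have hr := (hI.record j hj ℓ).mono hle
      by_cases hji : j = i
      · subst hji
        simp only [Function.update_self]
        exact
          { hr with
            announced := fun x hx => hx
            -- The crux of the timing argument: a node that has disclosed its share has a
            -- certificate by now, and closing turns this certificate into its announcement. After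
            -- closing no share is disclosed any more.
            announced_own := fun _ h => hr.own h }
      · simp only [Function.update_of_ne hji]
        exact hr
    · obtain ⟨j, hj, hp⟩ := hI.decision ℓ b hb
      exact ⟨j, hj, (hle.vc j ℓ).proposal b hp⟩
  | announce i ℓ k known hi hcl hpr hold hnew h =>
    have hr := hI.record i hi ℓ
    have hsome : (s.vc i ℓ).cert.isSome = true → known.isSome = true := fun hc => by
      obtain ⟨y, hy⟩ := Option.isSome_iff_exists.1 hc
      rw [hold y hy]; rfl
    have hcode : ∀ c, (s.vc i ℓ).cert.map Prod.fst = some c → known.map Prod.fst = some c :=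
      fun c hc => by
        obtain ⟨y, hy, rfl⟩ := Option.map_eq_some_iff.1 hc
        rw [hold y hy]; rfl
    have hheard : ∀ j ∈ insert k (s.vc i ℓ).heard, j ∉ E.badV → s.closed j = true ∧
        ((s.vc j ℓ).announced.isSome = true → known.isSome = true) := fun j hj hjb => by
      rcases Finset.mem_insert.1 hj with rfl | hj
      · exact h trivial hjb
      · exact ⟨(hr.heard j hj hjb).1, fun ha => hsome ((hr.heard j hj hjb).2 ha)⟩
    refine hI.setVc hle
      { hr with
        cert := ?_, announced := ?_, own := ?_, shares := ?_, heard := hheard, proposal := ?_,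
        outcome := ?_ }
    · intro c u hx
      rcases hc : (s.vc i ℓ).cert with _ | y
      · exact ⟨((hnew hc c u hx).2 trivial).1, (hnew hc c u hx).1, ((hnew hc c u hx).2 trivial).2⟩
      · have := hold y hc
        rw [show known = some (c, u) from hx] at this
        rw [← this] at hc
        exact hr.cert c u hc
    · intro x hx; exact hold x (hr.announced x hx)
    · intro ho; exact hsome (hr.own ho)
    · intro j hj hji hs
      obtain ⟨c, h1, h2⟩ := hr.shares j hj hji hs
      exact ⟨c, hcode c h1, h2⟩
    · intro b hb
      dsimp only at hb
      split at hb
      case isFalse => cases hb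
      case isTrue hthr =>
        obtain rfl := Option.some.inj hb
        refine ⟨hthr, id, fun hn j hj hjb => ?_⟩
        by_contra hne
        have := (hheard j hj hjb).2 (Option.isSome_iff_ne_none.2 hne)
        rw [hn] at this; cases this
    · intro o ho
      rcases hr.outcome o ho with h1 | ⟨c, h1, h2, h3⟩
      · exact .inl h1
      · exact .inr ⟨c, h1, h2, hcode c h3⟩
  | decide ℓ b hd h =>
    refine hI.of_vc hle rfl rfl rfl rfl (fun j hj ℓ' => (hI.record j hj ℓ').mono hle)
      fun ℓ' b' hb => ?_
    by_cases e : ℓ' = ℓ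
    · subst e
      simp only [Function.update_self, Option.some.injEq] at hb
      subst hb
      exact h
    · simp only [Function.update_of_ne e] at hb
      exact hI.decision ℓ' b' hb
  | learn i ℓ o hi ho h =>
    refine hI.setVc hle { hI.record i hi ℓ with outcome := fun o' ho' => ?_ }
    obtain rfl := Option.some.inj ho'
    exact h
  | recover i ℓ c u hi hd hc ho hp h =>
    have hr := hI.record i hi ℓ
    refine hI.setVc hle
      { hr with
        cert := ?_, announced := ?_, own := ?_, shares := ?_, heard := ?_, proposal := ?_,
        outcome := ?_ }
    · intro c' u' hx
      simp only [Option.some.injEq, Prod.mk.injEq] at hx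
      obtain ⟨rfl, rfl⟩ := hx
      exact ⟨(h trivial).1, hp, (h trivial).2⟩
    · intro x hx
      have := hr.announced x hx
      rw [hc] at this; cases this
    · intro _; rfl
    · intro k hk hki hs
      obtain ⟨c', h', -⟩ := hr.shares k hk hki hs
      rw [hc] at h'; cases h'
    · intro k hk hkb
      exact ⟨(hr.heard k hk hkb).1, fun _ => rfl⟩
    · intro b hb
      exact ⟨(hr.proposal b hb).1, fun _ => rfl, (hr.proposal b hb).2.2⟩
    · intro o ho'
      obtain rfl := Option.some.inj ho'
      exact .inr ⟨c, rfl, hd, rfl⟩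
  | finish i h =>
    refine
      { hI with
        record := fun j hj ℓ' => (hI.record j hj ℓ').mono hle
        sentKey := fun k hk x hx => ?_ }
    by_cases e : k = i
    · subst e
      simp only [Function.update_self, Option.some.injEq] at hx
      exact ⟨hx.symm, h⟩
    · simp only [Function.update_of_ne e] at hx
      exact hI.sentKey k hk x hx
  | submit b k V x hs h =>
    have hset : ∀ j W, (s.bb b).sets j = some W →
        Function.update (s.bb b).sets k (some V) j = some W := fun j W hj => by
      by_cases e : j = k
      · subst e; rw [hs] at hj; cases hj
      · simpa [e] using hj
    refine
      { hI with
        record := fun j hj ℓ' => (hI.record j hj ℓ').mono hle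
        sets := ?_, published := ?_, unpublished := ?_, msk := ?_, trustee := ?_, posts := ?_,
        result := ?_ }
    · intro b' j hj W hW
      rw [State.setBb_bb] at hW ⊢
      split at hW
      case isFalse e => rw [if_neg e]; exact hI.sets b' j hj W hW
      case isTrue e =>
        rw [if_pos e]
        subst e
        by_cases e : j = k
        · subst e
          simp only [Function.update_self, Option.some.injEq] at hW ⊢
          obtain ⟨h1, h2⟩ := h hj
          obtain ⟨h3, h4⟩ := hI.sentKey j hj x h1
          exact ⟨h3, h4, hW ▸ h2⟩
        · simp only [Function.update_of_ne e] at hW ⊢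
          exact hI.sets b' j hj W hW
    · intro b' W hW
      rw [State.setBb_bb] at hW ⊢
      split at hW
      case isFalse e => rw [if_neg e]; exact hI.published b' W hW
      case isTrue e =>
        rw [if_pos e]
        subst e
        dsimp only at hW ⊢
        split at hW
        case isTrue hc =>
          obtain rfl := Option.some.inj hW
          -- At most `fv` of the `fv + 1` nodes that submitted this list are corrupted.
          obtain ⟨j, hj, hjb⟩ := exists_notMem_of_card_lt
            (lt_of_le_of_lt hbV (Nat.lt_of_succ_le hc.2))
          exact ⟨j, hjb, (Finset.mem_filter.1 hj).2⟩
        case isFalse =>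
          obtain ⟨j, hj, hj'⟩ := hI.published b' W hW
          exact ⟨j, hj, hset j W hj'⟩
    · intro b' hb' W
      rw [State.setBb_bb] at hb' ⊢
      split at hb'
      case isFalse e => rw [if_neg e]; exact hI.unpublished b' hb' W
      case isTrue e =>
        rw [if_pos e]
        subst e
        dsimp only at hb' ⊢
        split at hb'
        case isTrue hc => cases hb'
        case isFalse hc =>
          rw [not_and] at hc
          by_cases hWV : W = V
          · subst hWV
            exact Nat.lt_succ_iff.1 (not_le.1 (hc hb'))
          · refine le_trans (Finset.card_le_card fun j hj => ?_) (hI.unpublished b' hb' W)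
            simp only [Finset.mem_filter, Finset.mem_univ, true_and] at hj ⊢
            by_cases e : j = k
            · subst e
              simp only [Function.update_self, Option.some.injEq] at hj
              exact absurd hj.symm hWV
            · simpa [e] using hj
    · intro b' key hk
      rw [State.setBb_bb] at hk
      split at hk
      case isFalse e => exact hI.msk b' key hk
      case isTrue e => exact hI.msk b key hk
    · intro t ht T hT
      obtain ⟨b', hb', W, h1, h2⟩ := hI.trustee t ht T hT
      exact ⟨b', hb', W, hle.published b' W h1, h2⟩
    · intro b' t ht T hT
      rw [State.setBb_bb] at hT
      split at hT
      case isFalse e => exact hI.posts b' t ht T hT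
      case isTrue e => exact hI.posts b t ht T hT
    · intro b' R hR
      have : ∃ b₀, b₀ = b' ∧ (s.bb b₀).result = some R := by
        rw [State.setBb_bb] at hR
        split at hR
        case isFalse e => exact ⟨b', rfl, hR⟩
        case isTrue e => exact ⟨b, e.symm, hR⟩
      obtain ⟨_, rfl, hR'⟩ := this
      obtain ⟨W, h1, h2⟩ := hI.result _ R hR'
      exact ⟨W, hle.published _ W h1, h2⟩
  | openKey b key hm h =>
    -- The salted digest determines the key, whatever shares were used to reconstruct it.
    have hkey : key = E.setup.msk := append_left_cancel (hH.key h)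
    have hbb : ∀ b', (((s.setBb b { s.bb b with msk := some key }).bb b').sets = (s.bb b').sets ∧
        ((s.setBb b { s.bb b with msk := some key }).bb b').keyShares = (s.bb b').keyShares ∧
        ((s.setBb b { s.bb b with msk := some key }).bb b').published = (s.bb b').published ∧
        ((s.setBb b { s.bb b with msk := some key }).bb b').posts = (s.bb b').posts ∧
        ((s.setBb b { s.bb b with msk := some key }).bb b').result = (s.bb b').result) := by
      intro b'
      rw [State.setBb_bb]
      split
      case isTrue e => subst e; exact ⟨rfl, rfl, rfl, rfl, rfl⟩
      case isFalse => exact ⟨rfl, rfl, rfl, rfl, rfl⟩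
    refine
      { hI with
        record := fun j hj ℓ' => (hI.record j hj ℓ').mono hle
        sets := ?_, published := ?_, unpublished := ?_, msk := ?_, trustee := ?_, posts := ?_,
        result := ?_ }
    · intro b'
      rw [(hbb b').1, (hbb b').2.1]; exact hI.sets b'
    · intro b'
      rw [(hbb b').1, (hbb b').2.2.1]; exact hI.published b'
    · intro b'
      rw [(hbb b').1, (hbb b').2.2.1]; exact hI.unpublished b'
    · intro b' key' hk
      rw [State.setBb_bb] at hk
      split at hk
      case isFalse e => exact hI.msk b' key' hk
      case isTrue e =>
        obtain rfl := Option.some.inj hk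
        exact hkey
    · intro t ht T hT
      obtain ⟨b', hb', W, h1, h2⟩ := hI.trustee t ht T hT
      exact ⟨b', hb', W, hle.published b' W h1, h2⟩
    · intro b'
      rw [(hbb b').2.2.2.1]; exact hI.posts b'
    · intro b'
      rw [(hbb b').2.2.2.2, (hbb b').2.2.1]; exact hI.result b'
  | read t R V key ht hR h =>
    have hmono : ∀ t' T, s.trustee t' = some T →
        Function.update s.trustee t (some (E.setup.tallyShare V key t)) t' = some T :=
      fun t' T hT => by
        by_cases e : t' = t
        · subst e; rw [ht] at hT; cases hT
        · simpa [e] using hT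
    refine
      { hI with
        record := fun j hj ℓ' => (hI.record j hj ℓ').mono hle
        trustee := fun t' ht' T hT => ?_
        posts := fun b t' ht' T hT => hmono t' T (hI.posts b t' ht' T hT) }
    by_cases e : t' = t
    · subst e
      simp only [Function.update_self, Option.some.injEq] at hT
      -- At most `fb` of the `fb + 1` boards that agree are corrupted.
      obtain ⟨b, hb, hbb⟩ := exists_notMem_of_card_lt (lt_of_le_of_lt hbB (Nat.lt_of_succ_le hR))
      have h' := (h b hb).resolve_left hbb
      refine ⟨b, hbb, V, h'.1, ?_⟩
      rw [← hT, hI.msk b key h'.2]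
    · simp only [Function.update_of_ne e] at hT
      exact hI.trustee t' ht' T hT
  | post t b T h =>
    have hbb : ∀ x, ∀ b', (((s.setBb b { s.bb b with posts := x }).bb b').sets = (s.bb b').sets ∧
        ((s.setBb b { s.bb b with posts := x }).bb b').keyShares = (s.bb b').keyShares ∧
        ((s.setBb b { s.bb b with posts := x }).bb b').published = (s.bb b').published ∧
        ((s.setBb b { s.bb b with posts := x }).bb b').msk = (s.bb b').msk ∧
        ((s.setBb b { s.bb b with posts := x }).bb b').result = (s.bb b').result) := by
      intro x b'
      rw [State.setBb_bb]
      split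
      case isTrue e => subst e; exact ⟨rfl, rfl, rfl, rfl, rfl⟩
      case isFalse => exact ⟨rfl, rfl, rfl, rfl, rfl⟩
    refine
      { hI with
        record := fun j hj ℓ' => (hI.record j hj ℓ').mono hle
        sets := ?_, published := ?_, unpublished := ?_, msk := ?_, trustee := ?_, posts := ?_,
        result := ?_ }
    · intro b'
      rw [(hbb _ b').1, (hbb _ b').2.1]; exact hI.sets b'
    · intro b'
      rw [(hbb _ b').1, (hbb _ b').2.2.1]; exact hI.published b'
    · intro b'
      rw [(hbb _ b').1, (hbb _ b').2.2.1]; exact hI.unpublished b'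
    · intro b'
      rw [(hbb _ b').2.2.2.1]; exact hI.msk b'
    · intro t ht T hT
      obtain ⟨b', hb', W, h1, h2⟩ := hI.trustee t ht T hT
      exact ⟨b', hb', W, hle.published b' W h1, h2⟩
    · intro b' t' ht' T' hT'
      rw [State.setBb_bb] at hT'
      split at hT'
      case isFalse e => exact hI.posts b' t' ht' T' hT'
      case isTrue e =>
        by_cases e' : t' = t
        · subst e'
          simp only [Function.update_self, Option.some.injEq] at hT'
          exact hT' ▸ h ht'
        · simp only [Function.update_of_ne e'] at hT'
          exact hI.posts b t' ht' T' hT'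
    · intro b'
      rw [(hbb _ b').2.2.2.2, (hbb _ b').2.2.1]; exact hI.result b'
  | combine b V key res rand hV hk h =>
    have hbb : ∀ b', (((s.setBb b { s.bb b with result := some res }).bb b').sets
          = (s.bb b').sets ∧
        ((s.setBb b { s.bb b with result := some res }).bb b').keyShares = (s.bb b').keyShares ∧
        ((s.setBb b { s.bb b with result := some res }).bb b').published = (s.bb b').published ∧
        ((s.setBb b { s.bb b with result := some res }).bb b').msk = (s.bb b').msk ∧
        ((s.setBb b { s.bb b with result := some res }).bb b').posts = (s.bb b').posts) := by
      intro b'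
      rw [State.setBb_bb]
      split
      case isTrue e => subst e; exact ⟨rfl, rfl, rfl, rfl, rfl⟩
      case isFalse => exact ⟨rfl, rfl, rfl, rfl, rfl⟩
    refine
      { hI with
        record := fun j hj ℓ' => (hI.record j hj ℓ').mono hle
        sets := ?_, published := ?_, unpublished := ?_, msk := ?_, trustee := ?_, posts := ?_,
        result := ?_ }
    · intro b'
      rw [(hbb b').1, (hbb b').2.1]; exact hI.sets b'
    · intro b'
      rw [(hbb b').1, (hbb b').2.2.1]; exact hI.published b'
    · intro b'
      rw [(hbb b').1, (hbb b').2.2.1]; exact hI.unpublished b'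
    · intro b'
      rw [(hbb b').2.2.2.1]; exact hI.msk b'
    · intro t ht T hT
      obtain ⟨b', hb', W, h1, h2⟩ := hI.trustee t ht T hT
      exact ⟨b', hb', W, hle.published b' W h1, h2⟩
    · intro b'
      rw [(hbb b').2.2.2.2]; exact hI.posts b'
    · intro b' R hR
      rw [(hbb b').2.2.1]
      rw [State.setBb_bb] at hR
      split at hR
      case isFalse e => exact hI.result b' R hR
      case isTrue e =>
        subst e
        obtain rfl := Option.some.inj hR
        obtain rfl := hI.msk b' key hk
        -- A result opens the product of the commitments, and so does the sum of the entries with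
        -- the summed randomness. Perfect binding makes the two agree, even if corrupted trustees
        -- contributed shares.
        refine ⟨V, hV, fun o => elgamal_injective
          (r := rand o) (r' := ∑ x ∈ E.setup.tallySet V E.setup.msk,
            E.setup.comRand x.1 (E.setup.line x.1 x.2) o) ?_⟩
        rw [h o, elgamal_sum]
        rfl

theorem Env.Inv.initial (E : Env P S D) (v : Fin P.n) : E.Inv v (State.initial P S) where
  record i hi ℓ :=
    { collected := fun j σ h => by cases h
      cert := fun c u h => by cases h
      announced := fun x h => by cases h
      announced_own := fun h => by cases h
      own := fun h => by cases h
      shares := fun k _ _ h => by cases h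
      receipt := fun h => by cases h
      heard := fun k hk => absurd hk (Finset.notMem_empty k)
      proposal := fun b h => by cases h
      outcome := fun o h => by cases h }
  decision ℓ b h := by cases h
  sentKey k _ x h := by cases h
  sets b k _ V h := by cases h
  published b V h := by cases h
  unpublished b _ V := by simp [State.initial]
  msk b key h := by cases h
  trustee t _ T h := by cases h
  posts b t _ T h := by cases h
  result b R h := by cases h
  cast o h := by cases h
  accepted h := by cases h

theorem Env.Inv.step {E : Env P S D} (hH : E.HashInjective) (hbV : E.badV.card ≤ P.fv)
    (hbB : E.badB.card ≤ P.fb) {v : Fin P.n} {s : State P S} {cmd : Cmd P} {σ : Fin P.Nv → S}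
    (hI : E.Inv v s) (hF : ∀ j, ¬ E.Forges cmd σ s j) (hG : ¬ E.Guesses v cmd s) :
    E.Inv v (E.step cmd σ s) := by
  have h := E.step_moves v True cmd σ s fun _ => ⟨hH, hI, hF, hG⟩
  generalize E.step cmd σ s = s' at h
  induction h with
  | refl => exact hI
  | tail _ h ih => exact ih.move hH hbV hbB h

end MovePreservation

/-! ### Quorum intersection and agreement -/

section Outcome

variable {P : Params} {S D : Type}

/-- Two quorums of `Nv - fv` nodes have an honest node in common. -/
theorem exists_honest_mem_inter (hv : 3 * P.fv < P.Nv) {bad A B : Finset (Fin P.Nv)}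
    (hbad : bad.card ≤ P.fv) (hA : P.thr ≤ A.card) (hB : P.thr ≤ B.card) :
    ∃ k ∈ A, k ∈ B ∧ k ∉ bad := by
  classical
  have h1 := Finset.card_union_add_card_inter A B
  have h2 : (A ∪ B).card ≤ P.Nv := by simpa using Finset.card_le_univ (A ∪ B)
  -- The intersection has at least `2 (Nv - fv) - Nv = Nv - 2 fv > fv` elements.
  obtain ⟨k, hk, hkb⟩ := exists_notMem_of_card_lt (A := A ∩ B) (B := bad)
    (by simp only [Params.thr] at hA hB; omega)
  exact ⟨k, (Finset.mem_inter.1 hk).1, (Finset.mem_inter.1 hk).2, hkb⟩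

theorem thr_le_card_compl {bad : Finset (Fin P.Nv)} (hbad : bad.card ≤ P.fv) :
    P.thr ≤ badᶜ.card := by
  rw [Finset.card_compl, Fintype.card_fin]
  exact Nat.sub_le_sub_left hbad _

/-- Both quorums contain a common honest node, and its record has room for only one endorsed vote
code. -/
theorem Env.Backed.unique {E : Env P S D} (hv : 3 * P.fv < P.Nv) (hbV : E.badV.card ≤ P.fv)
    {s : State P S} {ℓ : Fin P.n} {c c' : Code} (h : E.Backed s ℓ c) (h' : E.Backed s ℓ c') :
    c = c' := by
  obtain ⟨k, h1, h2, hk⟩ := exists_honest_mem_inter hv hbV h h'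
  have e1 := (Finset.mem_filter.1 h1).2.resolve_left hk
  have e2 := (Finset.mem_filter.1 h2).2.resolve_left hk
  rw [e1] at e2
  exact Option.some.inj e2

theorem Env.Inv.backed {E : Env P S D} {v : Fin P.n} {s : State P S} (hI : E.Inv v s)
    {i : Fin P.Nv} (hi : i ∉ E.badV) {ℓ : Fin P.n} {c : Code}
    (hc : (s.vc i ℓ).cert.map Prod.fst = some c) : E.Backed s ℓ c := by
  obtain ⟨⟨c', u⟩, hx, rfl⟩ := Option.map_eq_some_iff.1 hc
  exact ((hI.record i hi ℓ).cert c' u hx).2.2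

/-- Honest nodes share the decision on each ballot; if it is positive, their vote codes are backed
and hence equal. -/
theorem Env.Inv.voteSet_eq {E : Env P S D} (hv : 3 * P.fv < P.Nv) (hbV : E.badV.card ≤ P.fv)
    {v : Fin P.n} {s : State P S} (hI : E.Inv v s) {i j : Fin P.Nv} (hi : i ∉ E.badV)
    (hj : j ∉ E.badV) (ho : ∀ ℓ, (s.vc i ℓ).outcome.isSome = true)
    (ho' : ∀ ℓ, (s.vc j ℓ).outcome.isSome = true) : s.voteSet i = s.voteSet j := by
  funext ℓ
  obtain ⟨x, hx⟩ := Option.isSome_iff_exists.1 (ho ℓ)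
  obtain ⟨y, hy⟩ := Option.isSome_iff_exists.1 (ho' ℓ)
  simp only [State.voteSet, hx, hy, Option.join_some]
  rcases (hI.record i hi ℓ).outcome x hx with ⟨rfl, hd⟩ | ⟨c, rfl, hd, hc⟩ <;>
  rcases (hI.record j hj ℓ).outcome y hy with ⟨rfl, hd'⟩ | ⟨c', rfl, hd', hc'⟩
  · rfl
  · rw [hd] at hd'; simp at hd'
  · rw [hd] at hd'; simp at hd'
  · rw [(hI.backed hi hc).unique hv hbV (hI.backed hj hc')]

/-- If the voter has been given her receipt, then every honest node that has a result for her
ballot has her vote code. -/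
theorem Env.Inv.outcome_of_accepted {E : Env P S D} (hH : E.HashInjective)
    (hv : 3 * P.fv < P.Nv) (hbV : E.badV.card ≤ P.fv) {v : Fin P.n} {s : State P S}
    (hI : E.Inv v s) (ha : (s.voter v).accepted = true) {o : Fin P.m}
    (ho : (s.voter v).choice = some o) {i : Fin P.Nv} (hi : i ∉ E.badV)
    (hout : (s.vc i v).outcome.isSome = true) :
    s.voteSet i v = some ((E.setup.code v).1 (E.setup.part v, o)) := by
  obtain ⟨o', ho', hthr⟩ := hI.accepted ha
  rw [ho] at ho'
  obtain rfl := Option.some.inj ho'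
  have opened : ∀ k ∉ E.badV, k ∈ E.holders s v (E.setup.part v, o) →
      ((s.vc k v).shares k).isSome = true ∧
        E.Backed s v ((E.setup.code v).1 (E.setup.part v, o)) := fun k hk hkh => by
    obtain ⟨h1, c, h2, h3⟩ := (Env.mem_holders.1 hkh).resolve_left hk
    obtain rfl := E.eq_code_of_lineOf hH h3
    exact ⟨h1, hI.backed hk h2⟩
  obtain ⟨x, hx⟩ := Option.isSome_iff_exists.1 hout
  simp only [State.voteSet, hx, Option.join_some]
  rcases (hI.record i hi v).outcome x hx with ⟨rfl, hd⟩ | ⟨c, rfl, hd, hc⟩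
  -- Decision "no" was the opinion of an honest node `j` that heard a quorum. An honest node both
  -- heard by `j` and among the holders of the receipt disclosed its share and therefore announced a
  -- certificate, against the opinion of `j`.
  · obtain ⟨j, hj, hp⟩ := hI.decision v false hd
    have hr := hI.record j hj v
    obtain ⟨h1, -, h3⟩ := hr.proposal false hp
    obtain ⟨k, hk, hk', hkb⟩ := exists_honest_mem_inter hv hbV h1 hthr
    have hs := (opened k hkb hk').1
    have := (hI.record k hkb v).announced_own (hr.heard k hk hkb).1 hs
    rw [h3 rfl k hk hkb] at this
    cases this
  -- Decision "yes": the quorum of holders, intersected with itself, contains an honest node whose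
  -- certificate is for the voter's code; certified codes are unique.
  · obtain ⟨k, hk, -, hkb⟩ := exists_honest_mem_inter hv hbV hthr hthr
    rw [(hI.backed hi hc).unique hv hbV (opened k hkb hk).2]

/-! ### The tally -/

/-- Under the true key the stored ciphertexts decrypt to the distinct vote codes of the ballot, so
the rule against several marked positions never applies. -/
theorem Setup.mem_tallySet (e : Setup P) (V : VoteSet P) (x : Fin P.n × Pos P) :
    x ∈ e.tallySet V e.msk ↔ V x.1 = some (e.codeAt x.1 x.2) := by
  have hd : ∀ ℓ p, P.dec e.msk (e.cipher ℓ p) = e.codeAt ℓ p := fun ℓ p => P.dec_enc _ _ _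
  simp only [Setup.tallySet, Finset.mem_filter, Finset.mem_univ, true_and, hd]
  refine ⟨And.left, fun h => ⟨h, fun p hp => ?_⟩⟩
  rw [h] at hp
  have h1 := (e.code x.1).2 (Option.some.inj hp)
  simp only [Setup.line, Prod.mk.injEq] at h1
  obtain ⟨h1, h2⟩ := h1
  rcases p with ⟨a, p⟩
  simp only at h1 h2
  subst h1
  exact Prod.ext rfl ((e.perm x.1 x.2.1).injective h2.symm)

/-- Each listed ballot contributes at most one position, and the entry `o` there is `1` precisely
for a vote code of option `o`; so summing entries counts ballots. -/
theorem Setup.sum_entry (e : Setup P) (V : VoteSet P) (o : Fin P.m) :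
    ∑ x ∈ e.tallySet V e.msk, e.entry x.1 x.2 o = (e.votesFor V o : ZMod P.q) := by
  classical
  simp only [Setup.entry]
  rw [Finset.sum_boole]
  congr 1
  unfold Setup.votesFor
  refine Finset.card_bij (fun x _ => x.1) ?_ ?_ ?_
  · intro x hx
    rw [Finset.mem_filter, Setup.mem_tallySet] at hx
    refine Finset.mem_filter.2 ⟨Finset.mem_univ _, x.2.1, ?_⟩
    rw [hx.1, hx.2]
    rfl
  · rintro ⟨ℓ, p⟩ hx ⟨ℓ', p'⟩ hy h
    obtain rfl : ℓ = ℓ' := h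
    rw [Finset.mem_filter] at hx hy
    have h1 := (Finset.mem_filter.1 hy.1).2.1
    have h2 := (Finset.mem_filter.1 hx.1).2.2 p' h1
    simp only at h2
    rw [h2]
  · intro ℓ hℓ
    obtain ⟨part, hp⟩ := (Finset.mem_filter.1 hℓ).2
    refine ⟨(ℓ, (part, (e.perm ℓ part).symm o)), ?_, rfl⟩
    rw [Finset.mem_filter, Setup.mem_tallySet]
    refine ⟨?_, by simp [Setup.line]⟩
    rw [hp]
    exact congrArg some (e.codeAt_symm ℓ (part, o)).symm

/-- There are at most `n < q` ballots, so the count survives reduction modulo `q`. -/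
theorem Setup.val_sum_entry (e : Setup P) (V : VoteSet P) (o : Fin P.m) :
    (∑ x ∈ e.tallySet V e.msk, e.entry x.1 x.2 o).val = e.votesFor V o := by
  rw [Setup.sum_entry, ZMod.val_natCast_of_lt]
  refine lt_of_le_of_lt ?_ P.n_lt
  exact (Finset.card_le_univ _).trans (by simp)

theorem Setup.validTallyShare (e : Setup P) (V : VoteSet P) (key : MasterKey) (t : Fin P.Nt) :
    e.ValidTallyShare V key t (e.tallyShare V key t) := by
  intro o
  simp only [Setup.tallyShare, Prod.fst_sum, Prod.snd_sum]
  exact ⟨vssVerify_sum _ _ _ _, vssVerify_sum _ _ _ _⟩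

/-- Sharings with the same threshold add up coefficientwise, so sums of shares reconstruct the sum
of the secrets. -/
theorem vssRec_sum {N t : ℕ} (hN : N < P.q) (ht : 0 < t) {Q : Finset (Fin N)} (hQ : Q.card = t)
    {ι : Type*} (A : Finset ι) (secret : ι → ZMod P.q) (r : ι → VssCoins P t)
    {v : Fin N → ZMod P.q} (h : ∀ i ∈ Q, v i = (∑ x ∈ A, vssShare (secret x) (r x) i).1) :
    vssRec Q v = ∑ x ∈ A, secret x := by
  rw [vssRec_eq hN ht hQ (fun j => ∑ x ∈ A, secretCoeff (secret x) (r x) j)]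
  · simp [secretCoeff]
  · intro i hi
    rw [h i hi]
    simp only [Prod.fst_sum, vssShare, Finset.sum_mul]
    rw [Finset.sum_comm]

/-! ### Termination -/

variable {E : Env P S D} {v : Fin P.n} {s : State P S}

section Complete

variable [Nonempty S]

/-- Completeness holds for all signature strings, so arbitrary ones may be inserted. Progress is
derived below by contradiction: were something missing, a fair command that supplies it would change
the state. -/
theorem Env.Complete.step_eq (hC : E.Complete s) {cmd : Cmd P} (h : cmd.Fair) :
    E.step cmd (fun _ => Classical.arbitrary S) s = s := hC cmd h _

theorem Env.Complete.closed (hC : E.Complete s) {i : Fin P.Nv} (hi : i ∉ E.badV) :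
    s.closed i = true := by
  by_contra hn
  rw [Bool.not_eq_true] at hn
  have h := hC.step_eq (cmd := .close i) trivial
  simp only [Env.step, hi, hn, not_false_eq_true, and_self, if_true] at h
  have := congrArg (fun s => s.closed i) h
  simp [hn] at this

/-- If a node had no opinion, the delivery of any honest announcement would have to change nothing,
so all honest nodes have been heard already. They are a quorum, and the next announcement would
trigger an opinion. -/
theorem Env.Complete.proposal (hbV : E.badV.card ≤ P.fv) (hC : E.Complete s)
    {i : Fin P.Nv} (hi : i ∉ E.badV) (ℓ : Fin P.n) : (s.vc i ℓ).proposal.isSome = true := by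
  classical
  by_contra hn
  rw [Bool.not_eq_true, Option.isSome_eq_false_iff, Option.isNone_iff_eq_none] at hn
  have key : ∀ k ∉ E.badV, insert k (s.vc i ℓ).heard = (s.vc i ℓ).heard ∧
      ¬ P.thr ≤ (insert k (s.vc i ℓ).heard).card := fun k hk => by
    have h := hC.step_eq (cmd := .relayAnnounce i ℓ k) trivial
    simp only [Env.step] at h
    rw [if_pos ⟨hi, hk, hC.closed hk⟩] at h
    simp only [Env.onAnnounce] at h
    rw [if_pos ⟨hC.closed hi, hn⟩] at h
    have h' := congrArg (fun s => s.vc i ℓ) h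
    simp only [State.setVc_vc_self] at h'
    refine ⟨congrArg VcBallot.heard h', fun hthr => ?_⟩
    have := congrArg VcBallot.proposal h'
    simp only [hn] at this
    rw [if_pos hthr] at this
    cases this
  have hsub : E.badVᶜ ⊆ (s.vc i ℓ).heard := fun k hk => by
    rw [← (key k (Finset.mem_compl.1 hk)).1]
    exact Finset.mem_insert_self _ _
  refine (key i hi).2 ?_
  rw [(key i hi).1]
  exact (thr_le_card_compl hbV).trans (Finset.card_le_card hsub)

theorem Env.Complete.decision (hbV : E.badV.card ≤ P.fv) (hC : E.Complete s)
    {i : Fin P.Nv} (hi : i ∉ E.badV) (ℓ : Fin P.n) : (s.decision ℓ).isSome = true := by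
  by_contra hn
  rw [Bool.not_eq_true, Option.isSome_eq_false_iff, Option.isNone_iff_eq_none] at hn
  obtain ⟨b, hb⟩ := Option.isSome_iff_exists.1 (hC.proposal hbV hi ℓ)
  have h := hC.step_eq (cmd := .decide ℓ b) trivial
  simp only [Env.step] at h
  rw [if_pos ⟨hn, i, hi, hb⟩] at h
  have := congrArg (fun s => s.decision ℓ) h
  simp [hn] at this

theorem Env.Complete.outcome (hbV : E.badV.card ≤ P.fv) (hI : E.Inv v s)
    (hC : E.Complete s) {i : Fin P.Nv} (hi : i ∉ E.badV) (ℓ : Fin P.n) :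
    (s.vc i ℓ).outcome.isSome = true := by
  by_contra hn
  rw [Bool.not_eq_true, Option.isSome_eq_false_iff, Option.isNone_iff_eq_none] at hn
  have hp := hC.proposal hbV hi ℓ
  obtain ⟨b, hb⟩ := Option.isSome_iff_exists.1 (hC.decision hbV hi ℓ)
  have h := hC.step_eq (cmd := .learn i ℓ) trivial
  simp only [Env.step] at h
  rw [if_pos ⟨hi, hp, hn⟩, hb] at h
  cases b with
  | false =>
    have := congrArg (fun s => (s.vc i ℓ).outcome) h
    simp [hn] at this
  | true =>
  rcases hc : (s.vc i ℓ).cert with _ | ⟨c, u⟩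
  -- A node without the certified vote code can recover it: decision "yes" was the opinion of an
  -- honest node `k`, which then has a valid certificate to send.
  · obtain ⟨k, hk, hpk⟩ := hI.decision ℓ true hb
    have hr := hI.record k hk ℓ
    obtain ⟨⟨c, w⟩, hw⟩ := Option.isSome_iff_exists.1 ((hr.proposal true hpk).2.1 rfl)
    obtain ⟨h1, h2, -⟩ := hr.cert c w hw
    have h := hC.step_eq (cmd := .relayRecover i ℓ k) trivial
    simp only [Env.step, hw] at h
    rw [if_pos ⟨hi, hk⟩] at h
    simp only [Env.onRecover] at h
    rw [if_pos ⟨hp, hb, hc, hn, h1, h2⟩] at h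
    have := congrArg (fun s => (s.vc i ℓ).outcome) h
    simp [hn] at this
  · rw [hc] at h
    have := congrArg (fun s => (s.vc i ℓ).outcome) h
    simp [hn] at this

theorem Env.Complete.sets (hbV : E.badV.card ≤ P.fv) (hI : E.Inv v s) (hC : E.Complete s)
    {k : Fin P.Nv} (hk : k ∉ E.badV) (b : Fin P.Nb) :
    (s.bb b).sets k = some (s.voteSet k) ∧
      (s.bb b).keyShares k = some (E.setup.mskShare k) := by
  have hsent : s.sentKey k = some (E.setup.mskShare k) := by
    have h := hC.step_eq (cmd := .finish k) trivial
    simp only [Env.step] at h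
    rw [if_pos ⟨hk, fun ℓ => hC.outcome hbV hI hk ℓ⟩] at h
    have := congrArg (fun s => s.sentKey k) h
    simpa using this.symm
  rcases hs : (s.bb b).sets k with _ | V
  · have h := hC.step_eq (cmd := .relaySubmit k b) trivial
    simp only [Env.step, hsent] at h
    rw [if_pos hk] at h
    simp only [onSubmit] at h
    rw [if_pos hs] at h
    have := congrArg (fun s => (s.bb b).sets k) h
    simp [State.setBb_bb, hs] at this
  · obtain ⟨h1, h2, h3⟩ := hI.sets b k hk V hs
    exact ⟨by rw [h3], h1⟩

/-- All honest nodes submit the same list, and there are at least `Nv - fv > fv` of them. No other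
list can have been published, since an honest node is behind each published one. -/
theorem Env.Complete.published (hv : 3 * P.fv < P.Nv) (hbV : E.badV.card ≤ P.fv)
    (hI : E.Inv v s) (hC : E.Complete s) {i : Fin P.Nv} (hi : i ∉ E.badV) (b : Fin P.Nb) :
    (s.bb b).published = some (s.voteSet i) := by
  classical
  have hout := fun k (hk : k ∉ E.badV) ℓ => hC.outcome hbV hI hk ℓ
  have heq : ∀ k ∉ E.badV, s.voteSet k = s.voteSet i := fun k hk =>
    hI.voteSet_eq hv hbV hk hi (hout k hk) (hout i hi)
  rcases hp : (s.bb b).published with _ | V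
  · exfalso
    have h := hI.unpublished b hp (s.voteSet i)
    have h' : E.badVᶜ.card ≤ P.fv := by
      refine le_trans (Finset.card_le_card fun k hk => ?_) h
      have hk := Finset.mem_compl.1 hk
      refine Finset.mem_filter.2 ⟨Finset.mem_univ _, ?_⟩
      rw [← heq k hk]
      exact (hC.sets hbV hI hk b).1
    have := thr_le_card_compl hbV
    simp only [Params.thr] at this
    omega
  · obtain ⟨k, hk, hV⟩ := hI.published b V hp
    obtain ⟨-, h2, h3⟩ := hI.sets b k hk V hV
    rw [h3, heq k hk]

/-- The shares of `Nv - fv` honest nodes are genuine, so they pass verification and reconstruct the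
key; the digest then matches, and a 128-bit key fits below `q`. -/
theorem Env.Complete.msk (hv : 3 * P.fv < P.Nv) (hbV : E.badV.card ≤ P.fv)
    (hI : E.Inv v s) (hC : E.Complete s) {b : Fin P.Nb} (hb : b ∉ E.badB) :
    (s.bb b).msk = some E.setup.msk := by
  rcases hm : (s.bb b).msk with _ | key
  · exfalso
    obtain ⟨Q, hQ, hQc⟩ := Finset.exists_subset_card_eq (thr_le_card_compl hbV)
    have hks : ∀ k ∈ Q, (s.bb b).keyShares k = some (E.setup.mskShare k) := fun k hk =>
      (hC.sets hbV hI (Finset.mem_compl.1 (hQ hk)) b).2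
    have ht : 0 < P.thr := by simp only [Params.thr]; omega
    have hrec : vssRec Q (fun k => (((s.bb b).keyShares k).getD 0).1) = bitsToZ P E.setup.msk := by
      rw [vssRec_eq P.Nv_lt ht hQc (fun j => secretCoeff (bitsToZ P E.setup.msk) E.setup.mskVss j)]
      · simp [secretCoeff]
      · intro k hk
        rw [hks k hk]
        rfl
    have h := hC.step_eq (cmd := .openKey b Q) trivial
    simp only [Env.step] at h
    rw [if_pos hb] at h
    simp only [Env.onOpenKey] at h
    rw [if_pos ⟨hm, hQc, fun k hk => ⟨by rw [hks k hk]; rfl, by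
      rw [hks k hk]; exact vssVerify_share _ _ _⟩, by
        rw [hrec, bitsOfZ_bitsToZ P.key_lt.le]; rfl⟩] at h
    have := congrArg (fun s => (s.bb b).msk) h
    simp [State.setBb_bb, hm] at this
  · rw [hI.msk b key hm]

/-- The honest boards number at least `Nb - fb ≥ fb + 1` and agree on list and key, so an honest
trustee can read from them; if it has read already, it read the same data. -/
theorem Env.Complete.posts (hv : 3 * P.fv < P.Nv) (hbV : E.badV.card ≤ P.fv)
    (hb : 2 * P.fb < P.Nb) (hbB : E.badB.card ≤ P.fb)
    (hI : E.Inv v s) (hC : E.Complete s) {i : Fin P.Nv} (hi : i ∉ E.badV)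
    {t : Fin P.Nt} (ht : t ∉ E.badT) (b : Fin P.Nb) :
    (s.bb b).posts t = some (E.setup.tallyShare (s.voteSet i) E.setup.msk t) := by
  classical
  have htr : s.trustee t = some (E.setup.tallyShare (s.voteSet i) E.setup.msk t) := by
    rcases hT : s.trustee t with _ | T
    · exfalso
      have h := hC.step_eq (cmd := .read t E.badBᶜ (s.voteSet i) E.setup.msk) trivial
      simp only [Env.step] at h
      rw [if_pos ⟨ht, hT, by rw [Finset.card_compl, Fintype.card_fin]; omega,
        fun b hb => .inr ⟨hC.published hv hbV hI hi b,
          hC.msk hv hbV hI (Finset.mem_compl.1 hb)⟩⟩] at h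
      have := congrArg (fun s => s.trustee t) h
      simp [hT] at this
    · obtain ⟨b', -, V, h1, h2⟩ := hI.trustee t ht T hT
      rw [hC.published hv hbV hI hi b'] at h1
      rw [h2, Option.some.inj h1]
  rcases hp : (s.bb b).posts t with _ | T
  · exfalso
    have h := hC.step_eq (cmd := .relayPost t b) trivial
    simp only [Env.step, htr, hp] at h
    rw [if_pos ht] at h
    have := congrArg (fun s => (s.bb b).posts t) h
    simp [State.setBb_bb, hp] at this
  · have := hI.posts b t ht T hp
    rw [← this, htr]

/-- There are at least `ht` honest trustees. Their tally shares form a sharing of the summed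
openings, so combining them opens the product of the counted commitments. -/
theorem Env.Complete.result (hv : 3 * P.fv < P.Nv) (hbV : E.badV.card ≤ P.fv)
    (hb : 2 * P.fb < P.Nb) (hbB : E.badB.card ≤ P.fb) (ht : 1 ≤ P.ht) (htN : P.ht ≤ P.Nt)
    (hbT : E.badT.card ≤ P.Nt - P.ht) (hI : E.Inv v s) (hC : E.Complete s)
    {i : Fin P.Nv} (hi : i ∉ E.badV) {b : Fin P.Nb} (hbb : b ∉ E.badB) :
    (s.bb b).result.isSome = true := by
  classical
  by_contra hn
  rw [Bool.not_eq_true, Option.isSome_eq_false_iff, Option.isNone_iff_eq_none] at hn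
  obtain ⟨Q, hQ, hQc⟩ := Finset.exists_subset_card_eq (s := E.badTᶜ) (n := P.ht)
    (by rw [Finset.card_compl, Fintype.card_fin]; omega)
  have hposts : ∀ t ∈ Q, (s.bb b).posts t =
      some (E.setup.tallyShare (s.voteSet i) E.setup.msk t) := fun t ht =>
    hC.posts hv hbV hb hbB hI hi (Finset.mem_compl.1 (hQ ht)) b
  have h := hC.step_eq (cmd := .combine b Q) trivial
  simp only [Env.step] at h
  rw [if_pos hbb] at h
  simp only [Env.onCombine, hC.published hv hbV hI hi b, hC.msk hv hbV hI hbb] at h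
  rw [if_pos] at h
  · have := congrArg (fun s => (s.bb b).result) h
    simp [State.setBb_bb, hn] at this
  refine ⟨hn, hQc, fun t ht => ?_, fun o => ?_⟩
  · rw [hposts t ht]
    exact ⟨rfl, E.setup.validTallyShare _ _ _⟩
  · rw [vssRec_sum P.Nt_lt ht hQc (E.setup.tallySet (s.voteSet i) E.setup.msk)
        (fun x => E.setup.entry x.1 x.2 o)
        (fun x => (E.setup.openVss x.1 (E.setup.line x.1 x.2) o).1),
      vssRec_sum P.Nt_lt ht hQc (E.setup.tallySet (s.voteSet i) E.setup.msk)
        (fun x => E.setup.comRand x.1 (E.setup.line x.1 x.2) o)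
        (fun x => (E.setup.openVss x.1 (E.setup.line x.1 x.2) o).2), elgamal_sum]
    · rfl
    · intro t ht
      rw [hposts t ht]
      simp [Setup.tallyShare, Setup.openShare, Prod.fst_sum, Prod.snd_sum]
    · intro t ht
      rw [hposts t ht]
      simp [Setup.tallyShare, Setup.openShare, Prod.fst_sum]

end Complete

/-- In states that satisfy the invariant, an accepted vote is published and counted. -/
theorem Env.Inv.included [Nonempty S] (hH : E.HashInjective)
    (hv : 3 * P.fv < P.Nv) (hbV : E.badV.card ≤ P.fv)
    (hb : 2 * P.fb < P.Nb) (hbB : E.badB.card ≤ P.fb) (ht : 1 ≤ P.ht) (htN : P.ht ≤ P.Nt)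
    (hbT : E.badT.card ≤ P.Nt - P.ht) (hI : E.Inv v s)
    (ha : (s.voter v).accepted = true) {o : Fin P.m} (ho : (s.voter v).choice = some o) :
    E.Included v o s := by
  intro b hbb
  have hpub : ∀ V, (s.bb b).published = some V →
      V v = some ((E.setup.code v).1 (E.setup.part v, o)) := fun V hV => by
    obtain ⟨k, hk, hs⟩ := hI.published b V hV
    obtain ⟨-, h2, h3⟩ := hI.sets b k hk V hs
    rw [h3]
    exact hI.outcome_of_accepted hH hv hbV ha ho hk (h2 v)
  refine ⟨hpub, fun R hR => ?_, fun hC => ?_⟩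
  · obtain ⟨V, h1, h2⟩ := hI.result b R hR
    exact ⟨V, h1, hpub V h1, fun o' => by rw [h2, Setup.val_sum_entry]⟩
  · obtain ⟨i, -, hi⟩ := exists_notMem_of_card_lt (A := Finset.univ) (B := E.badV)
      (by rw [Finset.card_univ, Fintype.card_fin]; omega)
    exact ⟨by rw [hC.published hv hbV hI hi b]; rfl,
      hC.result hv hbV hb hbB ht htN hbT hI hi hbb⟩

end Outcome

/-! ### Changing a receipt that is not known to the adversary -/

section Masking

variable {P : Params} {S D : Type}

theorem rel_ite {α : Type*} {R : α → α → Prop} {p q : Prop} {_ : Decidable p}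
    {_ : Decidable q} (h : p ↔ q) {a a' b b' : α} (h₁ : p → R a a') (h₂ : ¬ p → R b b') :
    R (if p then a else b) (if q then a' else b') := by
  by_cases hp : p
  · rw [if_pos hp, if_pos (h.1 hp)]; exact h₁ hp
  · rw [if_neg hp, if_neg (mt h.2 hp)]; exact h₂ hp

/-- Replace the receipt on line `x` of the ballot `v` and the coins with which it is shared. -/
def Setup.withReceipt (e : Setup P) (v : Fin P.n) (x : Line P) (ρ : Receipt)
    (r : VssCoins P P.thr) : Setup P :=
  { e with
    receipt := fun ℓ y => if ℓ = v ∧ y = x then ρ else e.receipt ℓ y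
    receiptVss := fun ℓ y => if ℓ = v ∧ y = x then r else e.receiptVss ℓ y }

def Env.withReceipt (E : Env P S D) (v : Fin P.n) (x : Line P) (ρ : Receipt)
    (r : VssCoins P P.thr) : Env P S D :=
  { E with setup := E.setup.withReceipt v x ρ r }

theorem Setup.withReceipt_receiptShare (e : Setup P) (v : Fin P.n) (x : Line P) (ρ : Receipt)
    (r : VssCoins P P.thr) (ℓ : Fin P.n) (p : Pos P) (i : Fin P.Nv) :
    (e.withReceipt v x ρ r).receiptShare ℓ p i =
      if ℓ = v ∧ e.line ℓ p = x then vssShare (bitsToZ P ρ) r i else e.receiptShare ℓ p i := by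
  change vssShare (bitsToZ P (if ℓ = v ∧ e.line ℓ p = x then ρ else e.receipt ℓ (e.line ℓ p)))
    (if ℓ = v ∧ e.line ℓ p = x then r else e.receiptVss ℓ (e.line ℓ p)) i = _
  by_cases h : ℓ = v ∧ e.line ℓ p = x
  · simp only [if_pos h]
  · simp only [if_neg h]
    rfl

theorem Setup.withReceipt_receiptCommit {e : Setup P} {v : Fin P.n} {x : Line P} {ρ : Receipt}
    {r : VssCoins P P.thr}
    (h : vssCommit (bitsToZ P ρ) r = vssCommit (bitsToZ P (e.receipt v x)) (e.receiptVss v x)) :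
    (e.withReceipt v x ρ r).receiptCommit = e.receiptCommit := by
  funext ℓ p
  change vssCommit (bitsToZ P (if ℓ = v ∧ e.line ℓ p = x then ρ else e.receipt ℓ (e.line ℓ p)))
    (if ℓ = v ∧ e.line ℓ p = x then r else e.receiptVss ℓ (e.line ℓ p)) = _
  by_cases h' : ℓ = v ∧ e.line ℓ p = x
  · simp only [if_pos h', h]
    obtain ⟨rfl, rfl⟩ := h'
    rfl
  · simp only [if_neg h']
    rfl

/-- Suppress the information whether the voter has accepted a receipt. -/
def State.calm (v : Fin P.n) (s : State P S) : State P S :=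
  s.setVoter v { s.voter v with accepted := false }

theorem State.calm_eq_self {v : Fin P.n} {s : State P S} (h : (s.voter v).accepted = false) :
    s.calm v = s := by
  have : ({ s.voter v with accepted := false } : Voter P) = s.voter v := by rw [← h]
  rw [State.calm, this]
  simp [State.setVoter]

theorem State.calm_setVoter (v : Fin P.n) (s : State P S) (w : Voter P) :
    (s.setVoter v w).calm v = s.setVoter v { w with accepted := false } := by
  simp [State.calm, State.setVoter]

/-- The voter is corrupted, or enough shares of the receipt that she expects are known. -/
def Env.Exposed (E : Env P S D) (v : Fin P.n) (s : State P S) : Prop :=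
  (s.voter v).revealed.isSome = true ∨
    ∃ o, (s.voter v).choice = some o ∧ P.thr ≤ (E.holders s v (E.setup.part v, o)).card

theorem Env.Exposed.mono {E : Env P S D} {v : Fin P.n} {s s' : State P S} (h : s.Le s')
    (he : E.Exposed v s) : E.Exposed v s' := by
  rcases he with he | ⟨o, h1, h2⟩
  · exact .inl (h.revealed v he)
  · exact .inr ⟨o, h.choice v o h1, h2.trans (Finset.card_le_card (E.holders_mono h _ _))⟩

theorem tryReceipt_cert (r : VcBallot P S) : (tryReceipt r).cert = r.cert := by
  unfold tryReceipt; dsimp only; split <;> rfl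

theorem tryReceipt_shares (r : VcBallot P S) : (tryReceipt r).shares = r.shares := by
  unfold tryReceipt; dsimp only; split <;> rfl

theorem addShare_cert (k : Fin P.Nv) (x : Share P) (r : VcBallot P S) :
    (addShare k x r).cert = r.cert := by
  unfold addShare; split <;> rfl

theorem addShare_shares_isSome (k : Fin P.Nv) (x : Share P) (r : VcBallot P S) (j : Fin P.Nv) :
    ((addShare k x r).shares j).isSome = ((r.shares j).isSome || decide (j = k)) := by
  unfold addShare
  by_cases hj : j = k
  · subst hj
    split
    · simp
    case isFalse h =>
      rw [Option.isNone_iff_eq_none, ← Ne, ← Option.isSome_iff_ne_none] at h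
      simp [h]
  · split <;> simp [hj]

theorem Env.adopt_shares_isSome (E : Env P S D) (i : Fin P.Nv) (ℓ : Fin P.n) (p : Pos P)
    (c : Code) (u : UCert P S) (r : VcBallot P S) (j : Fin P.Nv) :
    ((E.adopt i ℓ p c u r).shares j).isSome = ((r.shares j).isSome || decide (j = i)) := by
  by_cases hj : j = i
  · subst hj; simp [Env.adopt]
  · simp [Env.adopt, hj]

section

variable (E : Env P S D) (v : Fin P.n) (x : Line P) (ρ : Receipt) (r : VssCoins P P.thr)
  (Q : Finset (Fin P.Nv))

/-- The states `s₁`, `s₂` arise from `s` when a node outside `Q` discloses its share of the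
receipt on line `x`, with possibly different shares. -/
def Env.Discloses (s s₁ s₂ : State P S) : Prop :=
  ∃ i ∉ Q, ∃ r₁ r₂ : VcBallot P S, s₁ = s.setVc i v r₁ ∧ s₂ = s.setVc i v r₂ ∧
    r₁.cert = r₂.cert ∧ (∀ k, (r₁.shares k).isSome = (r₂.shares k).isSome) ∧
    (r₁.shares i).isSome = true ∧ ∃ c, r₁.cert.map Prod.fst = some c ∧ E.lineOf v c = some x

variable {E v x ρ r Q}

/-- Adoption discloses the node's own share. It is unchanged if it belongs to another line or if the
node is in `Q`; what is left is a new disclosure for the line `x`. The map `f` covers the optional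
storing of the sender's share. -/
theorem Env.adopt_withReceipt
    (hs : ∀ i ∈ Q, vssShare (bitsToZ P ρ) r i =
      vssShare (bitsToZ P (E.setup.receipt v x)) (E.setup.receiptVss v x) i)
    {s : State P S} {i : Fin P.Nv} {ℓ : Fin P.n} {p : Pos P} {c : Code} (u : UCert P S)
    (hp : E.findPos ℓ c = some p) (r₀ : VcBallot P S) (f : VcBallot P S → VcBallot P S)
    (hf : f = id ∨ ∃ k y, f = addShare k y) :
    s.setVc i ℓ (tryReceipt (f ((E.withReceipt v x ρ r).adopt i ℓ p c u r₀))) =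
      s.setVc i ℓ (tryReceipt (f (E.adopt i ℓ p c u r₀))) ∨
    E.Discloses v x Q s (s.setVc i ℓ (tryReceipt (f (E.adopt i ℓ p c u r₀))))
      (s.setVc i ℓ (tryReceipt (f ((E.withReceipt v x ρ r).adopt i ℓ p c u r₀)))) := by
  by_cases h : (ℓ = v ∧ E.setup.line ℓ p = x) ∧ i ∉ Q
  · obtain ⟨⟨rfl, hx⟩, hi⟩ := h
    have hl : E.lineOf ℓ c = some x := by rw [Env.lineOf, hp, Option.map_some, hx]
    refine .inr ⟨i, hi, _, _, rfl, rfl, ?_⟩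
    simp only [tryReceipt_cert, tryReceipt_shares]
    rcases hf with rfl | ⟨k, y, rfl⟩
    · refine ⟨rfl, fun k => ?_, ?_, c, rfl, hl⟩
      · simp only [id, Env.adopt_shares_isSome]
      · simp only [id, Env.adopt_shares_isSome]; simp
    · simp only [addShare_cert, addShare_shares_isSome, Env.adopt_shares_isSome]
      exact ⟨rfl, fun k => trivial, by simp, c, rfl, hl⟩
  · left
    have : (E.withReceipt v x ρ r).setup.receiptShare ℓ p i = E.setup.receiptShare ℓ p i := by
      refine (Setup.withReceipt_receiptShare _ _ _ _ _ _ _ _).trans ?_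
      split
      case isTrue h' =>
        have hi : i ∈ Q := by by_contra hi; exact h ⟨h', hi⟩
        rw [hs i hi, ← h'.1, ← h'.2]; rfl
      case isFalse => rfl
    simp only [Env.adopt, this]

/-- A change of a hidden receipt does not change the effect of a command, up to what the voter
accepts, unless the voter is corrupted or a further share of that receipt is disclosed. -/
theorem Env.step_withReceipt
    (hs : ∀ i ∈ Q, vssShare (bitsToZ P ρ) r i =
      vssShare (bitsToZ P (E.setup.receipt v x)) (E.setup.receiptVss v x) i)
    (hc : vssCommit (bitsToZ P ρ) r =
      vssCommit (bitsToZ P (E.setup.receipt v x)) (E.setup.receiptVss v x))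
    (cmd : Cmd P) (hcmd : cmd ≠ .corrupt v) (σ : Fin P.Nv → S) (s : State P S) :
    ((E.withReceipt v x ρ r).step cmd σ s).calm v = (E.step cmd σ s).calm v ∨
      E.Discloses v x Q s (E.step cmd σ s) ((E.withReceipt v x ρ r).step cmd σ s) := by
  have hcom : (E.withReceipt v x ρ r).setup.receiptCommit = E.setup.receiptCommit :=
    Setup.withReceipt_receiptCommit hc
  -- For the voter `v` the replaced receipt affects only `accepted`, which `State.calm` erases;
  -- other voters' receipts are untouched.
  have hrec : ∀ ℓ ρ', ((E.withReceipt v x ρ r).onReceipt ℓ ρ' s).calm v =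
      (E.onReceipt ℓ ρ' s).calm v := fun ℓ ρ' => by
    by_cases hℓ : ℓ = v
    · subst hℓ
      simp only [Env.onReceipt, State.calm_setVoter]
    · have : (E.withReceipt v x ρ r).validReceipt ℓ ρ' s ↔ E.validReceipt ℓ ρ' s := by
        simp [Env.validReceipt, Env.withReceipt, Setup.withReceipt, hℓ]
      have h' : (E.withReceipt v x ρ r).onReceipt ℓ ρ' s = E.onReceipt ℓ ρ' s := by
        unfold Env.onReceipt
        exact congrArg (fun a => s.setVoter ℓ ({ s.voter ℓ with current := none, accepted := a }))
          (decide_eq_decide.2 this)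
      rw [h']
  have hvp : ∀ i ℓ k c y u,
      (E.withReceipt v x ρ r).onVoteP i ℓ k c y u s = E.onVoteP i ℓ k c y u s ∨
      E.Discloses v x Q s (E.onVoteP i ℓ k c y u s)
        ((E.withReceipt v x ρ r).onVoteP i ℓ k c y u s) := fun i ℓ k c y u => by
    rcases hp : E.findPos ℓ c with _ | p
    · have hp' : (E.withReceipt v x ρ r).findPos ℓ c = none := hp
      simp only [Env.onVoteP, hp, hp']
      exact .inl trivial
    have hp' : (E.withReceipt v x ρ r).findPos ℓ c = some p := hp
    simp only [Env.onVoteP, hp, hp']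
    refine rel_ite (R := fun b a : State P S => a = b ∨ E.Discloses v x Q s b a)
      (p := s.closed i = false ∧ E.ValidCert ℓ c u ∧ vssVerify (E.setup.receiptCommit ℓ p) k y)
      (q := s.closed i = false ∧ (E.withReceipt v x ρ r).ValidCert ℓ c u ∧
        vssVerify ((E.withReceipt v x ρ r).setup.receiptCommit ℓ p) k y)
      (by rw [hcom]; exact Iff.rfl) (fun _ => ?_) fun _ => .inl rfl
    split
    · exact Env.adopt_withReceipt hs u hp _ (addShare k y) (.inr ⟨k, y, rfl⟩)
    · exact .inl rfl
  cases cmd with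
  | corrupt ℓ =>
    left
    have hℓ : ℓ ≠ v := fun h => hcmd (h ▸ rfl)
    simp [Env.step, Env.withReceipt, Setup.withReceipt, hℓ]
  | reply ℓ ρ' =>
    left
    simp only [Env.step]
    exact rel_ite (R := fun a b : State P S => a.calm v = b.calm v) Iff.rfl (fun _ => hrec ℓ ρ') fun _ => rfl
  | relayReceipt ℓ =>
    left
    simp only [Env.step]
    split
    · rfl
    split
    · rfl
    exact rel_ite (R := fun a b : State P S => a.calm v = b.calm v) Iff.rfl (fun _ => hrec ℓ _) fun _ => rfl
  | endorsement i ℓ k =>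
    have : (E.withReceipt v x ρ r).onEndorsement i ℓ k (σ k) s = E.onEndorsement i ℓ k (σ k) s ∨
        E.Discloses v x Q s (E.onEndorsement i ℓ k (σ k) s)
          ((E.withReceipt v x ρ r).onEndorsement i ℓ k (σ k) s) := by
      simp only [Env.onEndorsement]
      split
      case h_2 => exact .inl rfl
      case h_1 c _ _ =>
      refine rel_ite (R := fun b a : State P S => a = b ∨ E.Discloses v x Q s b a) Iff.rfl (fun _ => ?_)
        fun _ => .inl rfl
      split
      case isFalse => exact .inl rfl
      case isTrue =>
      rcases hp : E.findPos ℓ c with _ | p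
      · have hp' : (E.withReceipt v x ρ r).findPos ℓ c = none := hp
        simp only [hp']
        exact .inl trivial
      have hp' : (E.withReceipt v x ρ r).findPos ℓ c = some p := hp
      simp only [hp']
      exact Env.adopt_withReceipt hs _ hp _ id (.inl rfl)
    simp only [Env.step]
    exact rel_ite (R := fun b a : State P S => a.calm v = b.calm v ∨ E.Discloses v x Q s b a) Iff.rfl
      (fun _ => this.imp_left fun h => by rw [h]) fun _ => .inl rfl
  | voteP i ℓ k c y =>
    simp only [Env.step]
    exact rel_ite (R := fun b a : State P S => a.calm v = b.calm v ∨ E.Discloses v x Q s b a) Iff.rfl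
      (fun _ => (hvp i ℓ k c y _).imp_left fun h => by rw [h]) fun _ => .inl rfl
  | relayVoteP i ℓ k =>
    simp only [Env.step]
    split
    case h_2 => exact .inl rfl
    case h_1 c w y _ _ =>
    exact rel_ite (R := fun b a : State P S => a.calm v = b.calm v ∨ E.Discloses v x Q s b a) Iff.rfl
      (fun _ => (hvp i ℓ k c y _).imp_left fun h => by rw [h]) fun _ => .inl rfl
  -- No other command looks at receipts or at their shares in the setup.
  | _ => exact .inl rfl

theorem Env.holders_congr {s₁ s₂ : State P S} (ℓ : Fin P.n) (y : Line P)
    (h : ∀ k, (s₁.vc k ℓ).cert = (s₂.vc k ℓ).cert ∧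
      ((s₁.vc k ℓ).shares k).isSome = ((s₂.vc k ℓ).shares k).isSome) :
    E.holders s₁ ℓ y = E.holders s₂ ℓ y := by
  ext k
  simp only [Env.mem_holders, Env.Opened, (h k).1, (h k).2]

theorem Env.Exposed.congr {s₁ s₂ : State P S}
    (hv₁ : (s₁.voter v).revealed = (s₂.voter v).revealed)
    (hv₂ : (s₁.voter v).choice = (s₂.voter v).choice)
    (h : ∀ y, E.holders s₁ v y = E.holders s₂ v y) : E.Exposed v s₁ ↔ E.Exposed v s₂ := by
  simp only [Env.Exposed, hv₁, hv₂, h]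

theorem Env.exposed_calm (s : State P S) : E.Exposed v (s.calm v) ↔ E.Exposed v s := by
  refine Env.Exposed.congr ?_ ?_ fun y => rfl <;> simp [State.calm, State.setVoter]

/-- Exposure depends on which shares are present, not on their values, so both states are exposed or
neither is. -/
theorem Env.Discloses.exposed_iff {s s₁ s₂ : State P S} (h : E.Discloses v x Q s s₁ s₂) :
    E.Exposed v s₁ ↔ E.Exposed v s₂ := by
  obtain ⟨i, -, r₁, r₂, rfl, rfl, h1, h2, -⟩ := h
  refine Env.Exposed.congr rfl rfl fun y => Env.holders_congr v y fun k => ?_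
  rw [State.setVc_vc, State.setVc_vc]
  split
  · exact ⟨h1, h2 k⟩
  · exact ⟨rfl, rfl⟩

theorem Env.Discloses.exists_mem_holders {s s₁ s₂ : State P S} (h : E.Discloses v x Q s s₁ s₂) :
    ∃ i ∉ Q, i ∈ E.holders s₁ v x := by
  obtain ⟨i, hi, r₁, r₂, rfl, rfl, -, -, h3, h4⟩ := h
  refine ⟨i, hi, Env.mem_holders.2 (.inr ?_)⟩
  rw [Env.Opened, State.setVc_vc_self]
  exact ⟨h3, h4⟩

end

/-! ### The number of guesses -/

open scoped Classical in
/-- The receipt with which a corrupted node answers the voter. -/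
noncomputable def Env.guess (E : Env P S D) (v : Fin P.n) (s : State P S) :
    Option (Cmd P) → Finset Receipt
  | some (.reply ℓ ρ) =>
    if ℓ = v ∧ (s.voter v).waiting ∧ ∃ i ∈ E.badV, (s.voter v).current = some i then {ρ} else ∅
  | _ => ∅

open scoped Classical in
/-- Every corrupted node is given at most one chance to answer the voter. -/
def Env.FewGuesses (E : Env P S D) (v : Fin P.n) (s : State P S) (g : Finset Receipt) : Prop :=
  g.card + (if ∃ i ∈ E.badV, (s.voter v).current = some i then 1 else 0) ≤
      ((s.voter v).tried ∩ E.badV).card ∧ ((s.voter v).choice = none → g = ∅)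

theorem Env.FewGuesses.of_voter {E : Env P S D} {v : Fin P.n} {s s' : State P S}
    {g : Finset Receipt} (h : E.FewGuesses v s g)
    (hc : (s'.voter v).current = (s.voter v).current ∨ (s'.voter v).current = none)
    (ht : (s'.voter v).tried = (s.voter v).tried)
    (ho : (s'.voter v).choice = (s.voter v).choice) : E.FewGuesses v s' g := by
  unfold Env.FewGuesses at h ⊢
  rw [ht, ho]
  refine ⟨le_trans ?_ h.1, h.2⟩
  rcases hc with hc | hc
  · rw [hc]
  · simp [hc]

/-- A corrupted node becomes `current` only when it enters `tried`, which pays for its pending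
answer. Other moves leave these fields alone or clear `current`. -/
theorem Env.FewGuesses.move {E : Env P S D} {v : Fin P.n} {s s' : State P S}
    {g : Finset Receipt} (hm : E.Move v False s s') (h : E.FewGuesses v s g) :
    E.FewGuesses v s' g := by
  classical
  cases hm with
  | corrupt ℓ y =>
    refine h.of_voter (.inl ?_) ?_ ?_ <;> (rw [State.setVoter_voter]; split)
    all_goals first | rfl | (rename_i e; subst e; rfl)
  | answer ℓ acc =>
    refine h.of_voter ?_ ?_ ?_ <;> (rw [State.setVoter_voter]; split)
    · exact .inr rfl
    · exact .inl rfl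
    all_goals first | rfl | (rename_i e; subst e; rfl)
  | start ℓ o i ho =>
    by_cases e : v = ℓ
    · subst e
      -- Starting resets `tried`, which is harmless because there were no guesses before.
      obtain rfl := h.2 ho
      refine ⟨?_, fun _ => rfl⟩
      rw [State.setVoter_voter, if_pos rfl]
      dsimp only
      split
      case isTrue h' =>
        obtain ⟨j, hj, hij⟩ := h'
        obtain rfl := Option.some.inj hij
        simp [hj]
      case isFalse => simp
    · refine h.of_voter (.inl ?_) ?_ ?_ <;> rw [State.setVoter_voter, if_neg e]
  | retry ℓ i hi hw =>
    by_cases e : v = ℓ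
    · subst e
      refine ⟨?_, fun hn => ?_⟩
      · have h1 := h.1
        rw [State.setVoter_voter, if_pos rfl]
        dsimp only
        split
        case isTrue h' =>
          obtain ⟨j, hj, hij⟩ := h'
          obtain rfl := Option.some.inj hij
          rw [Finset.insert_inter_of_mem hj, Finset.card_insert_of_notMem
            (fun h => hi (Finset.mem_inter.1 h).1)]
          omega
        case isFalse =>
          refine le_trans ?_ (Finset.card_le_card (Finset.inter_subset_inter_right
            (Finset.subset_insert i _)))
          omega
      · rw [State.setVoter_voter, if_pos rfl] at hn
        exact h.2 hn
    · refine h.of_voter (.inl ?_) ?_ ?_ <;> rw [State.setVoter_voter, if_neg e]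
  | _ => exact h

/-- An answer of a corrupted node adds at most one guess and clears `current`, so the pending answer
turns into a guess at no cost. -/
theorem Env.FewGuesses.step {E : Env P S D} {v : Fin P.n} {s : State P S}
    {g : Finset Receipt} (h : E.FewGuesses v s g) (cmd : Cmd P) (σ : Fin P.Nv → S) :
    E.FewGuesses v (E.step cmd σ s) (E.guess v s (some cmd) ∪ g) := by
  classical
  by_cases hg : E.guess v s (some cmd) = ∅
  · rw [hg, Finset.empty_union]
    have hm := E.step_moves v False cmd σ s False.elim
    generalize E.step cmd σ s = s' at hm
    induction hm with
    | refl => exact h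
    | tail _ hm ih => exact ih.move hm
  · cases cmd with
    | reply ℓ ρ =>
      simp only [Env.guess] at hg ⊢
      split at hg
      case isFalse => exact absurd rfl hg
      case isTrue h' =>
      rw [if_pos h']
      obtain ⟨rfl, hw, hb⟩ := h'
      have h1 := h.1
      rw [if_pos hb] at h1
      have hst : E.step (.reply ℓ ρ) σ s = E.onReceipt ℓ ρ s := by
        simp only [Env.step]; rw [if_pos ⟨hw, hb⟩]
      rw [hst]
      refine ⟨?_, fun hn => ?_⟩
      · simp only [Env.onReceipt, State.setVoter_voter, if_true]
        have h2 := Finset.card_union_le {ρ} g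
        rw [Finset.card_singleton] at h2
        simp only [reduceCtorEq, and_false, exists_false, if_false]
        omega
      · simp only [Env.onReceipt, State.setVoter_voter, if_true] at hn
        have := hw.2.1
        rw [hn] at this; cases this
    | _ => exact absurd rfl hg

theorem Env.FewGuesses.calm {E : Env P S D} {v : Fin P.n} {s : State P S}
    {g : Finset Receipt} (h : E.FewGuesses v s g) : E.FewGuesses v (s.calm v) g :=
  h.of_voter (.inl (by simp [State.calm, State.setVoter])) (by simp [State.calm, State.setVoter])
    (by simp [State.calm, State.setVoter])

theorem Env.FewGuesses.card_le {E : Env P S D} {v : Fin P.n} {s : State P S}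
    {g : Finset Receipt} (h : E.FewGuesses v s g) : g.card ≤ E.badV.card :=
  (Nat.le_add_right _ _).trans (h.1.trans (Finset.card_le_card Finset.inter_subset_right))

theorem Env.FewGuesses.initial (E : Env P S D) (v : Fin P.n) :
    E.FewGuesses v (State.initial P S) ∅ := by
  simp [Env.FewGuesses, State.initial]

end Masking

/-! ### The probability of guessing a hidden receipt -/

section Guessing

variable {P : Params} {Sg : SigScheme 224} {H : HashFamily} {A : Adversary P Sg H} {k : ℕ}

/-- The message of the adversary in round `t`. -/
noncomputable def advOutput (A : Adversary P Sg H) (k : ℕ) (ω : Randomness A k) (t : ℕ)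
    (x : Config A k) :
    Wires (A.machine.Mem k ⊕ (CodeWire (Cmd P) ⊕ (Fin P.Nv × Fin (Sg.sigLen k)))) :=
  A.machine.step k t (Sum.elim x.mem (Sum.elim ω.coins (Sum.elim (leak A k ω)
    (Sum.elim (encode (x.state.map fun _ => ())) x.out))))

/-- The command and the signature strings of the adversary in round `t`. -/
noncomputable def advCmd (A : Adversary P Sg H) (k : ℕ) (ω : Randomness A k) (t : ℕ)
    (x : Config A k) : Option (Cmd P) := decode fun j => advOutput A k ω t x (.inr (.inl j))

noncomputable def advSigs (A : Adversary P Sg H) (k : ℕ) (ω : Randomness A k) (t : ℕ)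
    (x : Config A k) : Fin P.Nv → Str (Sg.sigLen k) :=
  fun i j => advOutput A k ω t x (.inr (.inr (i, j)))

/-- Execute a command, if there is one. -/
noncomputable def Env.exec {S D : Type} (E : Env P S D) (cmd : Option (Cmd P))
    (σ : Fin P.Nv → S) (s : State P S) : State P S :=
  match cmd with
  | some c => E.step c σ s
  | none => s

/-- One round of the execution. -/
noncomputable def next (A : Adversary P Sg H) (k : ℕ) (ω : Randomness A k) (t : ℕ)
    (x : Config A k) : Config A k :=
  { mem := fun j => advOutput A k ω t x (.inl j)
    state := (env A k ω).exec (advCmd A k ω t x) (advSigs A k ω t x) x.state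
    out := signature A k ω t x.state (advCmd A k ω t x) }

theorem run_succ (ω : Randomness A k) (t : ℕ) : run A k ω (t + 1) = next A k ω t (run A k ω t) := by
  rw [run]
  rfl

theorem Env.exec_le {S D : Type} (E : Env P S D) (v : Fin P.n) (cmd : Option (Cmd P))
    (σ : Fin P.Nv → S) (s : State P S) : s.Le (E.exec cmd σ s) := by
  unfold Env.exec
  split
  · exact E.step_le _ _ _ v
  · exact .refl _

theorem run_le (v : Fin P.n) (ω : Randomness A k) {t t' : ℕ} (h : t ≤ t') :
    (run A k ω t).state.Le (run A k ω t').state := by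
  induction t', h using Nat.le_induction with
  | base => exact .refl _
  | succ t' _ ih =>
    rw [run_succ]
    exact ih.trans (Env.exec_le _ v _ _ _)

/-- State of the ideal execution: a configuration, the receipts with which corrupted nodes have
answered the voter, and "the execution has been stopped". -/
structure IdealConfig (A : Adversary P Sg H) (k : ℕ) where
  config : Config A k
  guesses : Finset Receipt
  frozen : Prop

open scoped Classical in
/-- The execution in which the voter never accepts a receipt, and which is stopped when she is
corrupted or the expected receipt is about to become known. -/
noncomputable def ideal (A : Adversary P Sg H) (k : ℕ) (v : Fin P.n) (ω : Randomness A k) :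
    ℕ → IdealConfig A k
  | 0 => ⟨⟨fun _ => false, State.initial P _, fun _ => false⟩, ∅, False⟩
  | t + 1 =>
    let x := ideal A k v ω t
    let y := next A k ω t x.config
    if x.frozen ∨ (env A k ω).Exposed v y.state then { x with frozen := True }
    else
      { config := { y with state := y.state.calm v }
        guesses := (env A k ω).guess v x.config.state (advCmd A k ω t x.config) ∪ x.guesses
        frozen := False }

theorem ideal_succ_of_frozen {v : Fin P.n} {ω : Randomness A k} {t : ℕ}
    (h : (ideal A k v ω t).frozen ∨
      (env A k ω).Exposed v (next A k ω t (ideal A k v ω t).config).state) :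
    ideal A k v ω (t + 1) = { ideal A k v ω t with frozen := True } := by
  rw [ideal]; exact if_pos h

theorem ideal_succ_of_not_frozen {v : Fin P.n} {ω : Randomness A k} {t : ℕ}
    (h : ¬ ((ideal A k v ω t).frozen ∨
      (env A k ω).Exposed v (next A k ω t (ideal A k v ω t).config).state)) :
    ideal A k v ω (t + 1) =
      { config := { next A k ω t (ideal A k v ω t).config with
          state := (next A k ω t (ideal A k v ω t).config).state.calm v }
        guesses := (env A k ω).guess v (ideal A k v ω t).config.state
          (advCmd A k ω t (ideal A k v ω t).config) ∪ (ideal A k v ω t).guesses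
        frozen := False } := by
  rw [ideal]; exact if_neg h

/-- The ideal execution keeps its last configuration instead of entering an exposed one. -/
theorem not_exposed_ideal (v : Fin P.n) (ω : Randomness A k) (t : ℕ) :
    ¬ (env A k ω).Exposed v (ideal A k v ω t).config.state := by
  induction t with
  | zero => simp [ideal, Env.Exposed, State.initial]
  | succ t ih =>
    by_cases h : (ideal A k v ω t).frozen ∨
      (env A k ω).Exposed v (next A k ω t (ideal A k v ω t).config).state
    · rw [ideal_succ_of_frozen h]; exact ih
    · rw [ideal_succ_of_not_frozen h]
      exact fun h' => h (.inr (Env.exposed_calm _ |>.1 h'))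

theorem State.calm_choice {S : Type} (v ℓ : Fin P.n) (s : State P S) :
    ((s.calm v).voter ℓ).choice = (s.voter ℓ).choice := by
  rw [State.calm, State.setVoter_voter]
  split
  case isTrue h => rw [h]
  case isFalse => rfl

/-- A stopped execution stands still, and otherwise the only non-monotone change is the erasure of
`accepted`, of which none of these data depend. -/
theorem ideal_mono (v : Fin P.n) (ω : Randomness A k) {t t' : ℕ} (h : t ≤ t') :
    (∀ o, ((ideal A k v ω t).config.state.voter v).choice = some o →
      ((ideal A k v ω t').config.state.voter v).choice = some o) ∧
    (∀ x, (env A k ω).holders (ideal A k v ω t).config.state v x ⊆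
      (env A k ω).holders (ideal A k v ω t').config.state v x) ∧
    (ideal A k v ω t).guesses ⊆ (ideal A k v ω t').guesses := by
  induction t', h using Nat.le_induction with
  | base => exact ⟨fun _ => id, fun _ => subset_rfl, subset_rfl⟩
  | succ t' _ ih =>
    by_cases h : (ideal A k v ω t').frozen ∨
      (env A k ω).Exposed v (next A k ω t' (ideal A k v ω t').config).state
    · rw [ideal_succ_of_frozen h]; exact ih
    · rw [ideal_succ_of_not_frozen h]
      have hle : (ideal A k v ω t').config.state.Le
          (next A k ω t' (ideal A k v ω t').config).state := Env.exec_le _ v _ _ _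
      refine ⟨fun o ho => ?_, fun x => (ih.2.1 x).trans (Env.holders_mono hle v x),
        ih.2.2.trans Finset.subset_union_right⟩
      rw [State.calm_choice]
      exact hle.choice v o (ih.1 o ho)

theorem ideal_fewGuesses (v : Fin P.n) (ω : Randomness A k) (t : ℕ) :
    (env A k ω).FewGuesses v (ideal A k v ω t).config.state (ideal A k v ω t).guesses := by
  induction t with
  | zero => exact Env.FewGuesses.initial _ v
  | succ t ih =>
    by_cases h : (ideal A k v ω t).frozen ∨
      (env A k ω).Exposed v (next A k ω t (ideal A k v ω t).config).state
    · rw [ideal_succ_of_frozen h]; exact ih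
    · rw [ideal_succ_of_not_frozen h]
      refine Env.FewGuesses.calm ?_
      simp only [next, Env.exec]
      cases advCmd A k ω t (ideal A k v ω t).config with
      | none => simpa [Env.guess] using ih
      | some c => exact ih.step c _

/-- The ideal execution is the real one up to the first acceptance or exposure. -/
theorem ideal_eq_run (v : Fin P.n) (ω : Randomness A k) (t : ℕ)
    (he : ¬ (env A k ω).Exposed v (run A k ω t).state)
    (ha : ((run A k ω t).state.voter v).accepted = false) :
    (ideal A k v ω t).config = run A k ω t ∧ ¬ (ideal A k v ω t).frozen := by
  induction t with
  | zero => exact ⟨rfl, id⟩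
  | succ t ih =>
    have hle := run_le v ω t.le_succ
    obtain ⟨h1, h2⟩ := ih (fun h => he (h.mono hle)) (by
      by_contra hn
      rw [Bool.not_eq_false] at hn
      rw [hle.accepted v hn] at ha; cases ha)
    rw [run_succ] at he ha ⊢
    rw [← h1] at he ha ⊢
    rw [ideal_succ_of_not_frozen (not_or.2 ⟨h2, he⟩)]
    refine ⟨?_, id⟩
    rw [State.calm_eq_self ha]

/-- The voter's receipt is among the guesses in the ideal execution. -/
def GuessEvent (A : Adversary P Sg H) (k : ℕ) (v : Fin P.n) (ω : Randomness A k) : Prop :=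
  ∃ o, ((ideal A k v ω (A.machine.rounds k)).config.state.voter v).choice = some o ∧
    ω.setup.receipt v (ω.setup.part v, o) ∈ (ideal A k v ω (A.machine.rounds k)).guesses

/-- At the time of the guess the voter is still waiting and her receipt is not exposed, so the ideal
execution agrees with the real one so far and records the guess, whatever happens later. -/
theorem guessEvent_of_guesses {v : Fin P.n} {ω : Randomness A k} {t : ℕ}
    (ht : t < A.machine.rounds k) {c : Cmd P} (hc : advCmd A k ω t (run A k ω t) = some c)
    (hg : (env A k ω).Guesses v c (run A k ω t).state) : GuessEvent A k v ω := by
  obtain ⟨r, o, rfl, hw, hb, ho, hr, hlt⟩ := hg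
  have he : ¬ (env A k ω).Exposed v (run A k ω t).state := by
    rintro (h | ⟨o', ho', h⟩)
    · rw [hw.1] at h; cases h
    · rw [ho] at ho'
      obtain rfl := Option.some.inj ho'
      exact absurd h (not_le.2 hlt)
  obtain ⟨h1, h2⟩ := ideal_eq_run v ω t he hw.2.2
  have hst : (next A k ω t (ideal A k v ω t).config).state =
      (env A k ω).onReceipt v r (run A k ω t).state := by
    rw [h1]
    simp only [next, hc, Env.exec, Env.step]
    exact if_pos ⟨hw, hb⟩
  -- An answer to the voter exposes nothing, so the execution is not stopped in this very round.
  have he' : ¬ (env A k ω).Exposed v (next A k ω t (ideal A k v ω t).config).state := by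
    rw [hst]
    refine fun h => he ((Env.Exposed.congr
      (s₁ := (env A k ω).onReceipt v r (run A k ω t).state)
      (s₂ := (run A k ω t).state) ?_ ?_ fun y => rfl).1 h) <;>
      simp [Env.onReceipt, State.setVoter]
  have hs := ideal_succ_of_not_frozen (not_or.2 ⟨h2, he'⟩)
  have hm := ideal_mono v ω (Nat.succ_le_of_lt ht)
  refine ⟨o, hm.1 o ?_, hm.2.2 ?_⟩
  · rw [hs]
    dsimp only
    rw [State.calm_choice, hst]
    simpa [Env.onReceipt, State.setVoter] using ho
  · rw [hs]
    refine Finset.mem_union_left _ ?_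
    rw [h1, hc]
    simp only [Env.guess]
    rw [if_pos ⟨rfl, hw, hb⟩, Finset.mem_singleton]
    exact hr.symm

/-! Replacing a hidden receipt -/

/-- Replace the receipt on line `x` of the ballot `v` by `ρ`, so that the shares of the nodes in
`Q` and the commitments stay the same. -/
noncomputable def Randomness.reshare (ω : Randomness A k) (v : Fin P.n) (x : Line P)
    (Q : Finset (Fin P.Nv)) (ρ : Receipt) : Randomness A k :=
  { ω with
    setup := ω.setup.withReceipt v x ρ (_root_.reshare (exists_dlog P).choose Q
      (bitsToZ P (ω.setup.receipt v x)) (bitsToZ P ρ) (ω.setup.receiptVss v x)) }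

theorem Randomness.reshare_receipt (ω : Randomness A k) (v : Fin P.n) (x : Line P)
    (Q : Finset (Fin P.Nv)) (ρ : Receipt) : (ω.reshare v x Q ρ).setup.receipt v x = ρ := by
  simp [Randomness.reshare, Setup.withReceipt]

/-- The old randomness can be recovered from the new one, the line, the set `Q` and the old receipt;
the final count relies on this. -/
theorem Randomness.reshare_reshare (ω : Randomness A k) (v : Fin P.n) (x : Line P)
    (Q : Finset (Fin P.Nv)) (ρ : Receipt) :
    (ω.reshare v x Q ρ).reshare v x Q (ω.setup.receipt v x) = ω := by
  rcases ω with ⟨⟨⟩⟩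
  simp only [Randomness.reshare, Setup.withReceipt, and_self, if_true, _root_.reshare_reshare,
    Randomness.mk.injEq, Setup.mk.injEq, true_and, and_true]
  constructor <;>
  · funext ℓ y
    split
    case isTrue h => rw [h.1, h.2]
    case isFalse => rfl

section

variable {v : Fin P.n} {ω : Randomness A k} {x : Line P} {Q : Finset (Fin P.Nv)}

theorem env_reshare (ρ : Receipt) : env A k (ω.reshare v x Q ρ) =
    (env A k ω).withReceipt v x ρ (_root_.reshare (exists_dlog P).choose Q
      (bitsToZ P (ω.setup.receipt v x)) (bitsToZ P ρ) (ω.setup.receiptVss v x)) := rfl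

/-- Of a receipt the initial knowledge contains only the Pedersen commitments and the shares of
corrupted nodes. -/
theorem leakData_withReceipt {S D : Type} {E : Env P S D} {ρ : Receipt} {r : VssCoins P P.thr}
    (hs : ∀ i ∈ E.badV, vssShare (bitsToZ P ρ) r i =
      vssShare (bitsToZ P (E.setup.receipt v x)) (E.setup.receiptVss v x) i)
    (hc : vssCommit (bitsToZ P ρ) r =
      vssCommit (bitsToZ P (E.setup.receipt v x)) (E.setup.receiptVss v x)) :
    leakData (E.withReceipt v x ρ r) = leakData E := by
  have h₁ : (E.withReceipt v x ρ r).setup.receiptCommit = E.setup.receiptCommit :=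
    Setup.withReceipt_receiptCommit hc
  have h₂ : (E.withReceipt v x ρ r).setup.cipher = E.setup.cipher := rfl
  have h₃ : (E.withReceipt v x ρ r).setup.com = E.setup.com := rfl
  have h₄ : (E.withReceipt v x ρ r).setup.mskCommit = E.setup.mskCommit := rfl
  have h₅ : (E.withReceipt v x ρ r).setup.openCommit = E.setup.openCommit := rfl
  have h₆ : (E.withReceipt v x ρ r).setup.mskShare = E.setup.mskShare := rfl
  have h₇ : (E.withReceipt v x ρ r).setup.openShare = E.setup.openShare := rfl
  have h₈ : (E.withReceipt v x ρ r).setup.salt = E.setup.salt := rfl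
  have h₉ : (E.withReceipt v x ρ r).setup.mskSalt = E.setup.mskSalt := rfl
  have h₁₀ : (E.withReceipt v x ρ r).badV = E.badV := rfl
  have h₁₁ : (E.withReceipt v x ρ r).badT = E.badT := rfl
  have hsh : ∀ i ∈ E.badV, ∀ ℓ p, (E.withReceipt v x ρ r).setup.receiptShare ℓ p i =
      E.setup.receiptShare ℓ p i := fun i hi ℓ p => by
    refine (Setup.withReceipt_receiptShare _ _ _ _ _ _ _ _).trans ?_
    split
    case isTrue h =>
      rw [hs i hi]
      obtain ⟨rfl, rfl⟩ := h
      rfl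
    case isFalse => rfl
  unfold leakData
  dsimp only
  rw [h₁, h₂, h₃, h₄, h₅, h₆, h₇, h₈, h₉, h₁₀, h₁₁]
  refine congrArg (fun f => (_, _, _, _, _, f, _)) (funext fun i => ?_)
  split
  case isTrue hi => simp only [hsh i hi]
  case isFalse => rfl

theorem leak_reshare (hQ : Q.card < P.thr) (hb : A.badV k ⊆ Q) (ρ : Receipt) :
    leak A k (ω.reshare v x Q ρ) = leak A k ω := by
  have hdata : leakData (env A k (ω.reshare v x Q ρ)) = leakData (env A k ω) := by
    rw [env_reshare]
    exact leakData_withReceipt (E := env A k ω)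
      (fun i hi => vssShare_reshare P.Nv_lt _ hQ _ _ _ (hb hi))
      (vssCommit_reshare (exists_dlog P).choose_spec _ _ _ _)
  have h₁ : (env A k (ω.reshare v x Q ρ)).mskDigest = (env A k ω).mskDigest := rfl
  have h₂ : (env A k (ω.reshare v x Q ρ)).digest = (env A k ω).digest := rfl
  funext w
  cases w with
  | data j => simp only [leak, hdata]
  | mskDigest j => simp only [leak, h₁]
  | digest ℓ p j => simp only [leak, h₂]
  | _ => rfl

theorem next_reshare (hQ : Q.card < P.thr) (hb : A.badV k ⊆ Q) (ρ : Receipt) (t : ℕ)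
    (y : Config A k) :
    advOutput A k (ω.reshare v x Q ρ) t y = advOutput A k ω t y := by
  unfold advOutput
  rw [leak_reshare hQ hb]
  rfl

/-- A hidden receipt has no influence on the ideal execution. -/
theorem ideal_reshare {o : Fin P.m} {T : ℕ}
    (ho : ((ideal A k v ω T).config.state.voter v).choice = some o)
    (hx : x = (ω.setup.part v, o))
    (hQ : Q = (env A k ω).holders (ideal A k v ω T).config.state v x) (ρ : Receipt) :
    ∀ t ≤ T, ideal A k v (ω.reshare v x Q ρ) t = ideal A k v ω t := by
  -- Ideal configurations are never exposed, so the mask of `Q` has low enough degree.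
  have hcard : Q.card < P.thr := by
    rw [hQ, hx]
    exact not_le.1 fun h => not_exposed_ideal v ω T (.inr ⟨o, ho, h⟩)
  have hb : A.badV k ⊆ Q := fun i hi => by
    rw [hQ]; exact Env.mem_holders.2 (.inl hi)
  intro t
  induction t with
  | zero => intro _; rfl
  | succ t ih =>
    intro ht
    have ih := ih (Nat.le_of_succ_le ht)
    have hout := next_reshare (v := v) (ω := ω) (x := x) hcard hb ρ t (ideal A k v ω t).config
    have hcmd : advCmd A k (ω.reshare v x Q ρ) t (ideal A k v ω t).config =
        advCmd A k ω t (ideal A k v ω t).config := by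
      unfold advCmd; rw [hout]
    have hsig : advSigs A k (ω.reshare v x Q ρ) t (ideal A k v ω t).config =
        advSigs A k ω t (ideal A k v ω t).config := by
      unfold advSigs; rw [hout]
    by_cases hfr : (ideal A k v ω t).frozen
    · rw [ideal_succ_of_frozen (.inl hfr), ideal_succ_of_frozen (.inl (by rw [ih]; exact hfr)), ih]
    have hexp : ∀ s : State P (Str (Sg.sigLen k)),
        (env A k (ω.reshare v x Q ρ)).Exposed v s ↔ (env A k ω).Exposed v s := fun s => Iff.rfl
    -- both executions are stopped, or they go on in the same way
    suffices hstep : ((next A k (ω.reshare v x Q ρ) t (ideal A k v ω t).config).state.calm v =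
          (next A k ω t (ideal A k v ω t).config).state.calm v) ∨
        ((env A k ω).Exposed v (next A k (ω.reshare v x Q ρ) t (ideal A k v ω t).config).state ∧
          (env A k ω).Exposed v (next A k ω t (ideal A k v ω t).config).state) by
      rcases hstep with hstep | ⟨h1, h2⟩
      · by_cases he : (env A k ω).Exposed v (next A k ω t (ideal A k v ω t).config).state
        · have he' : (env A k ω).Exposed v
              (next A k (ω.reshare v x Q ρ) t (ideal A k v ω t).config).state := by
            rw [← Env.exposed_calm, hstep, Env.exposed_calm]; exact he
          rw [ideal_succ_of_frozen (.inr he), ideal_succ_of_frozen (.inr (by rw [ih, hexp]; exact he')),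
            ih]
        · have he' : ¬ (env A k ω).Exposed v
              (next A k (ω.reshare v x Q ρ) t (ideal A k v ω t).config).state := by
            rw [← Env.exposed_calm, hstep, Env.exposed_calm]; exact he
          rw [ideal_succ_of_not_frozen (not_or.2 ⟨hfr, he⟩),
            ideal_succ_of_not_frozen (by rw [ih, hexp]; exact not_or.2 ⟨hfr, he'⟩), ih, hstep, hcmd]
          simp only [next, hout, hcmd]
          rfl
      · rw [ideal_succ_of_frozen (.inr h2), ideal_succ_of_frozen (.inr (by rw [ih, hexp]; exact h1)),
          ih]
    simp only [next, hcmd, hsig, Env.exec]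
    rcases hc : advCmd A k ω t (ideal A k v ω t).config with _ | c
    · exact .inl rfl
    dsimp only
    by_cases hcor : c = .corrupt v
    · subst hcor
      refine .inr ⟨.inl ?_, .inl ?_⟩ <;> simp [Env.step, State.setVoter]
    rcases Env.step_withReceipt (E := env A k ω) (v := v) (x := x) (ρ := ρ)
        (r := _root_.reshare (exists_dlog P).choose Q
          (bitsToZ P (ω.setup.receipt v x)) (bitsToZ P ρ) (ω.setup.receiptVss v x)) (Q := Q)
        (fun i hi => vssShare_reshare P.Nv_lt _ hcard _ _ _ hi)
        (vssCommit_reshare (exists_dlog P).choose_spec _ _ _ _) c hcor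
        (advSigs A k ω t (ideal A k v ω t).config) (ideal A k v ω t).config.state with h | h
    · exact .inl h
    · right
      refine ⟨h.exposed_iff.1 ?_, ?_⟩ <;>
      -- A node outside `Q` discloses its share of line `x`. If the receipt were not exposed by
      -- this, the ideal execution would go on and this node would be a holder at time `T`, but `Q`
      -- contains all holders at time `T`.
      · by_contra hne
        have hstate : (next A k ω t (ideal A k v ω t).config).state =
            (env A k ω).step c (advSigs A k ω t (ideal A k v ω t).config)
              (ideal A k v ω t).config.state := by
          simp only [next, hc, Env.exec]
        have hs := ideal_succ_of_not_frozen (v := v) (ω := ω) (t := t)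
          (not_or.2 ⟨hfr, by rw [hstate]; exact hne⟩)
        obtain ⟨i, hi, hi'⟩ := h.exists_mem_holders
        refine hi ?_
        rw [hQ]
        refine (ideal_mono v ω ht).2.1 x ?_
        rw [hs]
        rw [← hstate] at hi'
        exact hi'

end

theorem card_receipt : Nat.card Receipt = 2 ^ 64 := by
  simp [Nat.card_eq_fintype_card]

/-- The probability of guessing a hidden receipt. -/
theorem prob_guessEvent_le (v : Fin P.n) (hb : (A.badV k).card ≤ P.fv) :
    prob (GuessEvent A k v) ≤ (P.fv : ℝ) / 2 ^ 64 := by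
  classical
  let F : Randomness A k → IdealConfig A k := fun ω => ideal A k v ω (A.machine.rounds k)
  let o : {ω // GuessEvent A k v ω} → Fin P.m := fun ω => ω.2.choose
  have ho : ∀ ω, ((F ω.1).config.state.voter v).choice = some (o ω) := fun ω =>
    ω.2.choose_spec.1
  have hmem : ∀ ω : {ω // GuessEvent A k v ω}, ω.1.setup.receipt v (ω.1.setup.part v, o ω) ∈ (F ω.1).guesses := fun ω =>
    ω.2.choose_spec.2
  let x : {ω // GuessEvent A k v ω} → Line P := fun ω => (ω.1.setup.part v, o ω)
  let Q : {ω // GuessEvent A k v ω} → Finset (Fin P.Nv) := fun ω =>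
    (env A k ω.1).holders (F ω.1).config.state v (x ω)
  -- A lucky outcome and an arbitrary new receipt are encoded by the reshared randomness and the
  -- position of the old receipt in the list of guesses, which has at most `fv` entries.
  let f : {ω // GuessEvent A k v ω} × Receipt → Randomness A k × Fin P.fv := fun y =>
    (y.1.1.reshare v (x y.1) (Q y.1) y.2,
      ⟨(F y.1.1).guesses.toList.idxOf (y.1.1.setup.receipt v (x y.1)), by
        refine lt_of_lt_of_le (List.idxOf_lt_length_of_mem (Finset.mem_toList.2 (hmem y.1))) ?_
        rw [Finset.length_toList]
        exact (ideal_fewGuesses v y.1.1 _).card_le.trans hb⟩)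
  -- Decoding works because the reshared randomness has the same ideal execution: the choice, the
  -- holders and the list of guesses can be read off from it.
  have hF : ∀ y : {ω // GuessEvent A k v ω} × Receipt, F (f y).1 = F y.1.1 := fun y =>
    ideal_reshare (ho y.1) rfl rfl y.2 _ le_rfl
  have hf : Function.Injective f := by
    intro y z hyz
    have h1 : (f y).1 = (f z).1 := congrArg Prod.fst hyz
    have hFF : F y.1.1 = F z.1.1 := by rw [← hF y, ← hF z, h1]
    have hoo : o y.1 = o z.1 := by
      have a := ho y.1
      rw [hFF, ho z.1] at a
      exact (Option.some.inj a).symm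
    have hpart : y.1.1.setup.part = z.1.1.setup.part :=
      (congrArg (fun ω : Randomness A k => ω.setup.part) h1 : _)
    have hxx : x y.1 = x z.1 := by simp only [x, hpart, hoo]
    have hQQ : Q y.1 = Q z.1 := by
      have a : Q y.1 = (env A k (f y).1).holders (F y.1.1).config.state v (x y.1) := rfl
      have b : Q z.1 = (env A k (f z).1).holders (F z.1.1).config.state v (x z.1) := rfl
      rw [a, b, h1, hFF, hxx]
    -- Both old receipts occur in the common list of guesses, so equal positions mean equal
    -- receipts.
    have hrec : y.1.1.setup.receipt v (x y.1) = z.1.1.setup.receipt v (x z.1) := by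
      have h2 : (F y.1.1).guesses.toList.idxOf (y.1.1.setup.receipt v (x y.1)) =
          (F z.1.1).guesses.toList.idxOf (z.1.1.setup.receipt v (x z.1)) :=
        congrArg Fin.val (congrArg Prod.snd hyz)
      rw [hFF] at h2
      refine (List.idxOf_inj ?_).1 h2
      rw [← hFF]
      exact Finset.mem_toList.2 (hmem y.1)
    have hρ : y.2 = z.2 := by
      have a := Randomness.reshare_receipt y.1.1 v (x y.1) (Q y.1) y.2
      have b := Randomness.reshare_receipt z.1.1 v (x z.1) (Q z.1) z.2
      have h1' : y.1.1.reshare v (x y.1) (Q y.1) y.2 = z.1.1.reshare v (x z.1) (Q z.1) z.2 := h1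
      rw [h1', hxx] at a
      exact a.symm.trans b
    refine Prod.ext (Subtype.ext ?_) hρ
    have a := Randomness.reshare_reshare y.1.1 v (x y.1) (Q y.1) y.2
    have b := Randomness.reshare_reshare z.1.1 v (x z.1) (Q z.1) z.2
    have h1' : y.1.1.reshare v (x y.1) (Q y.1) y.2 = z.1.1.reshare v (x z.1) (Q z.1) z.2 := h1
    rw [h1', hrec, hxx, hQQ] at a
    exact a.symm.trans b
  have h := prob_le_of_injective card_receipt (Nat.two_pow_pos 64) _ f hf
  exact_mod_cast h

end Guessing

/-! ### Executions without signature strings -/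

section Abstraction

variable {P : Params} {S D : Type}

/-- The system in which a signature is replaced by the bit that tells whether it is valid. -/
def Env.bits (E : Env P S D) : Env P Bool D :=
  { setup := E.setup
    hash := E.hash
    verify := fun _ _ b => b
    badV := E.badV
    badB := E.badB
    badT := E.badT }

def Env.bitsCert (E : Env P S D) (ℓ : Fin P.n) (c : Code) (u : UCert P S) : UCert P Bool :=
  fun j => (u j).map (E.verify j (endorseMsg P ℓ c))

/-- The signatures in `collected` refer to the vote code in `asking`. The default value is harmless:
without such a code no endorsement is processed, and a new one empties `collected`. -/
def Env.bitsRecord (E : Env P S D) (ℓ : Fin P.n) (r : VcBallot P S) : VcBallot P Bool :=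
  { endorsed := r.endorsed
    asking := r.asking
    collected := E.bitsCert ℓ (r.asking.getD default) r.collected
    cert := r.cert.map fun x => (x.1, E.bitsCert ℓ x.1 x.2)
    shares := r.shares
    receipt := r.receipt
    announced := r.announced.map fun x => (x.1, E.bitsCert ℓ x.1 x.2)
    heard := r.heard
    proposal := r.proposal
    outcome := r.outcome }

def Env.bitsState (E : Env P S D) (s : State P S) : State P Bool :=
  { voter := s.voter
    vc := fun i ℓ => E.bitsRecord ℓ (s.vc i ℓ)
    closed := s.closed
    decision := s.decision
    sentKey := s.sentKey
    bb := s.bb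
    trustee := s.trustee }

variable (E : Env P S D)

/-- The adversary sees only the presence of signatures, so it gets the same view from the abstract
state. -/
theorem Env.bitsState_map (s : State P S) :
    (E.bitsState s).map (fun _ => ()) = s.map (fun _ => ()) := by
  simp only [bitsState, State.map, VcBallot.map, bitsRecord, bitsCert, Option.map_map,
    Function.comp_def]

theorem Env.bitsState_setVc (s : State P S) (i : Fin P.Nv) (ℓ : Fin P.n) (r : VcBallot P S) :
    E.bitsState (s.setVc i ℓ r) = (E.bitsState s).setVc i ℓ (E.bitsRecord ℓ r) := by
  simp only [bitsState, State.setVc, State.mk.injEq, true_and, and_true]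
  funext j ℓ'
  by_cases h : j = i
  · subst h
    by_cases h' : ℓ' = ℓ
    · subst h'; simp
    · simp [h']
  · simp [h]

theorem Env.bits_validCert {ℓ : Fin P.n} {c : Code} {u : UCert P S} :
    E.bits.ValidCert ℓ c (E.bitsCert ℓ c u) ↔ E.ValidCert ℓ c u := by
  unfold ValidCert
  simp [bits, bitsCert]

theorem Env.bitsRecord_tryReceipt (ℓ : Fin P.n) (r : VcBallot P S) :
    E.bitsRecord ℓ (tryReceipt r) = tryReceipt (E.bitsRecord ℓ r) :=
  (apply_ite (E.bitsRecord ℓ) _ _ _ : _)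

theorem Env.bitsRecord_addShare (ℓ : Fin P.n) (k : Fin P.Nv) (x : Share P) (r : VcBallot P S) :
    E.bitsRecord ℓ (addShare k x r) = addShare k x (E.bitsRecord ℓ r) :=
  (apply_ite (E.bitsRecord ℓ) _ _ _ : _)

theorem Env.bitsRecord_adopt (i : Fin P.Nv) (ℓ : Fin P.n) (p : Pos P) (c : Code) (u : UCert P S)
    (r : VcBallot P S) : E.bitsRecord ℓ (E.adopt i ℓ p c u r) =
      E.bits.adopt i ℓ p c (E.bitsCert ℓ c u) (E.bitsRecord ℓ r) := rfl

theorem Env.bitsState_onEndorsement (i : Fin P.Nv) (ℓ : Fin P.n) (k : Fin P.Nv) (σ : S)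
    (b : Bool) (s : State P S)
    (hb : ∀ c, (s.vc i ℓ).asking = some c → b = E.verify k (endorseMsg P ℓ c) σ) :
    E.bitsState (E.onEndorsement i ℓ k σ s) = E.bits.onEndorsement i ℓ k b (E.bitsState s) := by
  rcases hr : s.vc i ℓ with ⟨en, ask, col, cert, sh, rc, an, he, pr, out⟩
  have hr' : (E.bitsState s).vc i ℓ = E.bitsRecord ℓ ⟨en, ask, col, cert, sh, rc, an, he, pr, out⟩ :=
    by rw [← hr]; rfl
  unfold onEndorsement
  simp only [hr, hr']
  rw [hr] at hb
  rcases ask with _ | c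
  · rfl
  rcases cert with _ | _
  swap
  · rfl
  have hb := hb c rfl
  have hcol : E.bitsCert ℓ c (Function.update col k (some σ)) =
      Function.update (E.bitsCert ℓ c col) k (some b) := by
    funext j
    by_cases h : j = k
    · subst h; simp [bitsCert, hb]
    · simp [bitsCert, h]
  have hcard : ∀ w : UCert P S, (Finset.univ.filter fun j => (E.bitsCert ℓ c w j).isSome = true) =
      Finset.univ.filter fun j => (w j).isSome = true := fun w => by simp [bitsCert]
  simp only [bitsRecord, Option.getD_some, Option.map_none]
  rw [apply_ite E.bitsState]
  refine if_congr ?_ ?_ rfl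
  · rw [hb]; rfl
  simp only [← hcol, hcard]
  split_ifs
  · change E.bitsState (match E.findPos ℓ c with | some p => _ | none => _) =
      match E.findPos ℓ c with | some p => _ | none => _
    rcases E.findPos ℓ c with _ | p
    · rfl
    · simp only [bitsState_setVc, bitsRecord_tryReceipt, bitsRecord_adopt]
      rfl
  · rw [bitsState_setVc]
    rfl

open scoped Classical in
theorem Env.bitsState_onVoteP (i : Fin P.Nv) (ℓ : Fin P.n) (k : Fin P.Nv)
    (c : Code) (x : Share P) (u : UCert P S) (s : State P S) :
    E.bitsState (E.onVoteP i ℓ k c x u s) =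
      E.bits.onVoteP i ℓ k c x (E.bitsCert ℓ c u) (E.bitsState s) := by
  unfold onVoteP
  simp only [bits_validCert]
  change _ = match E.findPos ℓ c with | none => _ | some p => _
  rcases E.findPos ℓ c with _ | p
  · rfl
  dsimp only
  rw [apply_ite E.bitsState]
  refine if_congr Iff.rfl ?_ rfl
  have hcert : ((E.bitsState s).vc i ℓ).cert =
    (s.vc i ℓ).cert.map fun x => (x.1, E.bitsCert ℓ x.1 x.2) := rfl
  rw [hcert]
  rcases (s.vc i ℓ).cert with _ | ⟨c', w⟩
  · simp only [bitsState_setVc, bitsRecord_tryReceipt, bitsRecord_addShare, bitsRecord_adopt]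
    rfl
  · simp only [Option.map_some]
    rw [apply_ite E.bitsState]
    refine if_congr Iff.rfl ?_ rfl
    simp only [bitsState_setVc, bitsRecord_tryReceipt, bitsRecord_addShare]
    rfl

open scoped Classical in
theorem Env.bitsState_onAnnounce (i : Fin P.Nv) (ℓ : Fin P.n) (k : Fin P.Nv)
    (a : Option (Code × UCert P S)) (s : State P S) :
    E.bitsState (E.onAnnounce i ℓ k a s) = E.bits.onAnnounce i ℓ k
      (a.map fun x => (x.1, E.bitsCert ℓ x.1 x.2)) (E.bitsState s) := by
  unfold onAnnounce
  dsimp only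
  rw [apply_ite E.bitsState]
  refine if_congr Iff.rfl ?_ rfl
  rw [bitsState_setVc]
  congr 1
  have hcert : ((E.bitsState s).vc i ℓ).cert =
    (s.vc i ℓ).cert.map fun x => (x.1, E.bitsCert ℓ x.1 x.2) := rfl
  rw [hcert]
  unfold bitsRecord
  rcases hc : (s.vc i ℓ).cert with _ | ⟨c', w⟩
  · rcases a with _ | ⟨c, u⟩
    · rfl
    · simp only [Option.map_none, Option.map_some, bits_validCert]
      by_cases h : E.ValidCert ℓ c u ∧ (E.findPos ℓ c).isSome = true
      · have h' : E.ValidCert ℓ c u ∧ (E.bits.findPos ℓ c).isSome = true := h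
        simp only [if_pos h, if_pos h']
        rfl
      · have h' : ¬ (E.ValidCert ℓ c u ∧ (E.bits.findPos ℓ c).isSome = true) := h
        simp only [if_neg h, if_neg h']
        rfl
  · rfl

open scoped Classical in
theorem Env.bitsState_onRecover (i : Fin P.Nv) (ℓ : Fin P.n) (c : Code) (u : UCert P S)
    (s : State P S) : E.bitsState (E.onRecover i ℓ c u s) =
      E.bits.onRecover i ℓ c (E.bitsCert ℓ c u) (E.bitsState s) := by
  unfold onRecover
  simp only [bits_validCert]
  rw [apply_ite E.bitsState]
  refine if_congr ?_ ?_ rfl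
  · simp only [bitsState, bitsRecord, Option.map_eq_none_iff]
    rfl
  · rw [bitsState_setVc]
    rfl

open scoped Classical in
-- The system inspects signature strings only by verifying them on the serial number and vote code
-- to which they refer. Hence validity bits determine the abstract successor state; certificates
-- relayed by honest nodes carry their bits in the state already.
theorem Env.bitsState_step (cmd : Cmd P) (σ : Fin P.Nv → S) (β : Fin P.Nv → Bool) (s : State P S)
    (hβ : ∀ x, cmd.subject s = some x →
      ∀ j, β j = E.verify j (endorseMsg P x.1 x.2) (σ j)) :
    E.bitsState (E.step cmd σ s) = E.bits.step cmd β (E.bitsState s) := by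
  have hu : ∀ ℓ c, cmd.subject s = some (ℓ, c) →
      (fun j => some (β j)) = E.bitsCert ℓ c fun j => some (σ j) := fun ℓ c h => by
    funext j; rw [hβ _ h]; rfl
  cases cmd with
  | corrupt ℓ => rfl
  | start ℓ o i => exact apply_ite E.bitsState _ _ _
  | retry ℓ i => exact apply_ite E.bitsState _ _ _
  | reply ℓ r => exact apply_ite E.bitsState _ _ _
  | relayReceipt ℓ =>
    unfold step
    change E.bitsState (match (s.voter ℓ).current with | none => _ | some i => _) =
      match (s.voter ℓ).current with | none => _ | some i => _
    rcases (s.voter ℓ).current with _ | i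
    · rfl
    change E.bitsState (match (s.vc i ℓ).receipt with | none => _ | some i => _) =
      match (s.vc i ℓ).receipt with | none => _ | some i => _
    rcases (s.vc i ℓ).receipt with _ | r
    · rfl
    dsimp only
    rw [apply_ite E.bitsState]
    refine if_congr ?_ rfl rfl
    simp only [bitsState, bitsRecord, Option.map_map]
    rfl
  | vote i ℓ c =>
    unfold step
    dsimp only
    rw [apply_ite E.bitsState, bitsState_setVc]
    refine if_congr ?_ rfl rfl
    simp only [bitsState, bitsRecord, Option.map_eq_none_iff]
    rfl
  | endorse i ℓ c =>
    unfold step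
    dsimp only
    rw [apply_ite E.bitsState, bitsState_setVc]
    rfl
  | endorsement i ℓ k =>
    unfold step
    dsimp only
    rw [apply_ite E.bitsState, bitsState_onEndorsement E i ℓ k (σ k) (β k)]
    · rfl
    · exact fun c hc => hβ (ℓ, c) (by simp only [Cmd.subject, hc, Option.map_some]) k
  | voteP i ℓ k c x =>
    unfold step
    dsimp only
    rw [apply_ite E.bitsState, bitsState_onVoteP, hu ℓ c rfl]
    rfl
  | relayVoteP i ℓ k =>
    unfold step
    have hcert : ((E.bitsState s).vc k ℓ).cert =
      (s.vc k ℓ).cert.map fun x => (x.1, E.bitsCert ℓ x.1 x.2) := rfl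
    have hshares : ((E.bitsState s).vc k ℓ).shares k = (s.vc k ℓ).shares k := rfl
    dsimp only
    rw [hcert, hshares]
    rcases (s.vc k ℓ).cert with _ | ⟨c, w⟩
    · rfl
    rcases (s.vc k ℓ).shares k with _ | x
    · rfl
    simp only [Option.map_some]
    rw [apply_ite E.bitsState, bitsState_onVoteP]
    rfl
  | close i =>
    unfold step
    dsimp only
    rw [apply_ite E.bitsState]
    refine if_congr Iff.rfl ?_ rfl
    simp only [bitsState, State.mk.injEq, true_and, and_true]
    funext j ℓ
    by_cases h : j = i
    · subst h; simp [bitsRecord]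
    · simp [h]
  | announce i ℓ k c =>
    unfold step
    dsimp only
    rw [apply_ite E.bitsState, bitsState_onAnnounce]
    refine if_congr Iff.rfl ?_ rfl
    rcases c with _ | c
    · rfl
    · simp only [Option.map_some]
      rw [hu ℓ c rfl]
  | relayAnnounce i ℓ k =>
    unfold step
    dsimp only
    rw [apply_ite E.bitsState, bitsState_onAnnounce]
    rfl
  | decide ℓ b =>
    unfold step
    dsimp only
    rw [apply_ite E.bitsState]
    rfl
  | learn i ℓ =>
    unfold step
    dsimp only
    rw [apply_ite E.bitsState]
    refine if_congr Iff.rfl ?_ rfl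
    have hcert : ((E.bitsState s).vc i ℓ).cert =
      (s.vc i ℓ).cert.map fun x => (x.1, E.bitsCert ℓ x.1 x.2) := rfl
    have hdec : (E.bitsState s).decision ℓ = s.decision ℓ := rfl
    simp only [hcert, hdec]
    rcases s.decision ℓ with _ | _ | _
    · rfl
    · exact bitsState_setVc E s i ℓ _
    · rcases (s.vc i ℓ).cert with _ | ⟨c, w⟩
      · rfl
      · exact bitsState_setVc E s i ℓ _
  | recover i ℓ k c =>
    unfold step
    dsimp only
    rw [apply_ite E.bitsState, bitsState_onRecover, hu ℓ c rfl]
    rfl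
  | relayRecover i ℓ k =>
    unfold step
    have hcert : ((E.bitsState s).vc k ℓ).cert =
      (s.vc k ℓ).cert.map fun x => (x.1, E.bitsCert ℓ x.1 x.2) := rfl
    dsimp only
    rw [hcert]
    rcases (s.vc k ℓ).cert with _ | ⟨c, w⟩
    · rfl
    simp only [Option.map_some]
    rw [apply_ite E.bitsState, bitsState_onRecover]
    rfl
  | finish i => exact apply_ite E.bitsState _ _ _
  | relaySubmit k b =>
    unfold step
    change E.bitsState (match s.sentKey k with | some x => _ | none => s) =
      match s.sentKey k with | some x => _ | none => _
    rcases s.sentKey k with _ | x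
    · rfl
    dsimp only
    rw [apply_ite E.bitsState]
    refine if_congr Iff.rfl ?_ rfl
    exact apply_ite E.bitsState _ _ _
  | submit k b V x =>
    unfold step
    dsimp only
    rw [apply_ite E.bitsState]
    refine if_congr Iff.rfl ?_ rfl
    exact apply_ite E.bitsState _ _ _
  | openKey b Q =>
    unfold step
    dsimp only
    rw [apply_ite E.bitsState]
    refine if_congr Iff.rfl ?_ rfl
    exact apply_ite E.bitsState _ _ _
  | read t R V key => exact apply_ite E.bitsState _ _ _
  | relayPost t b =>
    unfold step
    change E.bitsState (match s.trustee t, (s.bb b).posts t with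
        | some T, none => _
        | _, _ => s) = match s.trustee t, (s.bb b).posts t with
        | some T, none => _
        | _, _ => _
    rcases s.trustee t with _ | T
    · rfl
    rcases (s.bb b).posts t with _ | _
    · exact apply_ite E.bitsState _ _ _
    · rfl
  | post t b T => exact apply_ite E.bitsState _ _ _
  | combine b Q =>
    unfold step
    dsimp only
    rw [apply_ite E.bitsState]
    refine if_congr Iff.rfl ?_ rfl
    unfold onCombine
    have hpub : ((E.bitsState s).bb b).published = (s.bb b).published := rfl
    have hmsk : ((E.bitsState s).bb b).msk = (s.bb b).msk := rfl
    simp only [hpub, hmsk]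
    rcases (s.bb b).published with _ | V
    · rfl
    rcases (s.bb b).msk with _ | key
    · rfl
    · exact apply_ite E.bitsState _ _ _

end Abstraction

/-! ### Families of circuits of polynomial size -/

section Families

/-- The numbers of the elements are below `2 ^ Nat.clog 2 (Nat.card α)`, so the omitted higher bits
vanish. -/
theorem encode_injective {α : Type} [Finite α] : Function.Injective (encode (α := α)) := by
  intro a b h
  refine (Finite.equivFin α).injective (Fin.ext (Nat.eq_of_testBit_eq fun i => ?_))
  rcases lt_or_ge i (Nat.clog 2 (Nat.card α)) with hi | hi
  · exact congrFun h ⟨i, hi⟩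
  · have hlt : ∀ x : Fin (Nat.card α), (x : ℕ) < 2 ^ i := fun x =>
      x.2.trans_le ((Nat.le_pow_clog one_lt_two _).trans (Nat.pow_le_pow_right two_pos hi))
    rw [Nat.testBit_lt_two_pow (hlt _), Nat.testBit_lt_two_pow (hlt _)]

theorem decode_encode {α : Type} [Finite α] (a : α) : decode (encode a) = some a := by
  have h : ∃ b : α, encode b = encode a := ⟨a, rfl⟩
  rw [decode, dif_pos h]
  exact congrArg some (encode_injective h.choose_spec)

variable {ι : Type} {κ : ι → ℕ} {α β γ : ι → Type}

/-- The maps `f i` have circuits of polynomial size in the security parameter `κ i`. -/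
def PolyCircuits (κ : ι → ℕ) {α β : ι → Type} (f : ∀ i, Wires (α i) → Wires (β i)) : Prop :=
  ∃ s : ℕ → ℕ, PolyBounded s ∧ ∀ i, CircuitLE (f i) (s (κ i))

namespace PolyCircuits

theorem of_polySize {α β : ℕ → Type} {f : ∀ k, Wires (α k) → Wires (β k)} (h : PolySize f) :
    PolyCircuits κ fun i => f (κ i) :=
  let ⟨s, hs, h⟩ := h
  ⟨s, hs, fun i => h (κ i)⟩

/-- Every output is constant or an input. -/
theorem rewire (e : ∀ i, β i → Bool ⊕ α i) :
    PolyCircuits κ fun i x b => (Sum.elim id x (e i b) : Bool) :=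
  ⟨fun _ => 0, .const 0, fun i => (((CircuitLE.const (id : Wires Bool)).pair
    (CircuitLE.wire (id : α i → α i))).select (e i)).mono le_rfl⟩

theorem wire (e : ∀ i, β i → α i) : PolyCircuits κ fun i (x : Wires (α i)) b => x (e i b) :=
  rewire fun i b => .inr (e i b)

theorem const (v : ∀ i, Wires (β i)) : PolyCircuits κ fun i (_ : Wires (α i)) => v i :=
  rewire fun i b => .inl (v i b)

theorem comp {f : ∀ i, Wires (α i) → Wires (β i)} {g : ∀ i, Wires (β i) → Wires (γ i)}
    (hg : PolyCircuits κ g) (hf : PolyCircuits κ f) : PolyCircuits κ fun i x => g i (f i x) :=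
  let ⟨s, hs, hf⟩ := hf
  let ⟨t, ht, hg⟩ := hg
  ⟨fun k => s k + t k, hs.add ht, fun i => (hg i).comp (hf i)⟩

theorem select {f : ∀ i, Wires (α i) → Wires (β i)} (hf : PolyCircuits κ f)
    (e : ∀ i, γ i → β i) : PolyCircuits κ fun i x c => f i x (e i c) :=
  (wire e).comp hf

theorem pair {f : ∀ i, Wires (α i) → Wires (β i)} {g : ∀ i, Wires (α i) → Wires (γ i)}
    (hf : PolyCircuits κ f) (hg : PolyCircuits κ g) :
    PolyCircuits κ fun i x => (Sum.elim (f i x) (g i x) : Wires (β i ⊕ γ i)) :=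
  let ⟨s, hs, hf⟩ := hf
  let ⟨t, ht, hg⟩ := hg
  ⟨fun k => s k + t k, hs.add ht, fun i => (hf i).pair (hg i)⟩

/-- Outputs of polynomial number may be treated one by one. -/
theorem of_bits [∀ i, Finite (β i)] {L c : ℕ → ℕ} (hL : PolyBounded L) (hc : PolyBounded c)
    (hcard : ∀ i, Nat.card (β i) ≤ L (κ i)) {f : ∀ i, Wires (α i) → Wires (β i)}
    (h : ∀ i b, CircuitLE (fun x (_ : Unit) => f i x b) (c (κ i))) : PolyCircuits κ f :=
  ⟨fun k => L k * c k, hL.mul hc, fun i =>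
    (CircuitLE.bits (h i)).mono (Nat.mul_le_mul_right _ (hcard i))⟩

/-- All maps on a fixed finite number of wires. -/
theorem table {α : Type} [Finite α] [∀ i, Finite (β i)] {L : ℕ → ℕ} (hL : PolyBounded L)
    (hcard : ∀ i, Nat.card (β i) ≤ L (κ i)) (f : ∀ i, Wires α → Wires (β i)) :
    PolyCircuits κ f :=
  let ⟨_, hs⟩ := CircuitLE.exists_bound α Unit
  of_bits hL (.const _) hcard fun _ _ => hs _

theorem table' {α β : Type} [Finite α] [Finite β] (f : ι → Wires α → Wires β) :
    PolyCircuits κ f :=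
  table (.const _) (fun _ => le_rfl) f

theorem or [∀ i, Finite (β i)] {L : ℕ → ℕ} (hL : PolyBounded L)
    (hcard : ∀ i, Nat.card (β i) ≤ L (κ i)) {f g : ∀ i, Wires (α i) → Wires (β i)}
    (hf : PolyCircuits κ f) (hg : PolyCircuits κ g) :
    PolyCircuits κ fun i x b => f i x b || g i x b := by
  obtain ⟨s, hs, hf⟩ := hf
  obtain ⟨t, ht, hg⟩ := hg
  refine of_bits hL (((hs.add hs).add (.const 1)).add ((ht.add ht).add (.const 1)) |>.add
    (.const 1)) hcard fun i b => ?_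
  have h₁ := (hf i).select fun _ : Unit => b
  have h₂ := (hg i).select fun _ : Unit => b
  -- Disjunction is the NAND of the two negations.
  have := (h₁.nand h₁).nand (h₂.nand h₂)
  simpa using this

theorem and [∀ i, Finite (β i)] {L : ℕ → ℕ} (hL : PolyBounded L)
    (hcard : ∀ i, Nat.card (β i) ≤ L (κ i)) {f : ∀ i, Wires (α i) → Wires Unit}
    {g : ∀ i, Wires (α i) → Wires (β i)}
    (hf : PolyCircuits κ f) (hg : PolyCircuits κ g) :
    PolyCircuits κ fun i x b => f i x () && g i x b := by
  obtain ⟨s, hs, hf⟩ := hf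
  obtain ⟨t, ht, hg⟩ := hg
  refine of_bits hL (((hs.add ht).add (.const 1)).add ((hs.add ht).add (.const 1)) |>.add
    (.const 1)) hcard fun i b => ?_
  have h := ((hf i).select fun _ : Unit => ()).nand ((hg i).select fun _ : Unit => b)
  have := h.nand h
  simpa using this

end PolyCircuits

end Families

/-! ### From an adversary to a forger -/

section Forger

variable {P : Params} {S D : Type}

/-- The message to which the signatures refer that come with a command. -/
def subjectMsg (cmd : Option (Cmd P)) (s : State P S) : Str 224 :=
  match cmd.bind fun c => c.subject s with
  | some x => endorseMsg P x.1 x.2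
  | none => fun _ => false

open scoped Classical in
/-- The node and the message that it signs when it receives a command. -/
noncomputable def Env.request (E : Env P S D) (cmd : Option (Cmd P)) (s : State P S) :
    Option (Fin P.Nv × Str 224) :=
  match cmd with
  | some (.endorse j ℓ c) => if E.Signs j ℓ c s then some (j, endorseMsg P ℓ c) else none
  | _ => none

theorem subjectMsg_bitsState (E : Env P S D) (cmd : Option (Cmd P)) (s : State P S) :
    subjectMsg cmd (E.bitsState s) = subjectMsg cmd s := by
  unfold subjectMsg
  rcases cmd with _ | c
  · rfl
  · cases c <;> rfl

theorem Env.request_bits (E : Env P S D) (cmd : Option (Cmd P)) (s : State P S) :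
    E.bits.request cmd (E.bitsState s) = E.request cmd s := by
  rcases cmd with _ | c
  · rfl
  · cases c <;> rfl

/-- Whenever an honest node signs, its endorsement is recorded in the same round; so every query to
the signing oracle is about an endorsed vote code. -/
theorem Env.request_eq_some {E : Env P S D} {cmd : Option (Cmd P)} {s : State P S}
    {x : Fin P.Nv × Str 224} (h : E.request cmd s = some x) (σ : Fin P.Nv → S) :
    x.1 ∉ E.badV ∧ ∃ ℓ c, x.2 = endorseMsg P ℓ c ∧
      ((E.exec cmd σ s).vc x.1 ℓ).endorsed = some c := by
  unfold request at h
  split at h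
  case h_1 j ℓ c =>
    split at h
    case isTrue hs =>
      obtain rfl := Option.some.inj h
      refine ⟨hs.1, ℓ, c, rfl, ?_⟩
      simp only [exec, step, if_pos hs, State.setVc_vc_self]
    case isFalse => cases h
  case h_2 => cases h

theorem Env.bitsState_exec (E : Env P S D) (cmd : Option (Cmd P)) (σ : Fin P.Nv → S)
    (s : State P S) : E.bitsState (E.exec cmd σ s) = E.bits.exec cmd
      (fun j => E.verify j (subjectMsg cmd s) (σ j)) (E.bitsState s) := by
  rcases cmd with _ | c
  · rfl
  · refine E.bitsState_step c σ _ s fun x hx j => ?_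
    simp only [subjectMsg, Option.bind_some, hx]

theorem endorseMsg_injective {ℓ ℓ' : Fin P.n} {c c' : Code}
    (h : endorseMsg P ℓ c = endorseMsg P ℓ' c') : ℓ = ℓ' ∧ c = c' := by
  exact ⟨P.serial.injective (append_left_cancel h), append_right_cancel h⟩

variable {Sg : SigScheme 224} {H : HashFamily} {A : Adversary P Sg H} {k : ℕ}

theorem signature_eq (ω : Randomness A k) (t : ℕ) (s : State P (Str (Sg.sigLen k)))
    (cmd : Option (Cmd P)) : signature A k ω t s cmd =
      match (env A k ω).request cmd s with
      | some (j, m) => Sg.sign k (Sg.gen k (ω.keyCoins j)).2 m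
        (if h : t < A.machine.rounds k then ω.signCoins j ⟨t, h⟩ else fun _ => false)
      | none => fun _ => false := by
  rcases cmd with _ | c
  · rfl
  · cases c with
    | endorse j ℓ c =>
      simp only [signature, Env.request]
      split <;> rfl
    | _ => rfl

/-- Memory of the forger: memory of the adversary, state of the system without signature strings,
last signature if it was made by the forger. -/
abbrev SimMem (A : Adversary P Sg H) (k : ℕ) : Type :=
  A.machine.Mem k ⊕ (CodeWire (State P Bool) ⊕ Fin (Sg.sigLen k))

abbrev SimIn (A : Adversary P Sg H) (k : ℕ) : Type :=
  SimMem A k ⊕ (Fin 0 ⊕ (Fin (Sg.vkLen k) ⊕ Fin (Sg.sigLen k)))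

/-- Encodings of a command and of a state. -/
abbrev SimCore (P : Params) : Type := CodeWire (Cmd P) ⊕ CodeWire (State P Bool)

/-- The memory of a machine starts with all bits `false`, which need not encode the initial state;
round `0` is therefore treated separately. The other default value is never used in the simulation.
-/
noncomputable def simState (t : ℕ) (z : Wires (CodeWire (State P Bool))) : State P Bool :=
  if t = 0 then State.initial P Bool else (decode z).getD (State.initial P Bool)

noncomputable def SimCore.cmd (z : Wires (SimCore P)) : Option (Cmd P) := decode fun j => z (.inl j)

noncomputable def SimCore.state (t : ℕ) (z : Wires (SimCore P)) : State P Bool :=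
  simState t fun j => z (.inr j)

variable (i : Fin P.Nv) (ω : Randomness A k) (t : ℕ)

/-- The forger knows the verification key of the node `i` from its own input, and everything else
from fixed random choices. -/
noncomputable def simLeak : LeakWire P Sg H (LeakData P) k → Bool ⊕ Fin (Sg.vkLen k)
  | .vk j b => if j = i then .inr b else .inl (leak A k ω (.vk j b))
  | .sk j b => .inl (decide (j ≠ i) && leak A k ω (.sk j b))
  | w => .inl (leak A k ω w)

/-- The signature of the last round was made either by the forger itself and stored, or by its
oracle. The other string is all `false`, so their disjunction is the signature. -/
noncomputable def simInput (x : Wires (SimIn A k)) :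
    Wires (A.machine.Mem k ⊕ (Fin (A.machine.coins k) ⊕ (LeakWire P Sg H (LeakData P) k ⊕
      (CodeWire (State P Unit) ⊕ Fin (Sg.sigLen k))))) :=
  Sum.elim (fun j => x (.inl (.inl j))) (Sum.elim ω.coins (Sum.elim
    (fun w => Sum.elim id (fun b => x (.inr (.inr (.inl b)))) (simLeak i ω w))
    (Sum.elim (encode ((simState t fun j => x (.inl (.inr (.inl j)))).map fun _ => ()))
      fun j => x (.inl (.inr (.inr j))) || x (.inr (.inr (.inr j))))))

noncomputable def simOutput (x : Wires (SimIn A k)) :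
    Wires (A.machine.Mem k ⊕ (CodeWire (Cmd P) ⊕ (Fin P.Nv × Fin (Sg.sigLen k)))) :=
  A.machine.step k t (simInput i ω t x)

/-- This is the part of the data whose size does not depend on the security parameter, so any
function of it is a table. -/
noncomputable def simCore (x : Wires (SimIn A k)) : Wires (SimCore P) :=
  Sum.elim (fun j => simOutput i ω t x (.inr (.inl j))) fun j => x (.inl (.inr (.inl j)))

noncomputable def SimCore.msg (z : Wires (SimCore P)) : Str 224 :=
  subjectMsg (SimCore.cmd z) (SimCore.state t z)

noncomputable def SimCore.request (z : Wires (SimCore P)) : Option (Fin P.Nv × Str 224) :=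
  (env A k ω).bits.request (SimCore.cmd z) (SimCore.state t z)

/-- Input of the signature algorithm for the nodes other than `i`. -/
noncomputable def SimCore.signInput (z : Wires (SimCore P)) :
    Wires (Fin (Sg.skLen k) ⊕ (Fin 224 ⊕ Fin (Sg.signCoins k))) :=
  match SimCore.request ω t z with
  | some (j, m) => Sum.elim (Sg.gen k (ω.keyCoins j)).2 (Sum.elim m
    (if h : t < A.machine.rounds k then ω.signCoins j ⟨t, h⟩ else fun _ => false))
  | none => fun _ => false

/-- Does a node other than `i` sign? -/
noncomputable def SimCore.signs (z : Wires (SimCore P)) : Bool :=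
  match SimCore.request ω t z with
  | some (j, _) => decide (j ≠ i)
  | none => false

noncomputable def SimCore.asks (z : Wires (SimCore P)) : Bool :=
  match SimCore.request ω t z with
  | some (j, _) => decide (j = i)
  | none => false

noncomputable def SimCore.query (z : Wires (SimCore P)) : Str 224 :=
  match SimCore.request ω t z with
  | some (_, m) => m
  | none => fun _ => false

/-- The signature algorithm, applied to the parts of its input. -/
def SigScheme.signWires {L : ℕ} (Sg : SigScheme L) (k : ℕ)
    (x : Wires (Fin (Sg.skLen k) ⊕ (Fin L ⊕ Fin (Sg.signCoins k)))) : Str (Sg.sigLen k) :=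
  Sg.sign k (fun i => x (.inl i)) (fun i => x (.inr (.inl i))) fun i => x (.inr (.inr i))

def SigScheme.verifyWires {L : ℕ} (Sg : SigScheme L) (k : ℕ)
    (x : Wires (Fin (Sg.vkLen k) ⊕ (Fin L ⊕ Fin (Sg.sigLen k)))) (_ : Unit) : Bool :=
  Sg.verify k (fun i => x (.inl i)) (fun i => x (.inr (.inl i))) fun i => x (.inr (.inr i))

noncomputable def simKey (x : Wires (SimIn A k)) (j : Fin P.Nv) : Str (Sg.vkLen k) :=
  if j = i then fun b => x (.inr (.inr (.inl b))) else (Sg.gen k (ω.keyCoins j)).1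

noncomputable def simVerify (x : Wires (SimIn A k)) : Str P.Nv := fun j =>
  Sg.verifyWires k (Sum.elim (simKey i ω x j) (Sum.elim (SimCore.msg t (simCore i ω t x))
    fun b => simOutput i ω t x (.inr (.inr (j, b))))) ()

noncomputable def simNext (x : Wires (SimCore P ⊕ Fin P.Nv)) : Wires (CodeWire (State P Bool)) :=
  encode ((env A k ω).bits.exec (SimCore.cmd fun j => x (.inl j)) (fun j => x (.inr j))
    (SimCore.state t fun j => x (.inl j)))

/-- The forger runs the adversary and the system, with random choices `ω` that do not concern the
node `i`, and asks for the signatures of that node. -/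
noncomputable def forger (A : Adversary P Sg H) (i : Fin P.Nv) (ω : ∀ k, Randomness A k) :
    Forger Sg where
  rounds := A.machine.rounds
  Mem := SimMem A
  coins _ := 0
  step k t x :=
    Sum.elim
      (Sum.elim (fun j => simOutput i (ω k) t x (.inl j))
        (Sum.elim (simNext (ω k) t (Sum.elim (simCore i (ω k) t x) (simVerify i (ω k) t x)))
          fun b => SimCore.signs i (ω k) t (simCore i (ω k) t x) &&
            Sg.signWires k (SimCore.signInput (ω k) t (simCore i (ω k) t x)) b))
      (Sum.elim (fun _ => SimCore.asks i (ω k) t (simCore i (ω k) t x))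
        (Sum.elim (SimCore.query (ω k) t (simCore i (ω k) t x))
          (Sum.elim (SimCore.msg t (simCore i (ω k) t x))
            fun b => simOutput i (ω k) t x (.inr (.inr (i, b))))))

/-- Functions of commands and abstract states have constantly many input bits, so each output bit
has a circuit of constant size, even if its values come from fixed random choices. The rest consists
of the adversary's step, one signature, `Nv` verifications and rewiring. -/
theorem forger_efficient (hSg : Sg.Efficient) (hA : A.machine.Efficient)
    (ω : ∀ k, Randomness A k) : (forger A i ω).Efficient := by
  obtain ⟨hr, s, hs, hst⟩ := hA
  obtain ⟨⟨-, hsk, hsig, -, hsc⟩, -, hsign, hver⟩ := hSg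
  refine ⟨hr, ?_⟩
  -- Indexing by security parameter and round together gives one bound for all rounds.
  let ι := Σ k, Fin (A.machine.rounds k)
  let κ : ι → ℕ := Sigma.fst
  have hstep : PolyCircuits κ fun q : ι => A.machine.step q.1 q.2 :=
    ⟨s, hs, fun q => hst q.1 q.2 q.2.2⟩
  have hleak : PolyCircuits κ fun (q : ι) (x : Wires (SimIn A q.1)) w =>
      (Sum.elim id (fun b => x (.inr (.inr (.inl b)))) (simLeak i (ω q.1) w) : Bool) := by
    have := PolyCircuits.rewire (κ := κ) (α := fun q : ι => SimIn A q.1)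
      fun (q : ι) w => (simLeak i (ω q.1) w).map id fun b => .inr (.inr (.inl b))
    refine cast (congrArg _ ?_) this
    funext q x w
    rcases simLeak i (ω q.1) w with b | b <;> rfl
  have hmem : PolyCircuits κ fun (q : ι) (x : Wires (SimIn A q.1))
      (j : CodeWire (State P Bool)) => x (.inl (.inr (.inl j))) :=
    .wire (α := fun q : ι => SimIn A q.1) fun q j => .inl (.inr (.inl j))
  have hstate : PolyCircuits κ fun (q : ι) (x : Wires (SimIn A q.1)) =>
      encode ((simState (P := P) q.2 fun j => x (.inl (.inr (.inl j)))).map fun _ => ()) :=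
    (PolyCircuits.table' fun (q : ι) z => encode ((simState (P := P) q.2 z).map fun _ => ())).comp
      hmem
  have hout : PolyCircuits κ fun (q : ι) (x : Wires (SimIn A q.1)) (j : Fin (Sg.sigLen q.1)) =>
      x (.inl (.inr (.inr j))) || x (.inr (.inr (.inr j))) :=
    .or (L := Sg.sigLen) hsig (fun q => by simp [κ])
      (.wire (α := fun q : ι => SimIn A q.1) fun q j => .inl (.inr (.inr j)))
      (.wire (α := fun q : ι => SimIn A q.1) fun q j => .inr (.inr (.inr j)))
  have hinput : PolyCircuits κ fun (q : ι) => simInput (A := A) i (ω q.1) q.2 :=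
    .pair (.wire (α := fun q : ι => SimIn A q.1) fun q j => .inl (.inl j)) (.pair (.const fun q : ι => (ω q.1).coins)
      (.pair hleak (.pair hstate hout)))
  have houtput : PolyCircuits κ fun (q : ι) => simOutput (A := A) i (ω q.1) q.2 :=
    hstep.comp hinput
  have hcore : PolyCircuits κ fun (q : ι) => simCore (A := A) i (ω q.1) q.2 :=
    .pair (houtput.select fun q j => .inr (.inl j)) hmem
  have hmsg : PolyCircuits κ fun (q : ι) (x : Wires (SimIn A q.1)) =>
      SimCore.msg q.2 (simCore i (ω q.1) q.2 x) :=
    (PolyCircuits.table' fun (q : ι) => SimCore.msg (P := P) q.2).comp hcore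
  have hquery : PolyCircuits κ fun (q : ι) (x : Wires (SimIn A q.1)) =>
      SimCore.query (ω q.1) q.2 (simCore i (ω q.1) q.2 x) :=
    (PolyCircuits.table' fun (q : ι) => SimCore.query (ω q.1) q.2).comp hcore
  have hasks : PolyCircuits κ fun (q : ι) (x : Wires (SimIn A q.1)) (_ : Unit) =>
      SimCore.asks i (ω q.1) q.2 (simCore i (ω q.1) q.2 x) :=
    (PolyCircuits.table' fun (q : ι) x (_ : Unit) => SimCore.asks i (ω q.1) q.2 x).comp hcore
  have hsigns : PolyCircuits κ fun (q : ι) (x : Wires (SimIn A q.1)) (_ : Unit) =>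
      SimCore.signs i (ω q.1) q.2 (simCore i (ω q.1) q.2 x) :=
    (PolyCircuits.table' fun (q : ι) x (_ : Unit) => SimCore.signs i (ω q.1) q.2 x).comp hcore
  have hsignInput : PolyCircuits κ fun (q : ι) (x : Wires (SimIn A q.1)) =>
      SimCore.signInput (ω q.1) q.2 (simCore i (ω q.1) q.2 x) :=
    (PolyCircuits.table (L := fun k => Sg.skLen k + (224 + Sg.signCoins k))
      (hsk.add ((PolyBounded.const 224).add hsc)) (fun q => by simp [κ])
      fun (q : ι) => SimCore.signInput (ω q.1) q.2).comp hcore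
  have hstored : PolyCircuits κ fun (q : ι) (x : Wires (SimIn A q.1)) b =>
      SimCore.signs i (ω q.1) q.2 (simCore i (ω q.1) q.2 x) &&
        Sg.signWires q.1 (SimCore.signInput (ω q.1) q.2 (simCore i (ω q.1) q.2 x)) b :=
    .and (L := Sg.sigLen) hsig (fun q => by simp [κ]) hsigns
      ((PolyCircuits.of_polySize hsign).comp hsignInput)
  have hkey : ∀ j, PolyCircuits κ fun (q : ι) (x : Wires (SimIn A q.1)) =>
      simKey i (ω q.1) x j := fun j => by
    unfold simKey
    by_cases h : j = i
    · simp only [if_pos h]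
      exact .wire (α := fun q : ι => SimIn A q.1) fun q b => .inr (.inr (.inl b))
    · simp only [if_neg h]
      exact .const _
  have hverify : PolyCircuits κ fun (q : ι) (x : Wires (SimIn A q.1)) =>
      simVerify i (ω q.1) q.2 x := by
    have h : ∀ j, PolyCircuits κ fun (q : ι) (x : Wires (SimIn A q.1)) (_ : Unit) =>
        simVerify i (ω q.1) q.2 x j := fun j =>
      (PolyCircuits.of_polySize hver).comp ((hkey j).pair
        (hmsg.pair (houtput.select fun q b => .inr (.inr (j, b)))))
    choose c hc h using h
    refine .of_bits (L := fun _ => P.Nv) (c := fun k => ∑ j, c j k) (.const _) ?_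
      (fun q => by simp) fun q j =>
        (h j q).mono (Finset.single_le_sum (f := fun j => c j (κ q)) (fun _ _ => Nat.zero_le _)
          (Finset.mem_univ j))
    have : ∀ s : Finset (Fin P.Nv), PolyBounded fun k => ∑ j ∈ s, c j k := fun s => by
      classical
      induction s using Finset.induction_on with
      | empty => exact .const 0
      | insert a s ha ih => simpa [Finset.sum_insert ha] using (hc a).add ih
    exact this _
  have hnext : PolyCircuits κ fun (q : ι) (x : Wires (SimIn A q.1)) =>
      simNext (ω q.1) q.2 (Sum.elim (simCore i (ω q.1) q.2 x) (simVerify i (ω q.1) q.2 x)) :=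
    (PolyCircuits.table' fun (q : ι) => simNext (ω q.1) q.2).comp (hcore.pair hverify)
  have : PolyCircuits κ fun (q : ι) => (forger A i ω).step q.1 q.2 :=
    .pair (.pair (houtput.select fun q j => .inl j) (.pair hnext hstored))
      (.pair hasks (.pair hquery (.pair hmsg (houtput.select fun q b => .inr (.inr (i, b))))))
  obtain ⟨s, hs, h⟩ := this
  exact ⟨s, hs, fun k t ht => h ⟨k, t, ht⟩⟩

end Forger

/-! ### Forgeries are unlikely -/

section Forgery

variable {P : Params} {Sg : SigScheme 224} {H : HashFamily} {A : Adversary P Sg H} {k : ℕ}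

/-- Random choices of the node `i` and of the forger. -/
abbrev KeyRandomness (A : Adversary P Sg H) (k : ℕ) : Type :=
  Str (Sg.genCoins k) × (Fin (A.machine.rounds k) → Str (Sg.signCoins k)) × Str 0

def Randomness.withKey (ω : Randomness A k) (i : Fin P.Nv) (κ : KeyRandomness A k) :
    Randomness A k :=
  { ω with
    keyCoins := Function.update ω.keyCoins i κ.1
    signCoins := Function.update ω.signCoins i κ.2.1 }

variable {i : Fin P.Nv} {ω : Randomness A k} {κ : KeyRandomness A k} {t : ℕ}

/-- For an honest node only the verification key leaks, and the forger knows it; everything else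
that leaks does not depend on the key of that node. -/
theorem leak_withKey (hi : i ∉ A.badV k) (w : LeakWire P Sg H (LeakData P) k) :
    (Sum.elim id (Sg.gen k κ.1).1 (simLeak i ω w) : Bool) = leak A k (ω.withKey i κ) w := by
  have hdata : leakData (env A k (ω.withKey i κ)) = leakData (env A k ω) := rfl
  cases w with
  | data j => simp only [simLeak, leak, hdata, Sum.elim_inl, id]
  | hashKey j => rfl
  | mskDigest j => rfl
  | digest ℓ p j => rfl
  | vk j b =>
    by_cases h : j = i
    · subst h; simp [simLeak, leak, Randomness.withKey]
    · simp [simLeak, leak, Randomness.withKey, h]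
  | sk j b =>
    by_cases h : j = i
    · subst h; simp [simLeak, leak, hi]
    · simp [simLeak, leak, Randomness.withKey, h]

/-- The forger holds the configuration `x` of the execution after `t` rounds. -/
structure Simulates (i : Fin P.Nv) (ω : Randomness A k) (t : ℕ) (x : Config A k)
    (mem : Wires (SimMem A k)) (answer : Str (Sg.sigLen k)) (queried : Set (Str 224)) : Prop where
  memory : ∀ j, mem (.inl j) = x.mem j
  state : simState t (fun j => mem (.inr (.inl j))) = (env A k ω).bitsState x.state
  out : ∀ j, (mem (.inr (.inr j)) || answer j) = x.out j
  endorsed : ∀ m ∈ queried, ∃ ℓ c, m = endorseMsg P ℓ c ∧ (x.state.vc i ℓ).endorsed = some c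

section Step

variable {x : Config A k} {mem : Wires (SimMem A k)} {answer : Str (Sg.sigLen k)}
  {queried : Set (Str 224)}

/-- Input of the forger. -/
def simIn (κ : KeyRandomness A k) (mem : Wires (SimMem A k)) (answer : Str (Sg.sigLen k)) :
    Wires (SimIn A k) :=
  Sum.elim mem (Sum.elim κ.2.2 (Sum.elim (Sg.gen k κ.1).1 answer))

theorem Simulates.output (hi : i ∉ A.badV k)
    (h : Simulates i (ω.withKey i κ) t x mem answer queried) :
    simOutput i ω t (simIn κ mem answer) = advOutput A k (ω.withKey i κ) t x := by
  unfold simOutput advOutput simInput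
  congr 1
  have h₁ : (fun j => simIn κ mem answer (.inl (.inl j))) = x.mem := funext h.memory
  have h₂ : (fun w => (Sum.elim id (fun b => simIn κ mem answer (.inr (.inr (.inl b))))
      (simLeak i ω w) : Bool)) = leak A k (ω.withKey i κ) := funext fun w => leak_withKey hi w
  have h₃ : (simState t fun j => simIn κ mem answer (.inl (.inr (.inl j)))) =
      (env A k (ω.withKey i κ)).bitsState x.state := h.state
  have h₄ : (fun j => simIn κ mem answer (.inl (.inr (.inr j))) ||
      simIn κ mem answer (.inr (.inr (.inr j)))) = x.out := funext h.out
  rw [h₁, h₂, h₃, h₄, Env.bitsState_map]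
  rfl

theorem Simulates.cmd (hi : i ∉ A.badV k)
    (h : Simulates i (ω.withKey i κ) t x mem answer queried) :
    SimCore.cmd (simCore i ω t (simIn κ mem answer)) = advCmd A k (ω.withKey i κ) t x := by
  unfold SimCore.cmd simCore advCmd
  simp only [Sum.elim_inl, h.output hi]

theorem Simulates.coreState (h : Simulates i (ω.withKey i κ) t x mem answer queried) :
    SimCore.state t (simCore i ω t (simIn κ mem answer)) =
      (env A k (ω.withKey i κ)).bitsState x.state := h.state

theorem Simulates.msg (hi : i ∉ A.badV k)
    (h : Simulates i (ω.withKey i κ) t x mem answer queried) :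
    SimCore.msg t (simCore i ω t (simIn κ mem answer)) =
      subjectMsg (advCmd A k (ω.withKey i κ) t x) x.state := by
  rw [SimCore.msg, h.cmd hi, h.coreState, subjectMsg_bitsState]

theorem Simulates.request (hi : i ∉ A.badV k)
    (h : Simulates i (ω.withKey i κ) t x mem answer queried) :
    SimCore.request ω t (simCore i ω t (simIn κ mem answer)) =
      (env A k (ω.withKey i κ)).request (advCmd A k (ω.withKey i κ) t x) x.state := by
  rw [SimCore.request, h.cmd hi, h.coreState, ← Env.request_bits]
  rfl

theorem Simulates.verify (hi : i ∉ A.badV k)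
    (h : Simulates i (ω.withKey i κ) t x mem answer queried) (j : Fin P.Nv) :
    simVerify i ω t (simIn κ mem answer) j = (env A k (ω.withKey i κ)).verify j
      (subjectMsg (advCmd A k (ω.withKey i κ) t x) x.state)
      (advSigs A k (ω.withKey i κ) t x j) := by
  have hkey : simKey i ω (simIn κ mem answer) j =
      (Sg.gen k ((ω.withKey i κ).keyCoins j)).1 := by
    unfold simKey Randomness.withKey
    split
    case isTrue hj => subst hj; simp [simIn]
    case isFalse hj => simp [hj]
  unfold simVerify
  rw [hkey, h.msg hi, h.output hi]
  rfl

theorem Simulates.next (hi : i ∉ A.badV k)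
    (h : Simulates i (ω.withKey i κ) t x mem answer queried) :
    simNext ω t (Sum.elim (simCore i ω t (simIn κ mem answer))
      (simVerify i ω t (simIn κ mem answer))) =
      encode ((env A k (ω.withKey i κ)).bitsState (next A k (ω.withKey i κ) t x).state) := by
  have hv : simVerify i ω t (simIn κ mem answer) = _ := funext fun j => h.verify hi j
  unfold simNext
  simp only [Sum.elim_inl, Sum.elim_inr]
  rw [h.cmd hi, h.coreState, hv]
  simp only [_root_.next]
  rw [Env.bitsState_exec]
  rfl

end Step

/-- The forger's memory follows the real execution exactly, for all choices of the key and of the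
signing coins of node `i`, and not just in distribution. -/
theorem simulates_forgeRun (hi : i ∉ A.badV k) (ω : ∀ k, Randomness A k)
    (κ : KeyRandomness A k) (t : ℕ) :
    let s := forgeRun Sg (forger A i ω) k κ.1 κ.2.1 κ.2.2 t
    Simulates i ((ω k).withKey i κ) t (run A k ((ω k).withKey i κ) t) s.mem s.answer s.queried := by
  induction t with
  | zero =>
    refine ⟨fun _ => rfl, ?_, fun _ => rfl, fun m hm => hm.elim⟩
    rw [simState, if_pos rfl]
    rfl
  | succ t ih =>
    dsimp only at ih ⊢
    set s := forgeRun Sg (forger A i ω) k κ.1 κ.2.1 κ.2.2 t with hs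
    set x := run A k ((ω k).withKey i κ) t
    have hreq := ih.request hi
    rw [run_succ]
    refine ⟨fun j => ?_, ?_, fun b => ?_, fun m hm => ?_⟩
    · exact congrFun (ih.output hi) (.inl j)
    · have : simState (t + 1) (encode ((env A k ((ω k).withKey i κ)).bitsState
          (next A k ((ω k).withKey i κ) t x).state)) = (env A k ((ω k).withKey i κ)).bitsState
            (next A k ((ω k).withKey i κ) t x).state := by
        rw [simState, if_neg t.succ_ne_zero, decode_encode, Option.getD_some]
      rw [← this, ← ih.next hi]
      rfl
    -- If node `i` signs, the oracle answers with its coins of this round and the stored string is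
    -- blank; if another node signs, it is the other way round.
    · change ((SimCore.signs i (ω k) t (simCore i (ω k) t (simIn κ s.mem s.answer)) &&
          Sg.signWires k (SimCore.signInput (ω k) t
            (simCore i (ω k) t (simIn κ s.mem s.answer))) b) ||
        (if SimCore.asks i (ω k) t (simCore i (ω k) t (simIn κ s.mem s.answer)) = true then
          Sg.sign k (Sg.gen k κ.1).2
            (SimCore.query (ω k) t (simCore i (ω k) t (simIn κ s.mem s.answer)))
            (if h : t < A.machine.rounds k then κ.2.1 ⟨t, h⟩ else fun _ => false)
        else fun _ => false) b) = signature A k _ t x.state _ b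
      rw [signature_eq]
      unfold SimCore.signs SimCore.asks SimCore.query SimCore.signInput SigScheme.signWires
      rw [hreq]
      rcases (env A k ((ω k).withKey i κ)).request
        (advCmd A k ((ω k).withKey i κ) t x) x.state with _ | ⟨j, m⟩
      · rfl
      · by_cases hj : j = i
        · subst hj
          simp [Randomness.withKey]
        · simp [Randomness.withKey, hj]
    -- Old queries remain endorsed by monotonicity, and a new one is endorsed in the round in which
    -- it is made.
    · change m ∈ (if SimCore.asks i (ω k) t (simCore i (ω k) t (simIn κ s.mem s.answer)) = true
        then insert (SimCore.query (ω k) t (simCore i (ω k) t (simIn κ s.mem s.answer))) s.queried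
        else s.queried) at hm
      have hold : ∀ m ∈ s.queried, ∃ ℓ c, m = endorseMsg P ℓ c ∧
          ((next A k ((ω k).withKey i κ) t x).state.vc i ℓ).endorsed = some c := fun m hm => by
        obtain ⟨ℓ, c, h₁, h₂⟩ := ih.endorsed m hm
        exact ⟨ℓ, c, h₁, ((Env.exec_le _ ℓ _ _ _).vc i ℓ).endorsed c h₂⟩
      unfold SimCore.asks SimCore.query at hm
      rw [hreq] at hm
      rcases hr : (env A k ((ω k).withKey i κ)).request
        (advCmd A k ((ω k).withKey i κ) t x) x.state with _ | ⟨j, m'⟩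
      · rw [hr] at hm
        exact hold m (by simpa using hm)
      · rw [hr] at hm
        by_cases hj : j = i
        · subst hj
          rcases (by simpa using hm : m = m' ∨ m ∈ s.queried) with rfl | hm
          · exact (Env.request_eq_some hr _).2
          · exact hold m hm
        · exact hold m (by simpa [hj] using hm)

/-- A signature of the honest node `i` on a vote code that it has not endorsed is used. -/
def ForgeEvent (A : Adversary P Sg H) (k : ℕ) (i : Fin P.Nv) (ω : Randomness A k) : Prop :=
  ∃ t < A.machine.rounds k, ∃ c, advCmd A k ω t (run A k ω t) = some c ∧
    (env A k ω).Forges c (advSigs A k ω t (run A k ω t)) (run A k ω t).state i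

theorem forgeRun_won_mono {L k : ℕ} {Sg : SigScheme L} {M : Forger Sg} {r : Str (Sg.genCoins k)}
    {r' : Fin (M.rounds k) → Str (Sg.signCoins k)} {r'' : Str (M.coins k)} {t t' : ℕ}
    (h : t ≤ t') (hw : (forgeRun Sg M k r r' r'' t).won) : (forgeRun Sg M k r r' r'' t').won := by
  induction t', h using Nat.le_induction with
  | base => exact hw
  | succ t' _ ih => exact .inl ih

/-- In each round the forger offers the adversary's string for node `i` on the current subject. In a
forging round this vote code is not endorsed by `i`, which endorses at most one code, so it was
never queried. -/
theorem forgeRun_won (ω : ∀ k, Randomness A k) (κ : KeyRandomness A k)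
    (h : ForgeEvent A k i ((ω k).withKey i κ)) :
    (forgeRun Sg (forger A i ω) k κ.1 κ.2.1 κ.2.2 ((forger A i ω).rounds k)).won := by
  obtain ⟨t, ht, c, hc, hi, y, hy, hv, hn⟩ := h
  have hsim := simulates_forgeRun hi ω κ t
  have hmsg : subjectMsg (advCmd A k ((ω k).withKey i κ) t (run A k ((ω k).withKey i κ) t))
      (run A k ((ω k).withKey i κ) t).state = endorseMsg P y.1 y.2 := by
    simp only [subjectMsg, hc, Option.bind_some, hy]
  have hm := (hsim.msg hi).trans hmsg
  have hsig := congrArg (fun f => fun b => f (.inr (.inr (i, b)))) (hsim.output hi)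
  have hkey : Sg.gen k (((ω k).withKey i κ).keyCoins i) = Sg.gen k κ.1 := by
    simp [Randomness.withKey]
  refine forgeRun_won_mono (Nat.succ_le_of_lt ht) (.inr ⟨?_, fun hq => ?_⟩)
  · refine Eq.trans ?_ hv
    change Sg.verify k _ _ _ = Sg.verify k _ _ _
    rw [hkey, ← hm]
    exact congrArg _ hsig
  · obtain ⟨ℓ, c', h₁, h₂⟩ := hsim.endorsed _ hq
    obtain ⟨rfl, rfl⟩ := endorseMsg_injective (hm.symm.trans h₁)
    exact hn h₂

/-- For each security parameter the randomness other than the key and signing coins of node `i` is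
fixed at a value that is no worse than average. This is non-uniform advice, built into the circuits
of the forger. -/
theorem exists_negligible_prob_forgeEvent_le (hSg : Sg.Efficient) (hUnf : Sg.Unforgeable)
    (hA : A.machine.Efficient) (i : Fin P.Nv) :
    ∃ f, Negligible f ∧ ∀ k, prob (ForgeEvent A k i) ≤ f k := by
  by_cases hne : ∀ k, Nonempty (Randomness A k)
  · have h : ∀ k, ∃ ω₀ : Randomness A k,
        prob (ForgeEvent A k i) ≤ prob fun κ => ForgeEvent A k i (ω₀.withKey i κ) := fun k =>
      exists_prob_le_patch
        (fun ω : Randomness A k => (ω.keyCoins i, ω.signCoins i, fun _ => false))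
        (fun ω κ => ω.withKey i κ)
        (fun ω κ => by
          simp only [Randomness.withKey, Function.update_self]
          exact Prod.ext rfl (Prod.ext rfl (Subsingleton.elim _ _)))
        (fun ω κ => by simp [Randomness.withKey]) _
    choose ω hω using h
    exact ⟨_, hUnf (forger A i ω) (forger_efficient i hSg hA ω), fun k =>
      (hω k).trans (prob_mono fun κ h => forgeRun_won ω κ h)⟩
  -- Only the setup can fail to exist, and it does not depend on the security parameter; then all
  -- probabilities are `0`.
  · refine ⟨0, .zero, fun k => ?_⟩
    have : IsEmpty (Randomness A k) := by
      by_contra hk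
      rw [not_isEmpty_iff] at hk
      obtain ⟨ω⟩ := hk
      exact hne fun k => ⟨⟨ω.setup, fun _ => false, fun _ _ => false, fun _ _ _ => false,
        fun _ => false⟩⟩
    exact (prob_of_isEmpty _).le

end Forgery

/-! ### Safety -/

section Safety

variable {P : Params} {Sg : SigScheme 224} {H : HashFamily} {A : Adversary P Sg H} {k : ℕ}

/-- Two strings of `w` bits collide. -/
def CollisionEvent (A : Adversary P Sg H) (k w : ℕ) (ω : Randomness A k) : Prop :=
  ∃ p ∈ (Finset.univ : Finset (Str w × Str w)),
    p.1 ≠ p.2 ∧ H.hash k ω.hashKey w p.1 = H.hash k ω.hashKey w p.2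

/-- The event depends on the hash key alone, so fixing everything else by averaging loses nothing.
-/
theorem prob_collisionEvent_le (w : ℕ) : prob (CollisionEvent A k w) ≤
    prob fun κ : Str (H.keyLen k) => ∃ p ∈ (Finset.univ : Finset (Str w × Str w)),
      p.1 ≠ p.2 ∧ H.hash k κ w p.1 = H.hash k κ w p.2 := by
  rcases isEmpty_or_nonempty (Randomness A k) with h | h
  · rw [prob_of_isEmpty]
    exact prob_nonneg _
  · obtain ⟨ω₀, h⟩ := exists_prob_le_patch (fun ω : Randomness A k => ω.hashKey)
      (fun ω κ => { ω with hashKey := κ }) (fun _ _ => rfl) (fun _ _ => rfl) (CollisionEvent A k w)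
    exact h

theorem injective_of_not_collisionEvent {w : ℕ} {ω : Randomness A k}
    (h : ¬ CollisionEvent A k w ω) : Function.Injective ((env A k ω).hash w) := fun a b hab => by
  by_contra hne
  exact h ⟨(a, b), Finset.mem_univ _, hne, hab⟩

theorem inv_run {v : Fin P.n} {ω : Randomness A k} (hbV : (A.badV k).card ≤ P.fv)
    (hbB : (A.badB k).card ≤ P.fb) (hH : (env A k ω).HashInjective)
    (hF : ∀ i, ¬ ForgeEvent A k i ω) (hG : ¬ GuessEvent A k v ω) :
    ∀ t ≤ A.machine.rounds k, (env A k ω).Inv v (run A k ω t).state := by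
  intro t
  induction t with
  | zero => intro _; exact Env.Inv.initial _ v
  | succ t ih =>
    intro ht
    have ih := ih (Nat.le_of_succ_le ht)
    rw [run_succ]
    simp only [next, Env.exec]
    split
    case h_1 c hc =>
      exact ih.step hH hbV hbB (fun j h => hF j ⟨t, ht, c, hc, h⟩)
        fun h => hG (guessEvent_of_guesses ht hc h)
    case h_2 => exact ih

/-- A violation needs a hash collision, a forgery or a lucky guess. -/
theorem violation_cases (hv : 3 * P.fv < P.Nv) (hb : 2 * P.fb < P.Nb) (ht : 1 ≤ P.ht)
    (htN : P.ht ≤ P.Nt) (hbV : (A.badV k).card ≤ P.fv) (hbB : (A.badB k).card ≤ P.fb)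
    (hbT : (A.badT k).card ≤ P.Nt - P.ht) {v : Fin P.n} {ω : Randomness A k}
    (h : (env A k ω).Violation v (finalState A k ω)) :
    ((∃ i ∈ Finset.univ, ForgeEvent A k i ω) ∨
      (CollisionEvent A k 224 ω ∨ CollisionEvent A k 192 ω)) ∨ GuessEvent A k v ω := by
  by_contra! hn
  obtain ⟨⟨hF, hc, hk⟩, hG⟩ := hn
  have hH : (env A k ω).HashInjective :=
    ⟨injective_of_not_collisionEvent hc, injective_of_not_collisionEvent hk⟩
  obtain ⟨-, ha, o, ho, hni⟩ := h
  exact hni ((inv_run hbV hbB hH (fun i => hF i (Finset.mem_univ i)) hG _ le_rfl).included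
    hH hv hbV hb hbB ht htN hbT ha ho)

end Safety

theorem theorem2 (P : Params)
    (hv : 3 * P.fv < P.Nv) (hv64 : P.fv < 2 ^ 64) (hb : 2 * P.fb < P.Nb)
    (ht : 1 ≤ P.ht) (htN : P.ht ≤ P.Nt)
    (Sg : SigScheme 224) (hSg : Sg.Efficient) (hUnf : Sg.Unforgeable)
    (H : HashFamily) (hCol : H.CollisionResistant)
    (A : Adversary P Sg H) (hA : A.machine.Efficient)
    (hbadV : ∀ k, (A.badV k).card ≤ P.fv)
    (hbadB : ∀ k, (A.badB k).card ≤ P.fb)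
    (hbadT : ∀ k, (A.badT k).card ≤ P.Nt - P.ht) :
    ∃ negl : ℕ → ℝ, Negligible negl ∧
      ∀ (k : ℕ) (ℓ : Fin P.n),
        prob (fun ω : Randomness A k => (env A k ω).Violation ℓ (finalState A k ω)) ≤
          negl k + (P.fv : ℝ) / ((2 : ℝ) ^ 64 - (P.fv : ℝ)) := by
  choose f hf hforge using exists_negligible_prob_forgeEvent_le hSg hUnf hA
  refine ⟨_, (Negligible.sum Finset.univ fun i _ => hf i).add
    ((hCol.negligible_not_injective 224).add (hCol.negligible_not_injective 192)), fun k ℓ => ?_⟩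
  have hv64' : (P.fv : ℝ) < 2 ^ 64 := by exact_mod_cast hv64
  refine (prob_mono fun ω h => violation_cases hv hb ht htN (hbadV k) (hbadB k) (hbadT k) h).trans
    ((prob_or_le _ _).trans (add_le_add ((prob_or_le _ _).trans (add_le_add ?_
      ((prob_or_le _ _).trans (add_le_add ?_ ?_)))) ?_))
  · exact (prob_exists_mem_le _ _).trans (Finset.sum_le_sum fun i _ => hforge i k)
  · exact prob_collisionEvent_le 224
  · exact prob_collisionEvent_le 192
  -- The guesses contribute at most `fv / 2 ^ 64`, which is stronger than needed; the smaller
  -- denominator is positive by `hv64`.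
  · refine (prob_guessEvent_le ℓ (hbadV k)).trans ?_
    refine div_le_div_of_nonneg_left (Nat.cast_nonneg _) (by linarith) ?_
    linarith [(Nat.cast_nonneg P.fv : (0 : ℝ) ≤ P.fv)]
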